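/- Theorem (interaction Morawetz estimate). There is an absolute constant $C>0$ such that the following holds. Let $d\ge 3$ and $T>0$, and write $x=(y,z)\in\mathbb R^3\times\mathbb R^{d-3}=\mathbb R^d$. Let $u:[0,T]\times\mathbb R^d\to\mathbb C$ be a regular solution of $$ i\,u_t+\sum_{\alpha,\beta=1}^d\partial_\alpha\big(g^{\alpha\beta}\partial_\beta u\big)=\mathfrak N,\qquad u|_{t=0}=u_0, $$ where $g^{\alpha\beta}=\delta_{\alpha\beta}+h^{\alpha\beta}$ with $h^{\alpha\beta}=h^{\beta\alpha}$ real-valued and bounded (no smallness of $h$ is needed). Here $h$ and $\mathfrak N$ are functions of $(t,x)$, for instance the values $h(u)$ and $\mathfrak N(u,\nabla u)$ along the solution. "Regular" means that the $x$-derivatives of $u$, $h^{\alpha\beta}$ and $\mathfrak N$ up to the orders $3$, $2$ and $1$, respectively, exist and are continuous on $[0,T]\times\mathbb R^d$; that those of $u$ and $\mathfrak N$ are bounded in $L^2(\mathbb R^d)$ uniformly in $t\in[0,T]$; that those of $h^{\alpha\beta}$ are bounded on $[0,T]\times\mathbb R^d$; and that $u$ is differentiable in $t$ and the equation holds pointwise.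 Put $a(y)=|y|$ and $$ M(s)=\int_{\mathbb R^3\times\mathbb R^3}\int\frac{|u|^2}{2}(s,\mathfrak y,z)\,dz\;\nabla_y a(y-\mathfrak y)\cdot\int \mathrm{Im}(u\nabla_y\bar u)(s,y,z)\,dz\;d\mathfrak y\,dy , $$ where $dz$-integrals are over $\mathbb R^{d-3}$. In the formulas below the time variable $s$ is suppressed and $(\mathfrak y)$, $(y)$ indicate the point of $\mathbb R^3$ at which the functions under a $dz$-integral are evaluated. Then for every $t\in[0,T]$ all integrals over $\mathbb R^3\times\mathbb R^3$ and over $[0,t]\times\mathbb R^3\times\mathbb R^3$ below converge absolutely, and $$\begin{aligned} \big\|\|u\|_{L^2_z}\big\|_{L^4_{t,y}([0,t]\times\mathbb R^3)}^4&=\int_0^t\int_{\mathbb R^3}\Big(\int|u|^2dz\Big)^2dy\,ds\\ &\le C\Big\{-\big(M(t)-M(0)\big)\\ &\quad+\Big|\int_0^t\!\!\int_{\mathbb R^3\times\mathbb R^3}\int\mathrm{Im}(\mathfrak N\bar u)(\mathfrak y)\,dz\;\nabla_ya(y-\mathfrak y)\cdot\int\mathrm{Im}(u\nabla_y\bar u)(y)\,dz\;d\mathfrak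 y\,dy\,ds\Big|\\ &\quad+\Big|\int_0^t\!\!\int_{\mathbb R^3\times\mathbb R^3}\int\frac{|u|^2}{2}(\mathfrak y)\,dz\;\nabla_ya(y-\mathfrak y)\cdot\int\big[\mathrm{Re}(u\nabla_y\overline{\mathfrak N})-\mathrm{Re}(\mathfrak N\nabla_y\bar u)\big](y)\,dz\;d\mathfrak y\,dy\,ds\Big|+\mathcal H\Big\}, \end{aligned}$$ where $$\begin{aligned} \mathcal H&=\sum_{k,\alpha=1}^3\sum_{\beta=1}^d\Big|\int_0^t\!\!\int_{\mathbb R^3\times\mathbb R^3}\int\mathrm{Im}(h^{\alpha\beta}u\,\partial_\beta\bar u)(\mathfrak y)\,dz\;\partial_{y_\alpha}\partial_{y_k}a(y-\mathfrak y)\int\mathrm{Im}(u\,\partial_{y_k}\bar u)(y)\,dz\;d\mathfrak y\,dy\,ds\Big|\\ &+\sum_{\alpha=1}^3\sum_{\beta=1}^d\Big|\int_0^t\!\!\int_{\mathbb R^3\times\mathbb R^3}\int\frac{|u|^2}{2}(\mathfrak y)\,dz\;\Delta_y\partial_{y_\alpha}a(y-\mathfrak y)\int\mathrm{Re}(u\,h^{\alpha\beta}\partial_\beta\bar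 u)(y)\,dz\;d\mathfrak y\,dy\,ds\Big|\\ &+2\sum_{k,\alpha=1}^3\sum_{\beta=1}^d\Big|\int_0^t\!\!\int_{\mathbb R^3\times\mathbb R^3}\int\frac{|u|^2}{2}(\mathfrak y)\,dz\;\partial_{y_\alpha}\partial_{y_k}a(y-\mathfrak y)\int\mathrm{Re}(\partial_{y_k}u\,h^{\alpha\beta}\partial_\beta\bar u)(y)\,dz\;d\mathfrak y\,dy\,ds\Big|\\ &+\sum_{k=1}^3\sum_{\alpha,\beta=1}^d\Big|\int_0^t\!\!\int_{\mathbb R^3\times\mathbb R^3}\int\frac{|u|^2}{2}(\mathfrak y)\,dz\;\frac{y_k-\mathfrak y_k}{|y-\mathfrak y|}\int\mathrm{Re}(\partial_\alpha u\,\partial_{y_k}h^{\alpha\beta}\,\partial_\beta\bar u)(y)\,dz\;d\mathfrak y\,dy\,ds\Big|. \end{aligned}$$ -/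

import Mathlib

open MeasureTheory Set
open scoped ENNReal ComplexConjugate

namespace QNLS

noncomputable section

/-- The space `ℝ³` of the variables `y` and `𝔶`, with its Euclidean norm. -/
abbrev Y : Type := EuclideanSpace ℝ (Fin 3)

/-- The space `ℝ^(d-3)` of the variable `z`. -/
abbrev Z (d : ℕ) : Type := EuclideanSpace ℝ (Fin (d - 3))

/-- The space `ℝ^d` of the variable `x = (y, z)`. Its volume is the product of the two Lebesgue
measures; its norm is only used up to equivalence. -/
abbrev X (d : ℕ) : Type := Y × Z d

/-- The indices `1, …, d` of the coordinates of `ℝ^d`; `Sum.inl` gives the three indices of `y`. -/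
abbrev Idx (d : ℕ) : Type := Fin 3 ⊕ Fin (d - 3)

/-- The standard basis of `ℝ^d = ℝ³ × ℝ^(d-3)`. -/
def basisVec (d : ℕ) : Idx d → X d
  | Sum.inl k => (EuclideanSpace.single k 1, 0)
  | Sum.inr j => (0, EuclideanSpace.single j 1)

/-- The partial derivative `∂_α f` on `ℝ^d`. -/
def pd {d : ℕ} {F : Type*} [NormedAddCommGroup F] [NormedSpace ℝ F]
    (α : Idx d) (f : X d → F) (x : X d) : F :=
  fderiv ℝ f x (basisVec d α)

/-- The partial derivative `∂_{y_k} f` on `ℝ³`. -/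
def pdY (k : Fin 3) (f : Y → ℝ) (y : Y) : ℝ :=
  fderiv ℝ f y (EuclideanSpace.single k 1)

/-- The Laplacian `Δ_y` on `ℝ³`. -/
def lapY (f : Y → ℝ) (y : Y) : ℝ := ∑ j : Fin 3, pdY j (pdY j f) y

/-- The Morawetz weight `a(y) = |y|`. -/
def a (y : Y) : ℝ := ‖y‖

/-- The coefficients `g^{αβ} = δ_{αβ} + h^{αβ}`. -/
def metric {d : ℕ} (h : Idx d → Idx d → ℝ → X d → ℝ) (α β : Idx d) (t : ℝ) (x : X d) : ℝ :=
  (if α = β then 1 else 0) + h α β t x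

/-- `u` is a regular solution on `[0, T] × ℝ^d` of
`i u_t + ∑ ∂_α (g^{αβ} ∂_β u) = 𝔑`, `u(0) = u₀`, where `g = I + h` is real and symmetric.
The coefficients and the right-hand side are functions of `(t, x)`; for a quasilinear equation they
are the values `h(u)` and `𝔑(u, ∇u)` along the solution.
The solution has three space derivatives that are bounded in `L²` uniformly in time, `𝔑` has one,
and `h` has two bounded space derivatives; all of these are continuous in `(t, x)`. -/
structure IsSolution (d : ℕ) (T : ℝ) (u₀ : X d → ℂ) (u : ℝ → X d → ℂ)
    (h : Idx d → Idx d → ℝ → X d → ℝ) (N : ℝ → X d → ℂ) : Prop where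
  symm : ∀ α β : Idx d, ∀ t ∈ Icc 0 T, ∀ x, h α β t x = h β α t x
  initial : u 0 = u₀
  equation : ∀ t ∈ Icc 0 T, ∀ x, ∃ ut : ℂ,
    HasDerivWithinAt (fun s => u s x) ut (Icc 0 T) t ∧
    Complex.I * ut
      + ∑ α : Idx d, ∑ β : Idx d, pd α (fun x' => (metric h α β t x' : ℂ) * pd β (u t) x') x
      = N t x
  contDiff_u : ∀ t ∈ Icc 0 T, ContDiff ℝ 3 (u t)
  contDiff_h : ∀ α β, ∀ t ∈ Icc 0 T, ContDiff ℝ 2 (h α β t)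
  contDiff_N : ∀ t ∈ Icc 0 T, ContDiff ℝ 1 (N t)
  continuous_u : ∀ j : ℕ, j ≤ 3 →
    ContinuousOn (fun p : ℝ × X d => iteratedFDeriv ℝ j (u p.1) p.2) (Icc 0 T ×ˢ univ)
  continuous_h : ∀ α β, ∀ j : ℕ, j ≤ 2 →
    ContinuousOn (fun p : ℝ × X d => iteratedFDeriv ℝ j (h α β p.1) p.2) (Icc 0 T ×ˢ univ)
  continuous_N : ∀ j : ℕ, j ≤ 1 →
    ContinuousOn (fun p : ℝ × X d => iteratedFDeriv ℝ j (N p.1) p.2) (Icc 0 T ×ˢ univ)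
  bound_u : ∃ K : ℝ, ∀ j : ℕ, j ≤ 3 → ∀ t ∈ Icc 0 T,
    eLpNorm (iteratedFDeriv ℝ j (u t)) 2 volume ≤ ENNReal.ofReal K
  bound_h : ∃ K : ℝ, ∀ α β, ∀ j : ℕ, j ≤ 2 → ∀ t ∈ Icc 0 T, ∀ x,
    ‖iteratedFDeriv ℝ j (h α β t) x‖ ≤ K
  bound_N : ∃ K : ℝ, ∀ j : ℕ, j ≤ 1 → ∀ t ∈ Icc 0 T,
    eLpNorm (iteratedFDeriv ℝ j (N t)) 2 volume ≤ ENNReal.ofReal K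

variable {d : ℕ}

/-- `‖ ‖u‖_{L²_z} ‖_{L⁴_{t,y}}` on the time interval `[0, t]`. -/
def mixedNorm (u : ℝ → X d → ℂ) (t : ℝ) : ℝ≥0∞ :=
  eLpNorm (fun p : ℝ × Y => eLpNorm (fun z : Z d => u p.1 (p.2, z)) 2 volume) 4
    ((volume.restrict (Icc 0 t)).prod volume)

/-- `∫ |u|²/2 dz` at `(s, y)`. -/
def mass (u : ℝ → X d → ℂ) (s : ℝ) (y : Y) : ℝ := ∫ z : Z d, ‖u s (y, z)‖ ^ 2 / 2

/-- `∫ Im (u ∂_{y_k} ū) dz` at `(s, y)`. -/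
def momentum (u : ℝ → X d → ℂ) (k : Fin 3) (s : ℝ) (y : Y) : ℝ :=
  ∫ z : Z d, (u s (y, z) * conj (pd (Sum.inl k) (u s) (y, z))).im

/-- The integrand, in `(𝔶, y)`, of the interaction Morawetz potential at time `s`:
`∫ |u|²/2 (𝔶) dz ∇_y a(y - 𝔶) · ∫ Im (u ∇_y ū)(y) dz`. -/
def potentialIntegrand (u : ℝ → X d → ℂ) (s : ℝ) (η y : Y) : ℝ :=
  mass u s η * ∑ k : Fin 3, pdY k a (y - η) * momentum u k s y

/-- The interaction Morawetz potential at time `s`. -/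
def potential (u : ℝ → X d → ℂ) (s : ℝ) : ℝ :=
  ∫ p : Y × Y, potentialIntegrand u s p.1 p.2

/-- `∫ Im (𝔑 ū)(𝔶) dz ∇_y a(y - 𝔶) · ∫ Im (u ∇_y ū)(y) dz`. -/
def massForcing (u N : ℝ → X d → ℂ) (s : ℝ) (η y : Y) : ℝ :=
  (∫ z : Z d, (N s (η, z) * conj (u s (η, z))).im)
    * ∑ k : Fin 3, pdY k a (y - η) * momentum u k s y

/-- `∫ |u|²/2 (𝔶) dz ∇_y a(y - 𝔶) · ∫ (Re (u ∇_y 𝔑̄) - Re (𝔑 ∇_y ū))(y) dz`. -/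
def momentumForcing (u N : ℝ → X d → ℂ) (s : ℝ) (η y : Y) : ℝ :=
  mass u s η * ∑ k : Fin 3, pdY k a (y - η) *
    ∫ z : Z d, ((u s (y, z) * conj (pd (Sum.inl k) (N s) (y, z))).re
      - (N s (y, z) * conj (pd (Sum.inl k) (u s) (y, z))).re)

/-- `∫ Im (h^{αβ} u ∂_β ū)(𝔶) dz ∂_{y_α} ∂_{y_k} a(y - 𝔶) ∫ Im (u ∂_{y_k} ū)(y) dz`. -/
def error₁ (u : ℝ → X d → ℂ) (h : Idx d → Idx d → ℝ → X d → ℝ) (k α : Fin 3) (β : Idx d)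
    (s : ℝ) (η y : Y) : ℝ :=
  (∫ z : Z d, ((h (Sum.inl α) β s (η, z) : ℂ) * u s (η, z) * conj (pd β (u s) (η, z))).im)
    * pdY α (pdY k a) (y - η) * momentum u k s y

/-- `∫ |u|²/2 (𝔶) dz Δ_y ∂_{y_α} a(y - 𝔶) ∫ Re (u h^{αβ} ∂_β ū)(y) dz`. -/
def error₂ (u : ℝ → X d → ℂ) (h : Idx d → Idx d → ℝ → X d → ℝ) (α : Fin 3) (β : Idx d)
    (s : ℝ) (η y : Y) : ℝ :=
  mass u s η * lapY (pdY α a) (y - η) *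
    ∫ z : Z d, (u s (y, z) * (h (Sum.inl α) β s (y, z) : ℂ) * conj (pd β (u s) (y, z))).re

/-- `∫ |u|²/2 (𝔶) dz ∂_{y_α} ∂_{y_k} a(y - 𝔶) ∫ Re (∂_{y_k} u h^{αβ} ∂_β ū)(y) dz`. -/
def error₃ (u : ℝ → X d → ℂ) (h : Idx d → Idx d → ℝ → X d → ℝ) (k α : Fin 3) (β : Idx d)
    (s : ℝ) (η y : Y) : ℝ :=
  mass u s η * pdY α (pdY k a) (y - η) *
    ∫ z : Z d, (pd (Sum.inl k) (u s) (y, z) * (h (Sum.inl α) β s (y, z) : ℂ)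
      * conj (pd β (u s) (y, z))).re

/-- `∫ |u|²/2 (𝔶) dz (y_k - 𝔶_k)/|y - 𝔶| ∫ Re (∂_α u ∂_{y_k} h^{αβ} ∂_β ū)(y) dz`. -/
def error₄ (u : ℝ → X d → ℂ) (h : Idx d → Idx d → ℝ → X d → ℝ) (k : Fin 3) (α β : Idx d)
    (s : ℝ) (η y : Y) : ℝ :=
  mass u s η * ((y k - η k) / ‖y - η‖) *
    ∫ z : Z d, (pd α (u s) (y, z) * ((pd (Sum.inl k) (h α β s) (y, z) : ℝ) : ℂ)
      * conj (pd β (u s) (y, z))).re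

/-- `∫_0^t ∫_{ℝ³×ℝ³} F(s, 𝔶, y) d𝔶 dy ds`. -/
def spaceTimeIntegral (t : ℝ) (F : ℝ → Y → Y → ℝ) : ℝ :=
  ∫ s in (0 : ℝ)..t, ∫ p : Y × Y, F s p.1 p.2

/-- Absolute convergence of `∫_0^t ∫_{ℝ³×ℝ³} F(s, 𝔶, y) d𝔶 dy ds`. -/
def SpaceTimeIntegrable (t : ℝ) (F : ℝ → Y → Y → ℝ) : Prop :=
  Integrable (fun q : ℝ × (Y × Y) => F q.1 q.2.1 q.2.2) ((volume.restrict (Icc 0 t)).prod volume)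

/-- The error term `𝓗`, which collects the contributions of `h` and of its first derivatives. -/
def errorTerm (u : ℝ → X d → ℂ) (h : Idx d → Idx d → ℝ → X d → ℝ) (t : ℝ) : ℝ :=
  (∑ k : Fin 3, ∑ α : Fin 3, ∑ β : Idx d, |spaceTimeIntegral t (error₁ u h k α β)|)
  + (∑ α : Fin 3, ∑ β : Idx d, |spaceTimeIntegral t (error₂ u h α β)|)
  + 2 * (∑ k : Fin 3, ∑ α : Fin 3, ∑ β : Idx d, |spaceTimeIntegral t (error₃ u h k α β)|)
  + ∑ k : Fin 3, ∑ α : Idx d, ∑ β : Idx d, |spaceTimeIntegral t (error₄ u h k α β)|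

/-- All the integrals in the right-hand side of the estimate on `[0, t]` converge absolutely. -/
structure TermsConverge (u : ℝ → X d → ℂ) (h : Idx d → Idx d → ℝ → X d → ℝ) (N : ℝ → X d → ℂ)
    (t : ℝ) : Prop where
  converge_potential : ∀ s ∈ Icc 0 t,
    Integrable (fun p : Y × Y => potentialIntegrand u s p.1 p.2) volume
  converge_massForcing : SpaceTimeIntegrable t (massForcing u N)
  converge_momentumForcing : SpaceTimeIntegrable t (momentumForcing u N)
  converge_error₁ : ∀ k α β, SpaceTimeIntegrable t (error₁ u h k α β)
  converge_error₂ : ∀ α β, SpaceTimeIntegrable t (error₂ u h α β)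
  converge_error₃ : ∀ k α β, SpaceTimeIntegrable t (error₃ u h k α β)
  converge_error₄ : ∀ k α β, SpaceTimeIntegrable t (error₄ u h k α β)

end

end QNLS

/-! Write $\rho=|u|^2/2$ and $m_k=\mathrm{Im}(u\,\partial_{y_k}\bar u)$. Both obey local
conservation laws (`RegData.mass_law`, `RegData.momentum_law`). In
$\frac{d}{dt}\sum_k\iint\rho(x')\,\partial_ka(y-y')\,m_k(x)\,dx'dx$ every divergence is moved onto
the weight. It depends on $y-y'$ alone, so all $z$-derivatives integrate to zero.

The $h$-free part consists of two contributions besides the forcing. The first is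
$\sum\partial_j\partial_ka\,\{m_j(x')m_k(x)-2\rho(x')\,\mathrm{Re}(\partial_ju\,\partial_k\bar
u)(x)\}$. After symmetrization in the two particles it is $\le0$, because the Hessian of $a$ is
nonnegative and $2\,\mathrm{Im}(U\bar a)\,\mathrm{Im}(V\bar b)\le|U|^2|b|^2+|V|^2|a|^2$
(`sum_w2_mul_le`, `RegData.pairing_hessian_nonpos`). The second is
$\iint\rho(x')\,\Delta^2a(y-y')\,\rho(x)$. In three dimensions $\Delta^2|y|$ is a negative multiple
of the Dirac mass, so minus this term is a multiple of $\int(\int|u|^2dz)^2dy$. The terms with $h$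
are carried along as errors and never absorbed; hence no smallness is needed.

The computation is made rigorous with $a_\varepsilon=\sqrt{\varepsilon^2+|y|^2}$. For
$\varepsilon>0$ its gradient and all the higher derivatives used are bounded, all integrations by
parts are elementary, and $\Delta^2a_\varepsilon=-15\varepsilon^4(\varepsilon^2+|y|^2)^{-7/2}\le0$.
This gives `IsSolution.neg_stPairing_w4_le`.

As $\varepsilon\to0$ the two sides are treated differently. On the right, the weights are dominated
by $1$, $|y|^{-1}$ and $|y|^{-2}$ uniformly in $\varepsilon$. The Hardy inequality in $y$ (`hardy`)
makes $\int|u|^2|y-y'|^{-2}dx'$ bounded uniformly in time and in the centre, so dominated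
convergence applies (`RegData.tendsto_regRhs`); the same bounds give absolute convergence of all
terms. On the left only a lower bound is needed: $-\Delta^2a_\varepsilon\ge\varepsilon^{-3}$ on the
ball of radius $\varepsilon$, so rescaling and Fatou's lemma, applied successively at the second
particle, the first particle and in time, suffice (`ballVol_mul_lintegral_le`). The left side is
kept as a Lebesgue integral in $[0,\infty]$, so finiteness of the $L^4_{t,y}L^2_z$ norm is a
conclusion of the argument. -/

open scoped NNReal

namespace QNLS

/-! ### Functions with continuous space derivatives bounded in $L^p$ uniformly in time. -/

noncomputable section

variable {d : ℕ} {F : Type*} [NormedAddCommGroup F] [NormedSpace ℝ F]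
  {G : Type*} [NormedAddCommGroup G] [NormedSpace ℝ G]

/-- `f` has `n` space derivatives, continuous in `(t, x)` on `[0, T] × ℝ^d` and bounded in `L^p`
uniformly in `t ∈ [0, T]`. -/
def Reg (p : ℝ≥0∞) (T : ℝ) : ℕ → (ℝ → X d → F) → Prop
  | 0, f => ContinuousOn (fun q : ℝ × X d => f q.1 q.2) (Icc 0 T ×ˢ univ) ∧
      ∃ K : ℝ≥0, ∀ t ∈ Icc 0 T, eLpNorm (f t) p volume ≤ K
  | n + 1, f => Reg p T 0 f ∧ (∀ t ∈ Icc 0 T, Differentiable ℝ (f t)) ∧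
      ∀ α, Reg p T n (fun t => pd α (f t))

variable {p q r : ℝ≥0∞} {T : ℝ} {n : ℕ} {f g : ℝ → X d → F}

theorem reg_zero : Reg p T 0 f ↔
    ContinuousOn (fun q : ℝ × X d => f q.1 q.2) (Icc 0 T ×ˢ univ) ∧
      ∃ K : ℝ≥0, ∀ t ∈ Icc 0 T, eLpNorm (f t) p volume ≤ K := by
  rw [Reg]

theorem reg_succ : Reg p T (n + 1) f ↔ Reg p T 0 f ∧ (∀ t ∈ Icc 0 T, Differentiable ℝ (f t)) ∧
    ∀ α, Reg p T n (fun t => pd α (f t)) := by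
  conv_lhs => rw [Reg]

theorem Reg.zero (hf : Reg p T n f) : Reg p T 0 f := by
  cases n with
  | zero => exact hf
  | succ n => exact (reg_succ.1 hf).1

theorem Reg.continuousOn (hf : Reg p T n f) :
    ContinuousOn (fun q : ℝ × X d => f q.1 q.2) (Icc 0 T ×ˢ univ) := (reg_zero.1 hf.zero).1

theorem Reg.bound (hf : Reg p T n f) :
    ∃ K : ℝ≥0, ∀ t ∈ Icc 0 T, eLpNorm (f t) p volume ≤ K := (reg_zero.1 hf.zero).2

theorem Reg.differentiable (hf : Reg p T (n + 1) f) {t : ℝ} (ht : t ∈ Icc 0 T) :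
    Differentiable ℝ (f t) := (reg_succ.1 hf).2.1 t ht

theorem Reg.pd (hf : Reg p T (n + 1) f) (α : Idx d) : Reg p T n (fun t => pd α (f t)) :=
    (reg_succ.1 hf).2.2 α

theorem Reg.pred (hf : Reg p T (n + 1) f) : Reg p T n f := by
  induction n generalizing f with
  | zero => exact hf.zero
  | succ n ih => exact reg_succ.2 ⟨hf.zero, fun t ht => hf.differentiable ht, fun α => ih (hf.pd α)⟩

theorem Reg.of_le {m : ℕ} (hf : Reg p T n f) (h : m ≤ n) : Reg p T m f := by
  induction h with
  | refl => exact hf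
  | step _ ih => exact ih hf.pred

theorem Reg.continuous (hf : Reg p T n f) {t : ℝ} (ht : t ∈ Icc 0 T) : Continuous (f t) := by
  have := hf.continuousOn.comp (f := fun x : X d => (t, x)) (s := univ) (by fun_prop)
    (fun x _ => ⟨ht, mem_univ _⟩)
  exact continuousOn_univ.1 this

theorem Reg.aestronglyMeasurable (hf : Reg p T n f) {t : ℝ} (ht : t ∈ Icc 0 T) :
    AEStronglyMeasurable (f t) volume := (hf.continuous ht).aestronglyMeasurable

theorem Reg.memLp (hf : Reg p T n f) {t : ℝ} (ht : t ∈ Icc 0 T) : MemLp (f t) p volume := by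
  obtain ⟨K, hK⟩ := hf.bound
  exact ⟨hf.aestronglyMeasurable ht, (hK t ht).trans_lt ENNReal.coe_lt_top⟩

theorem Reg.integrable (hf : Reg 1 T n f) {t : ℝ} (ht : t ∈ Icc 0 T) : Integrable (f t) volume :=
  memLp_one_iff_integrable.1 (hf.memLp ht)

theorem Reg.congr (hf : Reg p T n f) (h : ∀ t ∈ Icc 0 T, ∀ x, g t x = f t x) : Reg p T n g := by
  induction n generalizing f g with
  | zero =>
    refine reg_zero.2 ⟨hf.continuousOn.congr fun q hq => h q.1 hq.1 q.2, ?_⟩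
    obtain ⟨K, hK⟩ := hf.bound
    exact ⟨K, fun t ht => by rw [funext (h t ht)]; exact hK t ht⟩
  | succ n ih =>
    refine reg_succ.2 ⟨(ih hf.pred h).zero, fun t ht => ?_, fun α => ih (hf.pd α) fun t ht x => ?_⟩
    · rw [funext (h t ht)]; exact hf.differentiable ht
    · rw [funext (h t ht)]

theorem pd_clm (L : F →L[ℝ] G) {f : X d → F} {x : X d} (hf : DifferentiableAt ℝ f x)
    (α : Idx d) : pd α (fun x => L (f x)) x = L (pd α f x) := by
  simp only [pd]
  rw [show (fun x => L (f x)) = L ∘ f from rfl, fderiv_comp x L.differentiableAt hf, L.fderiv]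
  rfl

theorem eLpNorm_clm_le (L : F →L[ℝ] G) (f : X d → F) :
    eLpNorm (fun x => L (f x)) p volume ≤ ‖L‖₊ * eLpNorm f p volume := by
  have := eLpNorm_le_nnreal_smul_eLpNorm_of_ae_le_mul (μ := (volume : Measure (X d)))
    (f := fun x => L (f x)) (g := f) (c := ‖L‖₊)
    (Filter.Eventually.of_forall fun x => L.le_opNNNorm (f x)) p
  simpa [ENNReal.smul_def] using this

theorem Reg.clm (L : F →L[ℝ] G) (hf : Reg p T n f) : Reg p T n (fun t x => L (f t x)) := by
  induction n generalizing f with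
  | zero =>
    refine reg_zero.2 ⟨L.continuous.comp_continuousOn hf.continuousOn, ?_⟩
    obtain ⟨K, hK⟩ := hf.bound
    refine ⟨‖L‖₊ * K, fun t ht => ?_⟩
    refine (eLpNorm_clm_le L (f t)).trans ?_
    push_cast
    exact mul_le_mul' le_rfl (hK t ht)
  | succ n ih =>
    refine reg_succ.2 ⟨(ih hf.pred).zero, fun t ht => L.differentiable.comp
        (hf.differentiable ht), fun α => ?_⟩
    refine (ih (hf.pd α)).congr fun t ht x => ?_
    exact pd_clm L (hf.differentiable ht x) α

theorem pd_add {f g : X d → F} {x : X d} (hf : DifferentiableAt ℝ f x)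
    (hg : DifferentiableAt ℝ g x) (α : Idx d) :
    pd α (fun x => f x + g x) x = pd α f x + pd α g x := by
  simp only [pd]
  rw [fderiv_fun_add hf hg]; rfl

theorem pd_mul {𝔸 : Type*} [NormedRing 𝔸] [NormedAlgebra ℝ 𝔸] {f g : X d → 𝔸} {x : X d}
    (hf : DifferentiableAt ℝ f x) (hg : DifferentiableAt ℝ g x) (α : Idx d) :
    pd α (fun x => f x * g x) x = pd α f x * g x + f x * pd α g x := by
  simp only [pd]
  rw [fderiv_fun_mul' hf hg]
  simp [add_comm]

theorem pd_sum {ι : Type*} (s : Finset ι) {f : ι → X d → F} {x : X d}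
    (hf : ∀ i ∈ s, DifferentiableAt ℝ (f i) x) (α : Idx d) :
    pd α (fun x => ∑ i ∈ s, f i x) x = ∑ i ∈ s, pd α (f i) x := by
  simp only [pd]
  rw [fderiv_fun_sum hf]
  simp

theorem Reg.add (hp : 1 ≤ p) (hf : Reg p T n f) (hg : Reg p T n g) :
    Reg p T n (fun t x => f t x + g t x) := by
  induction n generalizing f g with
  | zero =>
    refine reg_zero.2 ⟨hf.continuousOn.add hg.continuousOn, ?_⟩
    obtain ⟨K, hK⟩ := hf.bound
    obtain ⟨K', hK'⟩ := hg.bound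
    refine ⟨K + K', fun t ht => ?_⟩
    refine (eLpNorm_add_le (hf.aestronglyMeasurable ht) (hg.aestronglyMeasurable ht) hp).trans ?_
    push_cast
    exact add_le_add (hK t ht) (hK' t ht)
  | succ n ih =>
    refine reg_succ.2 ⟨(ih hf.pred hg.pred).zero, fun t ht => (hf.differentiable ht).add
        (hg.differentiable ht), fun α => ?_⟩
    exact (ih (hf.pd α) (hg.pd α)).congr fun t ht x => pd_add (hf.differentiable ht x)
        (hg.differentiable ht x) α

theorem pd_const (c : F) (α : Idx d) (x : X d) : QNLS.pd α (fun _ => c) x = 0 := by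
  simp [QNLS.pd]

theorem Reg.zero_fun : Reg p T n (fun _ _ => (0 : F) : ℝ → X d → F) := by
  induction n with
  | zero => exact reg_zero.2 ⟨continuousOn_const, 0, fun t _ => by simp⟩
  | succ n ih =>
    exact reg_succ.2 ⟨ih.zero, fun _ _ => differentiable_const _,
      fun α => ih.congr fun t _ x => pd_const 0 α x⟩

theorem Reg.const (c : F) : Reg ∞ T n (fun _ _ => c : ℝ → X d → F) := by
  cases n with
  | zero =>
    refine reg_zero.2 ⟨continuousOn_const, ‖c‖₊, fun t _ => ?_⟩
    rw [eLpNorm_exponent_top]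
    exact eLpNormEssSup_le_of_ae_nnnorm_bound (Filter.Eventually.of_forall fun _ => le_rfl)
  | succ n =>
    refine reg_succ.2 ⟨reg_zero.2 ⟨continuousOn_const, ‖c‖₊, fun t _ => ?_⟩, fun _ _ =>
        differentiable_const _,
      fun α => Reg.zero_fun.congr fun t _ x => pd_const c α x⟩
    rw [eLpNorm_exponent_top]
    exact eLpNormEssSup_le_of_ae_nnnorm_bound (Filter.Eventually.of_forall fun _ => le_rfl)

theorem Reg.sum (hp : 1 ≤ p) {ι : Type*} (s : Finset ι) {f : ι → ℝ → X d → F}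
    (hf : ∀ i ∈ s, Reg p T n (f i)) : Reg p T n (fun t x => ∑ i ∈ s, f i t x) := by
  classical
  induction s using Finset.induction_on with
  | empty => simpa using Reg.zero_fun
  | insert i s hi ih =>
    simp only [Finset.sum_insert hi]
    exact Reg.add hp (hf i (by simp)) (ih fun j hj => hf j (by simp [hj]))

/-- Leibniz rule and Hölder's inequality. It is used with exponents $(\infty,2,2)$ or $(2,\infty,2)$
for a coefficient times $u$, and $(2,2,1)$ for quadratic densities. -/
theorem Reg.mul {𝔸 : Type*} [NormedRing 𝔸] [NormedAlgebra ℝ 𝔸] {f g : ℝ → X d → 𝔸}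
    [ENNReal.HolderTriple p q r] (hr : 1 ≤ r)
    (hf : Reg p T n f) (hg : Reg q T n g) : Reg r T n (fun t x => f t x * g t x) := by
  induction n generalizing f g with
  | zero =>
    refine reg_zero.2 ⟨hf.continuousOn.mul hg.continuousOn, ?_⟩
    obtain ⟨K, hK⟩ := hf.bound
    obtain ⟨K', hK'⟩ := hg.bound
    refine ⟨K * K', fun t ht => ?_⟩
    refine (eLpNorm_le_eLpNorm_mul_eLpNorm_of_nnnorm (p := p) (q := q)
      (hf.aestronglyMeasurable ht) (hg.aestronglyMeasurable ht) (· * ·) 1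
      (Filter.Eventually.of_forall fun x => by
        simpa using nnnorm_mul_le (f t x) (g t x))).trans ?_
    simp only [ENNReal.coe_one, one_mul, ENNReal.coe_mul]
    exact mul_le_mul' (hK t ht) (hK' t ht)
  | succ n ih =>
    refine reg_succ.2 ⟨(ih hf.pred hg.pred).zero, fun t ht => (hf.differentiable ht).mul
        (hg.differentiable ht), fun α => ?_⟩
    exact (Reg.add hr (ih (hf.pd α) hg.pred) (ih hf.pred (hg.pd α))).congr
      fun t ht x => pd_mul (hf.differentiable ht x) (hg.differentiable ht x) α

theorem Reg.const_mul {f : ℝ → X d → ℝ} (c : ℝ) (hf : Reg p T n f) :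
    Reg p T n (fun t x => c * f t x) := hf.clm (c • ContinuousLinearMap.id ℝ ℝ)

/-- The map that recovers the `j`-th derivative of `∂_α f` from the `(j+1)`-st derivative of `f`. -/
def evalLast (d : ℕ) (F : Type*) [NormedAddCommGroup F] [NormedSpace ℝ F] (j : ℕ) (α : Idx d) :
    (X d [×(j + 1)]→L[ℝ] F) →L[ℝ] (X d [×j]→L[ℝ] F) :=
  (ContinuousLinearMap.compContinuousMultilinearMapL ℝ (fun _ : Fin j => X d) (X d →L[ℝ] F) F
    (ContinuousLinearMap.apply ℝ F (basisVec d α))).comp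
    (continuousMultilinearCurryRightEquiv' ℝ j (X d)
        F).toContinuousLinearEquiv.toContinuousLinearMap

theorem iteratedFDeriv_pd {f : X d → F} {j : ℕ} (hf : ContDiff ℝ (j + 1 : ℕ) f) (α : Idx d)
    (x : X d) : iteratedFDeriv ℝ j (pd α f) x =
      evalLast d F j α (iteratedFDeriv ℝ (j + 1) f x) := by
  have h1 : ContDiff ℝ j (fderiv ℝ f) := hf.fderiv_right (by norm_cast)
  have := (ContinuousLinearMap.apply ℝ F (basisVec d α)).iteratedFDeriv_comp_left
    (h1.contDiffAt (x := x)) le_rfl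
  rw [iteratedFDeriv_succ_eq_comp_right]
  simp only [evalLast, ContinuousLinearMap.comp_apply, Function.comp_apply]
  refine this.trans ?_
  simp [ContinuousLinearMap.compContinuousMultilinearMapL]

/-- Connects the hypotheses on total derivatives with the recursive class: by `evalLast`, the $j$-th
derivative of $\partial_\alpha f$ is a fixed bounded linear image of the $(j+1)$-st derivative of
$f$, so continuity and $L^p$ bounds pass to it. -/
theorem Reg.of_iteratedFDeriv (hd : ∀ t ∈ Icc 0 T, ContDiff ℝ n (f t))
    (hc : ∀ j : ℕ, j ≤ n →
      ContinuousOn (fun p : ℝ × X d => iteratedFDeriv ℝ j (f p.1) p.2) (Icc 0 T ×ˢ univ))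
    (hb : ∃ K : ℝ≥0, ∀ j : ℕ, j ≤ n → ∀ t ∈ Icc 0 T,
      eLpNorm (iteratedFDeriv ℝ j (f t)) p volume ≤ K) : Reg p T n f := by
  induction n generalizing f with
  | zero =>
    refine reg_zero.2 ⟨?_, ?_⟩
    · have := (continuousMultilinearCurryFin0 ℝ (X d) F).continuous.comp_continuousOn
        (hc 0 le_rfl)
      refine this.congr fun q hq => ?_
      simp
    · obtain ⟨K, hK⟩ := hb
      refine ⟨K, fun t ht => le_trans (le_of_eq ?_) (hK 0 le_rfl t ht)⟩
      exact eLpNorm_congr_norm_ae (Filter.Eventually.of_forall fun x => by simp)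
  | succ n ih =>
    refine reg_succ.2 ⟨(ih (fun t ht => (hd t ht).of_le (by norm_cast; omega))
      (fun j hj => hc j (by omega)) ?_).zero,
      fun t ht => (hd t ht).differentiable (by simp), fun α => ih (fun t ht => ?_)
        (fun j hj => ?_) ?_⟩
    · obtain ⟨K, hK⟩ := hb
      exact ⟨K, fun j hj => hK j (by omega)⟩
    · have : ContDiff ℝ n (fderiv ℝ (f t)) := (hd t ht).fderiv_right (by norm_cast)
      exact this.clm_apply contDiff_const
    · refine ((evalLast d F j α).continuous.comp_continuousOn (hc (j + 1) (by omega))).congr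
        fun q hq => ?_
      exact iteratedFDeriv_pd ((hd q.1 hq.1).of_le (by norm_cast; omega)) α q.2
    · obtain ⟨K, hK⟩ := hb
      refine ⟨(∑ j ∈ Finset.range (n + 1), ‖evalLast d F j α‖₊) * K, fun j hj t ht => ?_⟩
      rw [funext (iteratedFDeriv_pd ((hd t ht).of_le (by norm_cast; omega)) α)]
      refine (eLpNorm_clm_le (evalLast d F j α) _).trans ?_
      push_cast
      refine mul_le_mul' ?_ (hK (j + 1) (by omega) t ht)
      have : ‖evalLast d F j α‖₊ ≤ ∑ j ∈ Finset.range (n + 1), ‖evalLast d F j α‖₊ :=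
        Finset.single_le_sum (f := fun j => ‖evalLast d F j α‖₊) (fun _ _ => zero_le)
            (by simp; omega)
      exact_mod_cast this

end

/-! ### The regularized weight $\sqrt{\varepsilon^2+|y|^2}$: derivatives, bounds, convexity. -/

noncomputable section

/-- `f` is differentiable at `y` and `∂_{y_k} f (y) = c`. -/
def HasPD (k : Fin 3) (f : Y → ℝ) (c : ℝ) (y : Y) : Prop :=
  DifferentiableAt ℝ f y ∧ pdY k f y = c

section HasPD

variable {k : Fin 3} {f g : Y → ℝ} {b c : ℝ} {y : Y}

theorem HasPD.add (hf : HasPD k f b y) (hg : HasPD k g c y) :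
    HasPD k (fun y => f y + g y) (b + c) y := by
  refine ⟨hf.1.add hg.1, ?_⟩
  rw [← hf.2, ← hg.2, pdY, fderiv_fun_add hf.1 hg.1]; rfl

theorem HasPD.sub (hf : HasPD k f b y) (hg : HasPD k g c y) :
    HasPD k (fun y => f y - g y) (b - c) y := by
  refine ⟨hf.1.sub hg.1, ?_⟩
  rw [← hf.2, ← hg.2, pdY, fderiv_fun_sub hf.1 hg.1]; rfl

theorem HasPD.mul (hf : HasPD k f b y) (hg : HasPD k g c y) :
    HasPD k (fun y => f y * g y) (b * g y + f y * c) y := by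
  refine ⟨hf.1.mul hg.1, ?_⟩
  rw [← hf.2, ← hg.2, pdY, fderiv_fun_mul hf.1 hg.1]
  simp [pdY]; ring

theorem HasPD.const_mul (a : ℝ) (hf : HasPD k f b y) : HasPD k (fun y => a * f y) (a * b) y := by
  refine ⟨hf.1.const_mul a, ?_⟩
  rw [← hf.2, pdY, fderiv_const_mul hf.1]; rfl

theorem HasPD.pow (n : ℕ) (hf : HasPD k f b y) :
    HasPD k (fun y => f y ^ n) (n * f y ^ (n - 1) * b) y := by
  refine ⟨hf.1.pow n, ?_⟩
  rw [← hf.2, pdY, fderiv_fun_pow n hf.1]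
  simp [pdY]

theorem HasPD.congr_val (hf : HasPD k f b y) (h : b = c) : HasPD k f c y := h ▸ hf

theorem HasPD.congr (hf : HasPD k f b y) (h : g =ᶠ[nhds y] f) : HasPD k g b y := by
  refine ⟨hf.1.congr_of_eventuallyEq h, ?_⟩
  rw [← hf.2, pdY, h.fderiv_eq]; rfl

theorem hasPD_coord (j k : Fin 3) (y : Y) : HasPD j (fun y : Y => y k) (if j = k then 1 else 0)
    y := by
  have : HasFDerivAt (fun y : Y => y k) (EuclideanSpace.proj k : Y →L[ℝ] ℝ) y :=
    (EuclideanSpace.proj k : Y →L[ℝ] ℝ).hasFDerivAt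
  refine ⟨this.differentiableAt, ?_⟩
  rw [pdY, this.fderiv]
  simp [eq_comm]

end HasPD

/-- The reciprocal of the regularized weight `√(ε² + |y|²)`. -/
def r (ε : ℝ) (y : Y) : ℝ := (√(ε ^ 2 + ‖y‖ ^ 2))⁻¹

variable {ε : ℝ} {y : Y}

theorem r_nonneg : 0 ≤ r ε y := by unfold r; positivity

/-- The only algebraic relation needed for the weights. The hypothesis covers at once
$\varepsilon>0$ with any $y$, and $\varepsilon=0$ with $y\ne0$, so one set of formulas serves the
regularized weight and $|y|$ off the origin. -/
theorem r_sq (h : 0 < ε ^ 2 + ‖y‖ ^ 2) : (ε ^ 2 + ‖y‖ ^ 2) * r ε y ^ 2 = 1 := by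
  rw [r, inv_pow, Real.sq_sqrt h.le, mul_inv_cancel₀ h.ne']

theorem r_sq_le : (ε ^ 2 + ‖y‖ ^ 2) * r ε y ^ 2 ≤ 1 := by
  rcases eq_or_lt_of_le (show 0 ≤ ε ^ 2 + ‖y‖ ^ 2 by positivity) with h | h
  · rw [← h]; simp
  · exact (r_sq h).le

theorem r_zero_eq : r 0 y = ‖y‖⁻¹ := by simp [r]

theorem norm_mul_r_le : ‖y‖ * r ε y ≤ 1 := by
  have := r_sq_le (ε := ε) (y := y)
  have h0 := r_nonneg (ε := ε) (y := y)
  have : (‖y‖ * r ε y) ^ 2 ≤ 1 := by nlinarith [sq_nonneg (ε * r ε y)]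
  exact (sq_le_one_iff₀ (by positivity)).1 this

theorem sq_mul_r_sq_le : ε ^ 2 * r ε y ^ 2 ≤ 1 := by
  have := r_sq_le (ε := ε) (y := y)
  nlinarith [sq_nonneg (‖y‖ * r ε y)]

theorem abs_coord_le (k : Fin 3) : |y k| ≤ ‖y‖ := by
  simpa using PiLp.norm_apply_le y k

theorem abs_coord_mul_r_le (k : Fin 3) : |y k| * r ε y ≤ 1 :=
  (mul_le_mul_of_nonneg_right (abs_coord_le k) r_nonneg).trans norm_mul_r_le

theorem r_le_inv (hε : 0 < ε) : r ε y ≤ ε⁻¹ := by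
  rw [r]
  gcongr
  exact Real.le_sqrt_of_sq_le (by nlinarith [sq_nonneg ‖y‖])

theorem r_le_r_zero (hy : y ≠ 0) : r ε y ≤ r 0 y := by
  rw [r_zero_eq, r]
  have : 0 < ‖y‖ := norm_pos_iff.2 hy
  gcongr
  exact Real.le_sqrt_of_sq_le (by nlinarith [sq_nonneg ε])

theorem normSq_eq (y : Y) : ‖y‖ ^ 2 = y 0 ^ 2 + y 1 ^ 2 + y 2 ^ 2 := by
  rw [EuclideanSpace.real_norm_sq_eq, Fin.sum_univ_three]

@[fun_prop]
theorem continuous_r (hε : 0 < ε) : Continuous (r ε) := by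
  unfold r
  refine Continuous.inv₀ (by fun_prop) fun y => ?_
  have : 0 < ε ^ 2 + ‖y‖ ^ 2 := by positivity
  positivity

@[fun_prop]
theorem measurable_r : Measurable (r ε) := by
  unfold r; fun_prop

theorem hasPD_normSq (k : Fin 3) (y : Y) : HasPD k (fun y : Y => ‖y‖ ^ 2) (2 * y k) y := by
  have : HasFDerivAt (fun y : Y => ‖y‖ ^ 2) (2 • innerSL ℝ y) y :=
    (hasStrictFDerivAt_norm_sq y).hasFDerivAt
  refine ⟨this.differentiableAt, ?_⟩
  rw [pdY, this.fderiv]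
  simp [EuclideanSpace.inner_single_right]

theorem hasPD_r (h : 0 < ε ^ 2 + ‖y‖ ^ 2) (k : Fin 3) : HasPD k (r ε) (-(y k * r ε y ^ 3)) y := by
  have h1 : HasFDerivAt (fun y : Y => ε ^ 2 + ‖y‖ ^ 2) (2 • innerSL ℝ y) y :=
    ((hasStrictFDerivAt_norm_sq y).hasFDerivAt).const_add _
  have h2 := (h1.sqrt h.ne')
  have hs : √(ε ^ 2 + ‖y‖ ^ 2) ≠ 0 := by positivity
  have h3 := (hasDerivAt_inv hs).comp_hasFDerivAt y h2
  refine ⟨h3.differentiableAt, ?_⟩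
  have : pdY k (r ε) y = _ := congrArg (fun L : Y →L[ℝ] ℝ => L (EuclideanSpace.single k 1))
      h3.fderiv
  rw [this]
  simp [EuclideanSpace.inner_single_right, r]
  field_simp

/-- The gradient of the regularized weight. -/
def w1 (ε : ℝ) (k : Fin 3) (y : Y) : ℝ := y k * r ε y

/-- The Hessian of the regularized weight. -/
def w2 (ε : ℝ) (j k : Fin 3) (y : Y) : ℝ :=
  (if j = k then 1 else 0) * r ε y - y j * y k * r ε y ^ 3

/-- The Laplacian of the regularized weight. -/
def wLap (ε : ℝ) (y : Y) : ℝ := 2 * r ε y + ε ^ 2 * r ε y ^ 3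

/-- The gradient of the Laplacian of the regularized weight. -/
def w3 (ε : ℝ) (k : Fin 3) (y : Y) : ℝ := -2 * (y k * r ε y ^ 3) - 3 * ε ^ 2 * (y k * r ε y ^ 5)

/-- The derivatives of `w3`. -/
def w3' (ε : ℝ) (j k : Fin 3) (y : Y) : ℝ :=
  -2 * ((if j = k then 1 else 0) * r ε y ^ 3 + y k * (3 * r ε y ^ 2 * -(y j * r ε y ^ 3)))
    - 3 * ε ^ 2 * ((if j = k then 1 else 0) * r ε y ^ 5
      + y k * (5 * r ε y ^ 4 * -(y j * r ε y ^ 3)))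

/-- The bi-Laplacian of the regularized weight. -/
def w4 (ε : ℝ) (y : Y) : ℝ := -15 * ε ^ 4 * r ε y ^ 7

theorem hasPD_w1 (h : 0 < ε ^ 2 + ‖y‖ ^ 2) (j k : Fin 3) : HasPD j (w1 ε k) (w2 ε j k y) y := by
  refine ((hasPD_coord j k y).mul (hasPD_r h j)).congr_val ?_
  rw [w2]; ring

theorem sum_w2 (h : 0 < ε ^ 2 + ‖y‖ ^ 2) : ∑ k, w2 ε k k y = wLap ε y := by
  have h1 := r_sq h
  rw [normSq_eq] at h1
  simp only [w2, wLap, Fin.sum_univ_three]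
  simp
  linear_combination (-r ε y) * h1

theorem hasPD_wLap (h : 0 < ε ^ 2 + ‖y‖ ^ 2) (k : Fin 3) : HasPD k (wLap ε) (w3 ε k y) y := by
  refine (((hasPD_r h k).const_mul 2).add (((hasPD_r h k).pow 3).const_mul (ε ^ 2))).congr_val ?_
  rw [w3]; push_cast; ring

theorem hasPD_w3 (h : 0 < ε ^ 2 + ‖y‖ ^ 2) (j k : Fin 3) : HasPD j (w3 ε k) (w3' ε j k y) y := by
  refine ((((hasPD_coord j k y).mul ((hasPD_r h j).pow 3)).const_mul (-2)).sub
    (((hasPD_coord j k y).mul ((hasPD_r h j).pow 5)).const_mul (3 * ε ^ 2))).congr_val ?_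
  rw [w3']; push_cast; ring

/-- The key use of dimension three: after $|y|^2r^2=1-\varepsilon^2r^2$ is substituted, the
coefficients of $r^3$ and of $\varepsilon^2r^5$ in the trace cancel, and only the negative term in
$\varepsilon^4r^7$ survives. -/
theorem sum_w3' (h : 0 < ε ^ 2 + ‖y‖ ^ 2) : ∑ k, w3' ε k k y = w4 ε y := by
  have h1 := r_sq h
  rw [normSq_eq] at h1
  simp only [w3', w4, Fin.sum_univ_three]
  simp
  linear_combination (6 * r ε y ^ 3 + 15 * ε ^ 2 * r ε y ^ 5) * h1

theorem hasPD_a (hy : y ≠ 0) (k : Fin 3) : HasPD k a (w1 0 k y) y := by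
  have h : 0 < (0 : ℝ) ^ 2 + ‖y‖ ^ 2 := by positivity
  have h1 := r_sq h
  -- The product form also holds at the origin, where the inverse of zero makes `r 0 0 = 0`; a
  -- global identity lets the product rule be applied without restricting to a neighbourhood.
  have : a = fun y => ‖y‖ ^ 2 * r 0 y := by
    funext y
    rw [a, r_zero_eq, pow_two]
    rcases eq_or_ne ‖y‖ 0 with h | h
    · simp [h]
    · field_simp
  rw [this]
  refine ((hasPD_normSq k y).mul (hasPD_r h k)).congr_val ?_
  rw [w1]
  linear_combination (-(y k * r 0 y)) * h1

theorem hasPD_pdY_a (hy : y ≠ 0) (j k : Fin 3) : HasPD j (pdY k a) (w2 0 j k y) y := by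
  have h : 0 < (0 : ℝ) ^ 2 + ‖y‖ ^ 2 := by positivity
  refine (hasPD_w1 h j k).congr ?_
  filter_upwards [isOpen_ne.mem_nhds hy] with x hx using (hasPD_a hx k).2

theorem pdY_a (hy : y ≠ 0) (k : Fin 3) : pdY k a y = w1 0 k y := (hasPD_a hy k).2

theorem pdY_pdY_a (hy : y ≠ 0) (j k : Fin 3) : pdY j (pdY k a) y = w2 0 j k y :=
  (hasPD_pdY_a hy j k).2

/-- Two derivatives of $\partial_k|y|$ are computed from the Hessian formula, valid near $y$ since
the complement of the origin is open; the sum over $j$ is then matched with the gradient of the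
Laplacian $2/|y|$. -/
theorem lapY_pdY_a (hy : y ≠ 0) (k : Fin 3) : lapY (pdY k a) y = w3 0 k y := by
  have h : 0 < (0 : ℝ) ^ 2 + ‖y‖ ^ 2 := by positivity
  have h1 := r_sq h
  have key : ∀ j, pdY j (pdY j (pdY k a)) y =
      (if j = k then 1 else 0) * -(y j * r 0 y ^ 3) - ((1 * y k + y j * (if j = k then 1 else 0))
        * r 0 y ^ 3 + y j * y k * (3 * r 0 y ^ 2 * -(y j * r 0 y ^ 3))) := by
    intro j
    have : pdY j (pdY k a) =ᶠ[nhds y] w2 0 j k := by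
      filter_upwards [isOpen_ne.mem_nhds hy] with x hx using pdY_pdY_a hx j k
    have h2 : HasPD j (pdY j (pdY k a)) _ y :=
        ((((hasPD_r h j).const_mul (if j = k then 1 else 0)).sub
      (((hasPD_coord j j y).mul (hasPD_coord j k y)).mul ((hasPD_r h j).pow 3)))).congr this
    rw [h2.2]
    simp
  rw [lapY, Finset.sum_congr rfl fun j _ => key j, w3]
  rw [normSq_eq] at h1
  simp only [Fin.sum_univ_three]
  fin_cases k <;> simp
  · linear_combination (3 * y 0 * r 0 y ^ 3) * h1
  · linear_combination (3 * y 1 * r 0 y ^ 3) * h1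
  · linear_combination (3 * y 2 * r 0 y ^ 3) * h1

/-- This bound and the two that follow for `w2` and `w3` are uniform in $\varepsilon$, and
$r_\varepsilon\le r_0$ off the origin. They supply the majorants $1$, $2/|y|$, $5/|y|^2$ for the
limit $\varepsilon\to0$. -/
theorem abs_w1_le (k : Fin 3) : |w1 ε k y| ≤ 1 := by
  rw [w1, abs_mul, abs_of_nonneg r_nonneg]
  exact abs_coord_mul_r_le k

theorem abs_w2_le (j k : Fin 3) : |w2 ε j k y| ≤ 2 * r ε y := by
  have h0 := r_nonneg (ε := ε) (y := y)
  have h1 : |(if j = k then 1 else 0) * r ε y| ≤ r ε y := by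
    split_ifs <;> simp [abs_of_nonneg, h0]
  have h2 : |y j * y k * r ε y ^ 3| ≤ r ε y := by
    rw [show y j * y k * r ε y ^ 3 = w1 ε j y * w1 ε k y * r ε y by rw [w1, w1]; ring,
      abs_mul, abs_mul, abs_of_nonneg h0]
    have := mul_le_one₀ (abs_w1_le (ε := ε) (y := y) j) (abs_nonneg _)
        (abs_w1_le (ε := ε) (y := y) k)
    exact mul_le_of_le_one_left h0 this
  rw [w2]
  have := abs_sub (((if j = k then 1 else 0) * r ε y)) (y j * y k * r ε y ^ 3)
  linarith

theorem abs_w3_le (k : Fin 3) : |w3 ε k y| ≤ 5 * r ε y ^ 2 := by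
  have h0 := r_nonneg (ε := ε) (y := y)
  have h2 : |y k * r ε y ^ 3| ≤ r ε y ^ 2 := by
    rw [show y k * r ε y ^ 3 = w1 ε k y * r ε y ^ 2 by rw [w1]; ring,
      abs_mul, abs_of_nonneg (pow_nonneg h0 2)]
    exact mul_le_of_le_one_left (by positivity) (abs_w1_le k)
  have h3 : |3 * ε ^ 2 * (y k * r ε y ^ 5)| ≤ 3 * r ε y ^ 2 := by
    rw [show 3 * ε ^ 2 * (y k * r ε y ^ 5) = 3 * ((ε ^ 2 * r ε y ^ 2) * (y k * r ε y ^ 3)) by ring,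
      abs_mul, abs_mul, abs_of_nonneg (by positivity : 0 ≤ ε ^ 2 * r ε y ^ 2)]
    rw [abs_of_nonneg (by norm_num : (0 : ℝ) ≤ 3)]
    gcongr
    exact (mul_le_of_le_one_left (abs_nonneg _) sq_mul_r_sq_le).trans h2
  have h4 : |-2 * (y k * r ε y ^ 3)| ≤ 2 * r ε y ^ 2 := by
    rw [abs_mul, abs_of_neg (by norm_num : (-2 : ℝ) < 0), neg_neg]; gcongr
  rw [w3]
  have := abs_sub (-2 * (y k * r ε y ^ 3)) (3 * ε ^ 2 * (y k * r ε y ^ 5))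
  linarith

theorem abs_w3'_le (j k : Fin 3) : |w3' ε j k y| ≤ 26 * r ε y ^ 3 := by
  have h0 := r_nonneg (ε := ε) (y := y)
  set δ : ℝ := if j = k then 1 else 0 with hδ
  have hd : |δ| ≤ 1 := by rw [hδ]; split_ifs <;> simp
  have hp : |w1 ε j y * w1 ε k y| ≤ 1 := by
    rw [abs_mul]; exact mul_le_one₀ (abs_w1_le j) (abs_nonneg _) (abs_w1_le k)
  -- The constant is $26=2+6+3+15$, since $|\delta|$, $|w^1_jw^1_k|$ and $\varepsilon^2r^2$ are all
  -- at most $1$.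
  have e : w3' ε j k y = (-2 * δ + 6 * (w1 ε j y * w1 ε k y)
      + (ε ^ 2 * r ε y ^ 2) * (-3 * δ + 15 * (w1 ε j y * w1 ε k y))) * r ε y ^ 3 := by
    rw [w3', w1, w1]; ring
  rw [e, abs_mul, abs_of_nonneg (by positivity : 0 ≤ r ε y ^ 3)]
  gcongr
  have hs := sq_mul_r_sq_le (ε := ε) (y := y)
  have hs0 : 0 ≤ ε ^ 2 * r ε y ^ 2 := by positivity
  have h1 : |-3 * δ + 15 * (w1 ε j y * w1 ε k y)| ≤ 18 := by
    rw [abs_le] at *; constructor <;> linarith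
  have h2 : |ε ^ 2 * r ε y ^ 2 * (-3 * δ + 15 * (w1 ε j y * w1 ε k y))| ≤ 18 := by
    rw [abs_mul, abs_of_nonneg hs0]
    exact (mul_le_of_le_one_left (abs_nonneg _) hs).trans h1
  rw [abs_le] at *; constructor <;> linarith

theorem w4_nonpos : w4 ε y ≤ 0 := by
  have h0 := r_nonneg (ε := ε) (y := y)
  have : 0 ≤ 15 * ε ^ 4 * r ε y ^ 7 := by positivity
  rw [w4]; linarith

theorem abs_wLap_le : |wLap ε y| ≤ 3 * r ε y := by
  have h0 := r_nonneg (ε := ε) (y := y)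
  have h : ε ^ 2 * r ε y ^ 3 ≤ r ε y := by
    rw [show ε ^ 2 * r ε y ^ 3 = ε ^ 2 * r ε y ^ 2 * r ε y by ring]
    exact mul_le_of_le_one_left h0 sq_mul_r_sq_le
  rw [wLap, abs_of_nonneg (by positivity)]
  linarith

open Filter Topology in
theorem tendsto_r (hy : y ≠ 0) : Tendsto (fun ε => r ε y) (𝓝 0) (𝓝 (r 0 y)) := by
  have : ContinuousAt (fun ε => r ε y) 0 := by
    unfold r
    refine ContinuousAt.inv₀ (by fun_prop) ?_
    have : 0 < ‖y‖ := norm_pos_iff.2 hy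
    positivity
  exact this

open Filter Topology in
theorem tendsto_w1 (hy : y ≠ 0) (k : Fin 3) :
    Tendsto (fun ε => w1 ε k y) (𝓝 0) (𝓝 (w1 0 k y)) := (tendsto_r hy).const_mul _

open Filter Topology in
theorem tendsto_w2 (hy : y ≠ 0) (j k : Fin 3) :
    Tendsto (fun ε => w2 ε j k y) (𝓝 0) (𝓝 (w2 0 j k y)) :=
  ((tendsto_r hy).const_mul _).sub (((tendsto_r hy).pow 3).const_mul _)

open Filter Topology in
theorem tendsto_w3 (hy : y ≠ 0) (k : Fin 3) :
    Tendsto (fun ε => w3 ε k y) (𝓝 0) (𝓝 (w3 0 k y)) := by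
  have h : Tendsto (fun ε : ℝ => ε) (𝓝 0) (𝓝 0) := tendsto_id
  exact (((tendsto_r hy).pow 3).const_mul (y k) |>.const_mul (-2)).sub
    (((h.pow 2).const_mul 3).mul (((tendsto_r hy).pow 5).const_mul (y k)))

@[fun_prop]
theorem measurable_w1 (k : Fin 3) : Measurable (w1 ε k) := by unfold w1; fun_prop

@[fun_prop]
theorem measurable_w2 (j k : Fin 3) : Measurable (w2 ε j k) := by unfold w2; fun_prop

@[fun_prop]
theorem measurable_wLap : Measurable (wLap ε) := by unfold wLap; fun_prop

@[fun_prop]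
theorem measurable_w3 (k : Fin 3) : Measurable (w3 ε k) := by unfold w3; fun_prop

@[fun_prop]
theorem measurable_w3' (j k : Fin 3) : Measurable (w3' ε j k) := by unfold w3'; fun_prop

@[fun_prop]
theorem measurable_w4 : Measurable (w4 ε) := by unfold w4; fun_prop

/-- A scalar form of the positivity behind the interaction Morawetz estimate. -/
theorem two_mul_im_mul_im_le (U V a b : ℂ) :
    2 * (U * conj a).im * (V * conj b).im ≤
      ‖U‖ ^ 2 * (b * conj b).re + ‖V‖ ^ 2 * (a * conj a).re := by
  have h1 : |(U * conj a).im| ≤ ‖U‖ * ‖a‖ := by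
    simpa using Complex.abs_im_le_norm (U * conj a)
  have h2 : |(V * conj b).im| ≤ ‖V‖ * ‖b‖ := by
    simpa using Complex.abs_im_le_norm (V * conj b)
  rw [Complex.mul_conj, Complex.mul_conj, Complex.ofReal_re, Complex.ofReal_re,
    Complex.normSq_eq_norm_sq, Complex.normSq_eq_norm_sq]
  have h3 := mul_le_mul h1 h2 (abs_nonneg _) (by positivity)
  rw [← abs_mul] at h3
  have h4 := le_abs_self ((U * conj a).im * (V * conj b).im)
  nlinarith [sq_nonneg (‖U‖ * ‖b‖ - ‖V‖ * ‖a‖)]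

/-- The Hessian of the weight is nonnegative, in the symmetrized form used for two particles. -/
theorem sum_w2_mul_le (h : 0 < ε ^ 2 + ‖y‖ ^ 2) (U V : ℂ) (a b : Fin 3 → ℂ) :
    ∑ j, ∑ k, w2 ε j k y * (2 * (U * conj (a j)).im * (V * conj (b k)).im) ≤
      ∑ j, ∑ k, w2 ε j k y * (‖U‖ ^ 2 * (b j * conj (b k)).re + ‖V‖ ^ 2 *
          (a j * conj (a k)).re) := by
  have h1 := r_sq h
  have h0 := r_nonneg (ε := ε) (y := y)
  have hw : ∀ j k, w2 ε j k y = r ε y ^ 3 *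
      ((if j = k then 1 else 0) * (ε ^ 2 + ‖y‖ ^ 2) - y j * y k) := by
    intro j k
    rw [w2]
    linear_combination (-(if j = k then 1 else 0) * r ε y) * h1
  simp only [hw, mul_assoc, ← Finset.mul_sum]
  refine mul_le_mul_of_nonneg_left ?_ (pow_nonneg h0 3)
  have e0 := two_mul_im_mul_im_le U V (a 0) (b 0)
  have e1 := two_mul_im_mul_im_le U V (a 1) (b 1)
  have e2 := two_mul_im_mul_im_le U V (a 2) (b 2)
  -- By Lagrange's identity the form $(\varepsilon^2+|y|^2)|v|^2-(y\cdot v)^2$ equals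
  -- $\varepsilon^2|v|^2+|y\times v|^2$. The scalar inequality is therefore applied to the three
  -- coordinates of the gradients, with factor $\varepsilon^2$, and to the three components of their
  -- cross products with $y$.
  have f0 := two_mul_im_mul_im_le U V (y 1 * a 2 - y 2 * a 1) (y 1 * b 2 - y 2 * b 1)
  have f1 := two_mul_im_mul_im_le U V (y 2 * a 0 - y 0 * a 2) (y 2 * b 0 - y 0 * b 2)
  have f2 := two_mul_im_mul_im_le U V (y 0 * a 1 - y 1 * a 0) (y 0 * b 1 - y 1 * b 0)
  have hε := sq_nonneg ε
  replace e0 := mul_le_mul_of_nonneg_left e0 hε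
  replace e1 := mul_le_mul_of_nonneg_left e1 hε
  replace e2 := mul_le_mul_of_nonneg_left e2 hε
  rw [normSq_eq]
  simp only [Fin.sum_univ_three]
  simp [Complex.mul_re, Complex.mul_im] at *
  linarith

end

/-! ### Two-particle integrals and integration by parts. -/

noncomputable section

section MeasurePreserving

variable {α β γ δ : Type*} [MeasurableSpace α] [MeasurableSpace β] [MeasurableSpace γ]
  [MeasurableSpace δ]

/-- The exchange of the two middle factors of a product of four spaces. -/
def prodExchange (α β γ δ : Type*) [MeasurableSpace α] [MeasurableSpace β] [MeasurableSpace γ]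
    [MeasurableSpace δ] : (α × β) × (γ × δ) ≃ᵐ (α × γ) × (β × δ) where
  toEquiv := Equiv.prodProdProdComm α β γ δ
  measurable_toFun := by
    change Measurable fun p : (α × β) × (γ × δ) => ((p.1.1, p.2.1), (p.1.2, p.2.2))
    fun_prop
  measurable_invFun := by
    change Measurable fun p : (α × γ) × (β × δ) => ((p.1.1, p.2.1), (p.1.2, p.2.2))
    fun_prop

theorem measurePreserving_prodExchange (a : Measure α) (b : Measure β) (c : Measure γ)
    (e : Measure δ) [SFinite a] [SFinite b] [SFinite c] [SFinite e] :
    MeasurePreserving (prodExchange α β γ δ) ((a.prod b).prod (c.prod e))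
      ((a.prod c).prod (b.prod e)) := by
  have h1 := measurePreserving_prodAssoc a b (c.prod e)
  have h2 := (MeasurePreserving.id a).prod ((measurePreserving_prodAssoc b c e).symm)
  have h3 := (MeasurePreserving.id a).prod
    ((Measure.measurePreserving_swap (μ := b) (ν := c)).prod (MeasurePreserving.id e))
  have h4 := (MeasurePreserving.id a).prod (measurePreserving_prodAssoc c b e)
  have h5 := (measurePreserving_prodAssoc a c (b.prod e)).symm
  exact h5.comp (h4.comp (h3.comp (h2.comp h1)))

end MeasurePreserving

variable {d : ℕ}

instance : (volume : Measure (X d)).IsAddHaarMeasure :=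
  inferInstanceAs ((volume : Measure Y).prod (volume : Measure (Z d))).IsAddHaarMeasure

theorem ae_fst_ne (y : Y) : ∀ᵐ x : X d, x.1 ≠ y := by
  have : ∀ᵐ y' : Y, y' ≠ y := by simp [ae_iff]
  exact Measure.quasiMeasurePreserving_fst.ae this

/-- The weights for $\varepsilon=0$ are meaningful only off $y=y'$. As this set is null, every
comparison of weights may ignore it. -/
theorem ae_fst_ne_fst : ∀ᵐ q : X d × X d, q.2.1 - q.1.1 ≠ 0 := by
  have hm : MeasurableSet {q : X d × X d | q.2.1 - q.1.1 ≠ 0} :=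
    (measurableSet_eq_fun (by fun_prop) (by fun_prop)).compl
  rw [Measure.volume_eq_prod, Measure.ae_prod_iff_ae_ae hm]
  refine Filter.Eventually.of_forall fun x => ?_
  filter_upwards [ae_fst_ne x.1] with x' hx'
  exact sub_ne_zero.2 hx'

/-- The two-particle integral `∫∫ f(x') w(y - y') g(x) dx' dx`. -/
def pairing (w : Y → ℝ) (f g : X d → ℝ) : ℝ :=
  ∫ q : X d × X d, f q.1 * w (q.2.1 - q.1.1) * g q.2

/-- Bounded measurable weights. -/
def BddW (w : Y → ℝ) : Prop := Measurable w ∧ ∃ C : ℝ, ∀ y, |w y| ≤ C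

variable {w w' : Y → ℝ} {f g f' g' : X d → ℝ}

theorem integrable_pairing (hw : BddW w) (hf : Integrable f) (hg : Integrable g) :
    Integrable (fun q : X d × X d => f q.1 * w (q.2.1 - q.1.1) * g q.2) := by
  obtain ⟨hm, C, hC⟩ := hw
  have h := (hf.mul_prod hg).bdd_mul (c := C)
    (f := fun q : X d × X d => w (q.2.1 - q.1.1))
    ((hm.comp (by fun_prop)).aestronglyMeasurable)
    (Filter.Eventually.of_forall fun q => hC _)
  refine h.congr (Filter.Eventually.of_forall fun q => ?_)
  simp only; ring

theorem pairing_add_left (hw : BddW w) (hf : Integrable f) (hf' : Integrable f')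
    (hg : Integrable g) :
    pairing w (fun x => f x + f' x) g = pairing w f g + pairing w f' g := by
  rw [pairing, pairing, pairing,
    ← integral_add (integrable_pairing hw hf hg) (integrable_pairing hw hf' hg)]
  congr 1; funext q; ring

theorem pairing_add_right (hw : BddW w) (hf : Integrable f) (hg : Integrable g)
    (hg' : Integrable g') :
    pairing w f (fun x => g x + g' x) = pairing w f g + pairing w f g' := by
  rw [pairing, pairing, pairing,
    ← integral_add (integrable_pairing hw hf hg) (integrable_pairing hw hf hg')]
  congr 1; funext q; ring

theorem pairing_sub_right (hw : BddW w) (hf : Integrable f) (hg : Integrable g)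
    (hg' : Integrable g') :
    pairing w f (fun x => g x - g' x) = pairing w f g - pairing w f g' := by
  rw [pairing, pairing, pairing,
    ← integral_sub (integrable_pairing hw hf hg) (integrable_pairing hw hf hg')]
  congr 1; funext q; ring

theorem pairing_const_mul_right (c : ℝ) :
    pairing w f (fun x => c * g x) = c * pairing w f g := by
  rw [pairing, pairing, ← integral_const_mul]
  congr 1; funext q; ring

theorem pairing_sum_left {ι : Type*} (s : Finset ι) {f : ι → X d → ℝ} (hw : BddW w)
    (hf : ∀ i ∈ s, Integrable (f i)) (hg : Integrable g) :
    pairing w (fun x => ∑ i ∈ s, f i x) g = ∑ i ∈ s, pairing w (f i) g := by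
  simp only [pairing]
  rw [← integral_finsetSum _ fun i hi => integrable_pairing hw (hf i hi) hg]
  congr 1; funext q; simp only [Finset.sum_mul]

theorem pairing_sum_right {ι : Type*} (s : Finset ι) {g : ι → X d → ℝ} (hw : BddW w)
    (hf : Integrable f) (hg : ∀ i ∈ s, Integrable (g i)) :
    pairing w f (fun x => ∑ i ∈ s, g i x) = ∑ i ∈ s, pairing w f (g i) := by
  simp only [pairing]
  rw [← integral_finsetSum _ fun i hi => integrable_pairing hw hf (hg i hi)]
  congr 1; funext q; simp only [Finset.mul_sum]

theorem pairing_sum_weight {ι : Type*} (s : Finset ι) {w : ι → Y → ℝ} (hw : ∀ i ∈ s, BddW (w i))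
    (hf : Integrable f) (hg : Integrable g) :
    pairing (fun y => ∑ i ∈ s, w i y) f g = ∑ i ∈ s, pairing (w i) f g := by
  simp only [pairing]
  rw [← integral_finsetSum _ fun i hi => integrable_pairing (hw i hi) hf hg]
  congr 1; funext q; simp only [Finset.sum_mul, Finset.mul_sum]

theorem hasLineDerivAt_weight_left {k : Fin 3} {c : ℝ} {y : Y} {x : X d}
    (h : HasPD k w c (y - x.1)) :
    HasLineDerivAt ℝ (fun x : X d => w (y - x.1)) (-c) x (basisVec d (Sum.inl k)) := by
  have h1 : HasFDerivAt (fun x : X d => y - x.1) (-ContinuousLinearMap.fst ℝ Y (Z d)) x := by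
    simpa using (hasFDerivAt_fst (𝕜 := ℝ) (p := x)).const_sub y
  have h2 := (h.1.hasFDerivAt.comp x h1).hasLineDerivAt (basisVec d (Sum.inl k))
  convert! h2 using 1
  rw [← h.2]
  simp [pdY, basisVec]

theorem hasLineDerivAt_weight_right {k : Fin 3} {c : ℝ} {y : Y} {x : X d}
    (h : HasPD k w c (x.1 - y)) :
    HasLineDerivAt ℝ (fun x : X d => w (x.1 - y)) c x (basisVec d (Sum.inl k)) := by
  have h1 : HasFDerivAt (fun x : X d => x.1 - y) (ContinuousLinearMap.fst ℝ Y (Z d)) x := by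
    simpa using (hasFDerivAt_fst (𝕜 := ℝ) (p := x)).sub_const y
  have h2 := (h.1.hasFDerivAt.comp x h1).hasLineDerivAt (basisVec d (Sum.inl k))
  convert! h2 using 1
  rw [← h.2]
  simp [pdY, basisVec]

/-- A displacement in $z$ does not change the argument of the weight, so no regularity of $w$ is
required. -/
theorem hasLineDerivAt_fst_const (w : Y → ℝ) (x : X d) (j : Fin (d - 3)) :
    HasLineDerivAt ℝ (fun x : X d => w x.1) 0 x (basisVec d (Sum.inr j)) := by
  simp only [HasLineDerivAt, basisVec]
  simpa using hasDerivAt_const (0 : ℝ) (w x.1)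

/-- Boundedness of the weight and of its derivative makes all three products integrable, which is
why no boundary term at infinity appears. Line derivatives are enough, so the same statement serves
$y$- and $z$-directions. -/
theorem integral_mul_pd {W W' : X d → ℝ} {α : Idx d} (hW : Measurable W) (hW' : Measurable W')
    {C C' : ℝ} (hC : ∀ x, |W x| ≤ C) (hC' : ∀ x, |W' x| ≤ C')
    (hd : ∀ x, HasLineDerivAt ℝ W (W' x) x (basisVec d α))
    (hfd : Differentiable ℝ f) (hf : Integrable f) (hf' : Integrable (pd α f)) :
    ∫ x, W x * pd α f x = -∫ x, W' x * f x := by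
  refine integral_bilinear_hasLineDerivAt_right_eq_neg_left_of_integrable
    (B := ContinuousLinearMap.mul ℝ ℝ) (v := basisVec d α)
    (hf.bdd_mul hW'.aestronglyMeasurable (Filter.Eventually.of_forall hC'))
    (hf'.bdd_mul hW.aestronglyMeasurable (Filter.Eventually.of_forall hC))
    (hf.bdd_mul hW.aestronglyMeasurable (Filter.Eventually.of_forall hC))
    (fun x _ => hd x) (fun x _ => (hfd x).hasFDerivAt.hasLineDerivAt _)

theorem pairing_eq_integral_left (hw : BddW w) (hf : Integrable f) (hg : Integrable g) :
    pairing w f g = ∫ x, (∫ x', w (x.1 - x'.1) * f x') * g x := by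
  rw [pairing, Measure.volume_eq_prod, integral_prod_symm _ (integrable_pairing hw hf hg)]
  congr 1; funext x
  rw [← integral_mul_const]
  congr 1; funext x'; ring

theorem pairing_eq_integral_right (hw : BddW w) (hf : Integrable f) (hg : Integrable g) :
    pairing w f g = ∫ x', f x' * ∫ x, w (x.1 - x'.1) * g x := by
  rw [pairing, Measure.volume_eq_prod, integral_prod _ (integrable_pairing hw hf hg)]
  congr 1; funext x
  rw [← integral_const_mul]
  congr 1; funext x'; ring

/-- The sign is positive here because the minus of integration by parts cancels the minus from
$\partial_{y'}w(y-y')$; for the second particle only the former is present. -/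
theorem pairing_pd_left {k : Fin 3} (hw : BddW w) (hw' : BddW w') (hd : ∀ y, HasPD k w (w' y) y)
    (hfd : Differentiable ℝ f) (hf : Integrable f) (hf' : Integrable (pd (Sum.inl k) f))
    (hg : Integrable g) : pairing w (pd (Sum.inl k) f) g = pairing w' f g := by
  obtain ⟨C, hC⟩ := hw.2
  obtain ⟨C', hC'⟩ := hw'.2
  rw [pairing_eq_integral_left hw hf' hg, pairing_eq_integral_left hw' hf hg]
  congr 1; funext x
  congr 1
  have hm := hw.1
  have hm' := hw'.1
  have := integral_mul_pd (W := fun x' : X d => w (x.1 - x'.1))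
    (W' := fun x' : X d => -w' (x.1 - x'.1)) (α := Sum.inl k) (by fun_prop) (by fun_prop)
    (fun _ => hC _) (fun _ => by rw [abs_neg]; exact hC' _)
    (fun x' => hasLineDerivAt_weight_left (hd _)) hfd hf hf'
  rw [this, ← integral_neg]
  congr 1; funext x'; ring

theorem pairing_pd_right {k : Fin 3} (hw : BddW w) (hw' : BddW w') (hd : ∀ y, HasPD k w (w' y) y)
    (hgd : Differentiable ℝ g) (hg : Integrable g) (hg' : Integrable (pd (Sum.inl k) g))
    (hf : Integrable f) : pairing w f (pd (Sum.inl k) g) = -pairing w' f g := by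
  obtain ⟨C, hC⟩ := hw.2
  obtain ⟨C', hC'⟩ := hw'.2
  rw [pairing_eq_integral_right hw hf hg', pairing_eq_integral_right hw' hf hg, ← integral_neg]
  congr 1; funext x
  have hm := hw.1
  have hm' := hw'.1
  have := integral_mul_pd (W := fun x' : X d => w (x'.1 - x.1))
    (W' := fun x' : X d => w' (x'.1 - x.1)) (α := Sum.inl k) (by fun_prop) (by fun_prop)
    (fun _ => hC _) (fun _ => hC' _)
    (fun x' => hasLineDerivAt_weight_right (hd _)) hgd hg hg'
  rw [this]; ring

theorem pairing_pd_inr_left {j : Fin (d - 3)} (hw : BddW w)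
    (hfd : Differentiable ℝ f) (hf : Integrable f) (hf' : Integrable (pd (Sum.inr j) f))
    (hg : Integrable g) : pairing w (pd (Sum.inr j) f) g = 0 := by
  obtain ⟨C, hC⟩ := hw.2
  rw [pairing_eq_integral_left hw hf' hg]
  have hm := hw.1
  have key : ∀ x : X d, ∫ x', w (x.1 - x'.1) * pd (Sum.inr j) f x' = 0 := fun x => by
    have := integral_mul_pd (W := fun x' : X d => w (x.1 - x'.1))
      (W' := fun x' : X d => 0) (α := Sum.inr j) (by fun_prop) (by fun_prop)
      (fun _ => hC _) (C' := 0) (fun _ => by simp)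
      (fun x' => hasLineDerivAt_fst_const (fun y => w (x.1 - y)) x' j) hfd hf hf'
    rw [this]; simp
  simp [key]

theorem pairing_pd_inr_right {j : Fin (d - 3)} (hw : BddW w)
    (hgd : Differentiable ℝ g) (hg : Integrable g) (hg' : Integrable (pd (Sum.inr j) g))
    (hf : Integrable f) : pairing w f (pd (Sum.inr j) g) = 0 := by
  obtain ⟨C, hC⟩ := hw.2
  rw [pairing_eq_integral_right hw hf hg']
  have hm := hw.1
  have key : ∀ x' : X d, ∫ x, w (x.1 - x'.1) * pd (Sum.inr j) g x = 0 := fun x => by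
    have := integral_mul_pd (W := fun x' : X d => w (x'.1 - x.1))
      (W' := fun x' : X d => 0) (α := Sum.inr j) (by fun_prop) (by fun_prop)
      (fun _ => hC _) (C' := 0) (fun _ => by simp)
      (fun x' => hasLineDerivAt_fst_const (fun y => w (y - x.1)) x' j) hgd hg hg'
    rw [this]; simp
  simp [key]

end

/-! ### Singular weights: integrability, limits, and passage to the $z$-integrated form. -/

noncomputable section

variable {d : ℕ} {T t : ℝ}

/-- The measure `ds dx' dx` on `[0, t] × ℝ^d × ℝ^d`. -/
def stMeasure (d : ℕ) (t : ℝ) : Measure (ℝ × (X d × X d)) :=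
  (volume.restrict (Icc 0 t)).prod volume

/-- The two-particle integrand `f(s, x') w(y - y') g(s, x)`. -/
def kern (w : Y → ℝ) (f g : ℝ → X d → ℝ) (q : ℝ × (X d × X d)) : ℝ :=
  f q.1 q.2.1 * w (q.2.2.1 - q.2.1.1) * g q.1 q.2.2

/-- `∫ |f(s, x')| |w(y - y')| dx'` is bounded uniformly in `s` and `y`. -/
def Dom (T : ℝ) (f : ℝ → X d → ℝ) (w : Y → ℝ) : Prop :=
  Measurable w ∧ ContinuousOn (fun q : ℝ × X d => f q.1 q.2) (Icc 0 T ×ˢ univ) ∧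
    ∃ K : ℝ≥0, ∀ s ∈ Icc 0 T, ∀ y : Y, ∫⁻ x, ‖f s x‖ₑ * ‖w (y - x.1)‖ₑ ≤ K

variable {f g : ℝ → X d → ℝ} {w κ : Y → ℝ}

theorem stMeasure_eq : stMeasure d t = (volume : Measure (ℝ × (X d × X d))).restrict
    (Icc 0 t ×ˢ univ) := by
  rw [stMeasure, Measure.volume_eq_prod ℝ, ← Measure.prod_restrict, Measure.restrict_univ]

theorem aestronglyMeasurable_stMeasure {φ : ℝ × (X d × X d) → X d} (hφ : Continuous φ)
    {F : Type*} [NormedAddCommGroup F] [SecondCountableTopology F] {f : ℝ → X d → F}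
    (hf : ContinuousOn (fun q : ℝ × X d => f q.1 q.2) (Icc 0 T ×ˢ univ)) (ht : t ≤ T) :
    AEStronglyMeasurable (fun q => f q.1 (φ q)) (stMeasure d t) := by
  rw [stMeasure_eq]
  have h : ContinuousOn (fun q : ℝ × (X d × X d) => f q.1 (φ q)) (Icc 0 t ×ˢ univ) :=
    hf.comp (f := fun q : ℝ × (X d × X d) => (q.1, φ q)) (by fun_prop)
      (fun q hq => ⟨⟨hq.1.1, hq.1.2.trans ht⟩, mem_univ _⟩)
  exact h.aestronglyMeasurable (measurableSet_Icc.prod MeasurableSet.univ)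

theorem aestronglyMeasurable_kern (hw : Measurable w)
    (hf : ContinuousOn (fun q : ℝ × X d => f q.1 q.2) (Icc 0 T ×ˢ univ))
    (hg : ContinuousOn (fun q : ℝ × X d => g q.1 q.2) (Icc 0 T ×ˢ univ)) (ht : t ≤ T) :
    AEStronglyMeasurable (kern w f g) (stMeasure d t) :=
  ((aestronglyMeasurable_stMeasure (φ := fun q => q.2.1) (by fun_prop) hf ht).mul
    (hw.comp (by fun_prop : Measurable fun q : ℝ × (X d × X d) => q.2.2.1 - q.2.1.1)
      ).aestronglyMeasurable).mul
    (aestronglyMeasurable_stMeasure (φ := fun q => q.2.2) (by fun_prop) hg ht)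

/-- Tonelli with the first particle integrated first: the singularity is paid for by the uniform
bound $K$, and only the $L^1$ norm of $g$ remains. This is what makes `Dom` the right hypothesis on
$f$ and $w$. -/
theorem lintegral_pairing_le {f g : X d → ℝ} (hw : Measurable w) (hf : Continuous f)
    (hg : Continuous g) {K : ℝ≥0∞} (hK : ∀ y : Y, ∫⁻ x, ‖f x‖ₑ * ‖w (y - x.1)‖ₑ ≤ K) :
    ∫⁻ q : X d × X d, ‖f q.1 * w (q.2.1 - q.1.1) * g q.2‖ₑ ≤ K * ∫⁻ x, ‖g x‖ₑ := by
  have hf' := hf.measurable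
  have hg' := hg.measurable
  rw [Measure.volume_eq_prod, lintegral_prod_symm _ (by fun_prop)]
  rw [← lintegral_const_mul _ (by fun_prop)]
  refine lintegral_mono fun x => ?_
  simp only [enorm_mul]
  rw [lintegral_mul_const _ (by fun_prop)]
  gcongr
  exact hK x.1

theorem integrable_kern (hf : Dom T f w) (hg : Reg 1 T 0 g) (ht : t ≤ T) :
    Integrable (kern w f g) (stMeasure d t) := by
  obtain ⟨hw, hfc, K, hK⟩ := hf
  have hm := aestronglyMeasurable_kern hw hfc hg.continuousOn ht
  refine ⟨hm, ?_⟩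
  obtain ⟨K', hK'⟩ := hg.bound
  rw [HasFiniteIntegral]
  rw [stMeasure] at hm ⊢
  rw [lintegral_prod _ hm.enorm]
  calc _ ≤ ∫⁻ s in Icc 0 t, (K * K' : ℝ≥0∞) := by
        refine setLIntegral_mono measurable_const fun s hs => ?_
        have hs' : s ∈ Icc 0 T := ⟨hs.1, hs.2.trans ht⟩
        have hfs : Continuous (f s) := by
          have := hfc.comp (f := fun x : X d => (s, x)) (s := univ) (by fun_prop)
            (fun x _ => ⟨hs', mem_univ _⟩)
          exact continuousOn_univ.1 this
        refine (lintegral_pairing_le hw hfs (hg.continuous hs') (hK s hs')).trans ?_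
        gcongr
        rw [← eLpNorm_one_eq_lintegral_enorm]
        exact hK' s hs'
    _ < ∞ := by
        rw [setLIntegral_const]
        simp [ENNReal.mul_lt_top]

theorem Dom.of_bddW (hf : Reg 1 T 0 f) (hw : BddW w) : Dom T f w := by
  obtain ⟨hm, C, hC⟩ := hw
  obtain ⟨K, hK⟩ := hf.bound
  refine ⟨hm, hf.continuousOn, K * C.toNNReal, fun s hs y => ?_⟩
  calc _ ≤ ∫⁻ x, ‖f s x‖ₑ * ENNReal.ofReal C := by
        refine lintegral_mono fun x => ?_
        gcongr
        rw [Real.enorm_eq_ofReal_abs]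
        exact ENNReal.ofReal_le_ofReal (hC _)
    _ = (∫⁻ x, ‖f s x‖ₑ) * ENNReal.ofReal C :=
        lintegral_mul_const _ (hf.continuous hs).measurable.enorm
    _ ≤ _ := by
        push_cast
        refine mul_le_mul' ?_ le_rfl
        rw [← eLpNorm_one_eq_lintegral_enorm]
        exact hK s hs

theorem Dom.of_le (hf : Dom T f κ) (hw : Measurable w) {C : ℝ}
    (h : ∀ y, y ≠ 0 → |w y| ≤ C * |κ y|) : Dom T f w := by
  obtain ⟨hm, hfc, K, hK⟩ := hf
  refine ⟨hw, hfc, C.toNNReal * K, fun s hs y => ?_⟩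
  calc _ ≤ ∫⁻ x, ENNReal.ofReal C * (‖f s x‖ₑ * ‖κ (y - x.1)‖ₑ) := by
        refine lintegral_mono_ae ?_
        filter_upwards [ae_fst_ne y] with x hx
        rw [mul_left_comm]
        gcongr
        rcases le_or_gt 0 C with hC | hC
        · rw [Real.enorm_eq_ofReal_abs, Real.enorm_eq_ofReal_abs, ← ENNReal.ofReal_mul hC]
          exact ENNReal.ofReal_le_ofReal (h _ (sub_ne_zero.2 hx.symm))
        -- A negative constant forces the weight to vanish off the origin, so the bound survives
        -- truncation of $C$ to zero.
        · have h1 := h _ (sub_ne_zero.2 hx.symm)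
          have h2 : w (y - x.1) = 0 := by
            have := mul_nonpos_of_nonpos_of_nonneg hC.le (abs_nonneg (κ (y - x.1)))
            exact abs_nonpos_iff.1 (h1.trans this)
          simp [h2]
    _ = ENNReal.ofReal C * ∫⁻ x, (‖f s x‖ₑ * ‖κ (y - x.1)‖ₑ) :=
        lintegral_const_mul' _ _ ENNReal.ofReal_ne_top
    _ ≤ _ := by
        push_cast
        exact mul_le_mul' le_rfl (hK s hs y)

theorem ae_stMeasure_ne : ∀ᵐ q ∂(stMeasure d t), q.2.2.1 - q.2.1.1 ≠ 0 :=
  Measure.quasiMeasurePreserving_snd.ae (ae_fst_ne_fst (d := d))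

-- Dominated convergence with majorant $C\,|f|\,|\kappa|\,|g|$, integrable by `integrable_kern`.
-- Here $\kappa$ will be $1$, $|y|^{-1}$ or $|y|^{-2}$, and the weights need be compared with it
-- only off the origin.
open Filter Topology in
theorem tendsto_integral_kern (hf : Dom T f κ) (hg : Reg 1 T 0 g) (ht : t ≤ T) {W : ℕ → Y → ℝ}
    (hW : ∀ n, Measurable (W n)) {C : ℝ} (h : ∀ n y, y ≠ 0 → |W n y| ≤ C * |κ y|)
    (hlim : ∀ y, y ≠ 0 → Tendsto (fun n => W n y) atTop (𝓝 (w y))) :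
    Tendsto (fun n => ∫ q, kern (W n) f g q ∂(stMeasure d t)) atTop
      (𝓝 (∫ q, kern w f g q ∂(stMeasure d t))) := by
  refine tendsto_integral_of_dominated_convergence (fun q => C * ‖kern κ f g q‖)
    (fun n => aestronglyMeasurable_kern (hW n) hf.2.1 hg.continuousOn ht)
    ((integrable_kern hf hg ht).norm.const_mul C) (fun n => ?_) ?_
  · filter_upwards [ae_stMeasure_ne] with q hq
    simp only [kern, norm_mul, Real.norm_eq_abs]
    have := h n _ hq
    calc _ ≤ |f q.1 q.2.1| * (C * |κ (q.2.2.1 - q.2.1.1)|) * |g q.1 q.2.2| := by gcongr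
      _ = _ := by ring
  · filter_upwards [ae_stMeasure_ne] with q hq
    exact ((hlim _ hq).const_mul _).mul_const _

open Filter Topology in
theorem tendsto_pairing {f g : X d → ℝ} (hf : Integrable f) (hg : Integrable g) {W : ℕ → Y → ℝ}
    (hW : ∀ n, Measurable (W n)) {C : ℝ} (h : ∀ n y, |W n y| ≤ C)
    (hlim : ∀ y, y ≠ 0 → Tendsto (fun n => W n y) atTop (𝓝 (w y))) :
    Tendsto (fun n => pairing (W n) f g) atTop (𝓝 (pairing w f g)) := by
  refine tendsto_integral_of_dominated_convergence (fun q => C * ‖f q.1 * g q.2‖)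
    (fun n => (integrable_pairing ⟨hW n, C, h n⟩ hf hg).aestronglyMeasurable)
    ((hf.mul_prod hg).norm.const_mul C)
    (fun n => Filter.Eventually.of_forall fun q => ?_) ?_
  · simp only [norm_mul, Real.norm_eq_abs]
    have := h n (q.2.1 - q.1.1)
    calc _ ≤ |f q.1| * C * |g q.2| := by gcongr
      _ = _ := by ring
  · filter_upwards [ae_fst_ne_fst] with q hq
    exact ((hlim _ hq).const_mul _).mul_const _

theorem integral_pairing_eq (hf : Dom T f w) (hg : Reg 1 T 0 g) (ht : t ≤ T) :
    ∫ s in Icc 0 t, pairing w (f s) (g s) = ∫ q, kern w f g q ∂(stMeasure d t) :=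
  (integral_prod _ (integrable_kern hf hg ht)).symm

theorem integrableOn_pairing (hf : Dom T f w) (hg : Reg 1 T 0 g) (ht : t ≤ T) :
    IntegrableOn (fun s => pairing w (f s) (g s)) (Icc 0 t) :=
  (integrable_kern hf hg ht).integral_prod_left

/-- The `z`-integrated two-particle integrand. -/
theorem integral_zz (w : Y → ℝ) (f g : X d → ℝ) (η y : Y) :
    ∫ z : Z d × Z d, f (η, z.1) * w (y - η) * g (y, z.2) =
      (∫ z, f (η, z)) * w (y - η) * ∫ z, g (y, z) := by
  rw [Measure.volume_eq_prod, integral_prod_mul (fun z => f (η, z) * w (y - η)) fun z => g (y, z),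
    integral_mul_const]

/-- The variables $(y',z',y,z)$ are regrouped as $((y',y),(z',z))$ by `prodExchange`; Fubini in the
second group produces the product of two $z$-integrals that appears in the statement of the theorem.
-/
theorem integrable_zInt {f g : X d → ℝ}
    (h : Integrable (fun q : X d × X d => f q.1 * w (q.2.1 - q.1.1) * g q.2)) :
    Integrable (fun p : Y × Y => (∫ z, f (p.1, z)) * w (p.2 - p.1) * ∫ z, g (p.2, z)) := by
  have hmp := measurePreserving_prodExchange (volume : Measure Y) (volume : Measure (Z d))
    (volume : Measure Y) (volume : Measure (Z d))
  have h1 := (hmp.symm.integrable_comp_emb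
      (prodExchange Y (Z d) Y (Z d)).symm.measurableEmbedding).2 h
  refine h1.integral_prod_left.congr (Filter.Eventually.of_forall fun p => ?_)
  exact integral_zz w f g p.1 p.2

theorem integral_zInt {f g : X d → ℝ}
    (h : Integrable (fun q : X d × X d => f q.1 * w (q.2.1 - q.1.1) * g q.2)) :
    ∫ p : Y × Y, (∫ z, f (p.1, z)) * w (p.2 - p.1) * ∫ z, g (p.2, z) = pairing w f g := by
  have hmp := measurePreserving_prodExchange (volume : Measure Y) (volume : Measure (Z d))
    (volume : Measure Y) (volume : Measure (Z d))
  have h1 := (hmp.symm.integrable_comp_emb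
      (prodExchange Y (Z d) Y (Z d)).symm.measurableEmbedding).2 h
  have h2 := hmp.symm.integral_comp (prodExchange Y (Z d) Y (Z d)).symm.measurableEmbedding
    (fun q : X d × X d => f q.1 * w (q.2.1 - q.1.1) * g q.2)
  rw [pairing]
  refine Eq.trans ?_ h2
  refine Eq.trans ?_ (integral_prod _ h1).symm
  congr 1; funext p
  exact (integral_zz w f g p.1 p.2).symm

theorem integrable_zInt_kern (h : Integrable (kern w f g) (stMeasure d t)) :
    Integrable (fun q : ℝ × (Y × Y) =>
      (∫ z, f q.1 (q.2.1, z)) * w (q.2.2 - q.2.1) * ∫ z, g q.1 (q.2.2, z))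
      ((volume.restrict (Icc 0 t)).prod volume) := by
  have hmp := (MeasurePreserving.id (volume.restrict (Icc (0 : ℝ) t))).prod
    (measurePreserving_prodExchange (volume : Measure Y) (volume : Measure (Z d))
    (volume : Measure Y) (volume : Measure (Z d))).symm
  have ha := measurePreserving_prodAssoc (volume.restrict (Icc (0 : ℝ) t))
    ((volume : Measure Y).prod (volume : Measure Y))
    ((volume : Measure (Z d)).prod (volume : Measure (Z d)))
  have h1 := ((hmp.comp ha).integrable_comp h.aestronglyMeasurable).2 h
  refine h1.integral_prod_left.congr (Filter.Eventually.of_forall fun p => ?_)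
  exact integral_zz w (f p.1) (g p.1) p.2.1 p.2.2

theorem ae_snd_ne_fst : ∀ᵐ p : Y × Y, p.2 ≠ p.1 := by
  have hm : MeasurableSet {p : Y × Y | p.2 ≠ p.1} :=
    (measurableSet_eq_fun (by fun_prop) (by fun_prop)).compl
  rw [Measure.volume_eq_prod, Measure.ae_prod_iff_ae_ae hm]
  exact Filter.Eventually.of_forall fun x => by simp [ae_iff]

/-- Agreement off the diagonal suffices, so the values of the derivatives of $|y|$ at the origin,
where it is not differentiable, play no role. -/
theorem spaceTime_of_kern (h : Integrable (kern w f g) (stMeasure d t)) (ht : 0 ≤ t)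
    {Φ : ℝ → Y → Y → ℝ} (hΦ : ∀ s ∈ Icc 0 t, ∀ η y, y ≠ η →
      Φ s η y = (∫ z, f s (η, z)) * w (y - η) * ∫ z, g s (y, z)) :
    SpaceTimeIntegrable t Φ ∧ spaceTimeIntegral t Φ = ∫ q, kern w f g q ∂(stMeasure d t) := by
  constructor
  · refine (integrable_zInt_kern h).congr ?_
    have h1 : ∀ᵐ q : ℝ × (Y × Y) ∂((volume.restrict (Icc 0 t)).prod volume), q.2.2 ≠ q.2.1 :=
      Measure.quasiMeasurePreserving_snd.ae ae_snd_ne_fst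
    have h2 : ∀ᵐ q : ℝ × (Y × Y) ∂((volume.restrict (Icc 0 t)).prod volume), q.1 ∈ Icc 0 t :=
      Measure.quasiMeasurePreserving_fst.ae (ae_restrict_mem measurableSet_Icc)
    filter_upwards [h1, h2] with q hq hq'
    exact (hΦ _ hq' _ _ hq).symm
  · rw [stMeasure] at h
    rw [spaceTimeIntegral, intervalIntegral.integral_of_le ht, ← integral_Icc_eq_integral_Ioc,
      stMeasure, integral_prod _ h]
    refine integral_congr_ae ?_
    filter_upwards [h.prod_right_ae, ae_restrict_mem measurableSet_Icc] with s hs hst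
    refine Eq.trans ?_ (integral_zInt (f := f s) (g := g s) (w := w) hs)
    refine integral_congr_ae ?_
    filter_upwards [ae_snd_ne_fst] with p hp
    exact hΦ s hst _ _ hp

end

/-! ### Quadratic densities and the Hardy inequality. -/

noncomputable section

variable {d : ℕ} {T t : ℝ} {n : ℕ}

/-- The real part of `p q̄`. -/
def reP (p q : ℝ → X d → ℂ) (s : ℝ) (x : X d) : ℝ := (p s x * conj (q s x)).re

/-- The imaginary part of `p q̄`. -/
def imP (p q : ℝ → X d → ℂ) (s : ℝ) (x : X d) : ℝ := (p s x * conj (q s x)).im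

/-- The density `|u|² / 2`. -/
def massDensity (u : ℝ → X d → ℂ) (s : ℝ) (x : X d) : ℝ := ‖u s x‖ ^ 2 / 2

instance : ENNReal.HolderTriple ∞ 2 2 := ⟨by simp⟩

instance : ENNReal.HolderTriple 2 ∞ 2 := ⟨by simp⟩

variable {p q u v : ℝ → X d → ℂ}

theorem Reg.conj (hp : Reg 2 T n p) : Reg 2 T n (fun s x => conj (p s x)) :=
  hp.clm Complex.conjCLE.toContinuousLinearMap

theorem Reg.mul_conj (hp : Reg 2 T n p) (hq : Reg 2 T n q) :
    Reg 1 T n (fun s x => p s x * conj (q s x)) := Reg.mul le_rfl hp hq.conj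

theorem Reg.reP (hp : Reg 2 T n p) (hq : Reg 2 T n q) : Reg 1 T n (reP p q) :=
  (hp.mul_conj hq).clm Complex.reCLM

theorem Reg.imP (hp : Reg 2 T n p) (hq : Reg 2 T n q) : Reg 1 T n (imP p q) :=
  (hp.mul_conj hq).clm Complex.imCLM

theorem massDensity_eq : massDensity u = fun s x => 2⁻¹ * reP u u s x := by
  funext s x
  rw [massDensity, reP, Complex.mul_conj, Complex.normSq_eq_norm_sq, Complex.ofReal_re]
  ring

theorem Reg.massDensity (hu : Reg 2 T n u) : Reg 1 T n (massDensity u) := by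
  rw [massDensity_eq]
  exact (hu.reP hu).const_mul _

theorem pd_mul_conj {p q : X d → ℂ} {x : X d} (hp : DifferentiableAt ℝ p x)
    (hq : DifferentiableAt ℝ q x) (α : Idx d) :
    pd α (fun x => p x * conj (q x)) x = pd α p x * conj (q x) + p x * conj (pd α q x) := by
  have hq' : DifferentiableAt ℝ (fun x => conj (q x)) x :=
    Complex.conjCLE.toContinuousLinearMap.differentiableAt.comp x hq
  rw [pd_mul hp hq']
  congr 2
  exact pd_clm Complex.conjCLE.toContinuousLinearMap hq α

theorem pd_reP {s : ℝ} {x : X d} (hp : DifferentiableAt ℝ (p s) x)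
    (hq : DifferentiableAt ℝ (q s) x) (α : Idx d) :
    pd α (reP p q s) x = (pd α (p s) x * conj (q s x)).re + (p s x * conj (pd α (q s) x)).re := by
  have hq' : DifferentiableAt ℝ (fun x => conj (q s x)) x :=
    Complex.conjCLE.toContinuousLinearMap.differentiableAt.comp x hq
  have := pd_clm Complex.reCLM (hp.mul hq') α
  refine this.trans ?_
  rw [show (p s * fun x => conj (q s x)) = fun x => p s x * conj (q s x) from rfl,
    pd_mul_conj hp hq]
  simp only [Complex.reCLM_apply, Complex.add_re]

theorem pd_imP {s : ℝ} {x : X d} (hp : DifferentiableAt ℝ (p s) x)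
    (hq : DifferentiableAt ℝ (q s) x) (α : Idx d) :
    pd α (imP p q s) x = (pd α (p s) x * conj (q s x)).im + (p s x * conj (pd α (q s) x)).im := by
  have hq' : DifferentiableAt ℝ (fun x => conj (q s x)) x :=
    Complex.conjCLE.toContinuousLinearMap.differentiableAt.comp x hq
  have := pd_clm Complex.imCLM (hp.mul hq') α
  refine this.trans ?_
  rw [show (p s * fun x => conj (q s x)) = fun x => p s x * conj (q s x) from rfl,
    pd_mul_conj hp hq]
  simp only [Complex.imCLM_apply, Complex.add_im]

theorem pd_massDensity {s : ℝ} {x : X d} (hu : DifferentiableAt ℝ (u s) x) (α : Idx d) :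
    pd α (massDensity u s) x = (pd α (u s) x * conj (u s x)).re := by
  have hd : DifferentiableAt ℝ (reP u u s) x := by
    have hq' : DifferentiableAt ℝ (fun x => conj (u s x)) x :=
      Complex.conjCLE.toContinuousLinearMap.differentiableAt.comp x hu
    exact Complex.reCLM.differentiableAt.comp x (hu.mul hq')
  rw [massDensity_eq]
  have := pd_clm ((2⁻¹ : ℝ) • ContinuousLinearMap.id ℝ ℝ) hd α
  refine this.trans ?_
  rw [pd_reP hu hu]
  simp
  ring

theorem lintegral_sq_eq {F : Type*} [NormedAddCommGroup F] (f : X d → F) :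
    ∫⁻ x, ‖f x‖ₑ ^ 2 = eLpNorm f 2 volume ^ 2 := by
  have := eLpNorm_nnreal_pow_eq_lintegral (μ := (volume : Measure (X d))) (f := f)
    (p := 2) (by norm_num)
  simpa using this.symm

theorem integrable_norm_sq {f : X d → ℂ} (hf : MemLp f 2 volume) :
    Integrable (fun x => ‖f x‖ ^ 2) := (memLp_two_iff_integrable_sq_norm hf.1).1 hf

theorem lintegral_sq_eq_ofReal {f : X d → ℂ} (hf : MemLp f 2 volume) :
    ∫⁻ x, ‖f x‖ₑ ^ 2 = ENNReal.ofReal (∫ x, ‖f x‖ ^ 2) := by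
  rw [ofReal_integral_eq_lintegral_ofReal (integrable_norm_sq hf)
    (Filter.Eventually.of_forall fun x => by positivity)]
  congr 1; funext x
  rw [ENNReal.ofReal_pow (norm_nonneg _), ofReal_norm]

/-- The vector field of the Hardy inequality. -/
def hardyField (ε : ℝ) (k : Fin 3) (y : Y) : ℝ := y k * r ε y ^ 2

/-- The derivatives of `hardyField`. -/
def hardyField' (ε : ℝ) (k : Fin 3) (y : Y) : ℝ :=
  r ε y ^ 2 + y k * (2 * r ε y * -(y k * r ε y ^ 3))

theorem hasPD_hardyField {ε : ℝ} (hε : 0 < ε) (k : Fin 3) (y : Y) :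
    HasPD k (hardyField ε k) (hardyField' ε k y) y := by
  refine ((hasPD_coord k k y).mul ((hasPD_r (by positivity) k).pow 2)).congr_val ?_
  rw [hardyField']; simp

theorem abs_hardyField_le (ε : ℝ) (k : Fin 3) (y : Y) : |hardyField ε k y| ≤ r ε y := by
  rw [show hardyField ε k y = w1 ε k y * r ε y by rw [hardyField, w1]; ring, abs_mul,
    abs_of_nonneg r_nonneg]
  exact mul_le_of_le_one_left r_nonneg (abs_w1_le k)

theorem abs_hardyField'_le (ε : ℝ) (k : Fin 3) (y : Y) :
    |hardyField' ε k y| ≤ 3 * r ε y ^ 2 := by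
  have h0 := r_nonneg (ε := ε) (y := y)
  have h1 : w1 ε k y ^ 2 ≤ 1 := (sq_le_one_iff_abs_le_one _).2 (abs_w1_le k)
  rw [show hardyField' ε k y = (1 - 2 * w1 ε k y ^ 2) * r ε y ^ 2 by rw [hardyField', w1]; ring,
    abs_mul, abs_of_nonneg (by positivity : 0 ≤ r ε y ^ 2)]
  gcongr
  rw [abs_le]; constructor <;> nlinarith [sq_nonneg (w1 ε k y)]

/-- The divergence of $y\,r^2$ in dimension three is $3r^2-2|y|^2r^4$, and $|y|^2r^2\le1$. -/
theorem r_sq_le_sum_hardyField' {ε : ℝ} {y : Y} : r ε y ^ 2 ≤ ∑ k, hardyField' ε k y := by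
  have h1 := norm_mul_r_le (ε := ε) (y := y)
  have h0 : 0 ≤ ‖y‖ * r ε y := mul_nonneg (norm_nonneg _) r_nonneg
  have h2 : (‖y‖ * r ε y) ^ 2 ≤ 1 := by nlinarith
  rw [mul_pow, normSq_eq] at h2
  simp only [hardyField', Fin.sum_univ_three]
  nlinarith [sq_nonneg (r ε y)]

/-- The Hardy inequality in the variable `y`, with the regularized weight. -/
theorem hardy_regularized {ε : ℝ} (hε : 0 < ε) {u : X d → ℂ} (hd : Differentiable ℝ u)
    (hu : MemLp u 2 volume) (hu' : ∀ k : Fin 3, MemLp (pd (Sum.inl k) u) 2 volume) (y : Y) :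
    ∫ x, ‖u x‖ ^ 2 * r ε (x.1 - y) ^ 2 ≤ 12 * ∑ k : Fin 3, ∫ x, ‖pd (Sum.inl k) u x‖ ^ 2 := by
  have hrb : ∀ z, |r ε z ^ 2| ≤ ε⁻¹ ^ 2 := fun z => by
    rw [abs_of_nonneg (by have := r_nonneg (ε := ε) (y := z); positivity)]
    exact pow_le_pow_left₀ r_nonneg (r_le_inv hε) 2
  have hfi : Integrable (fun x => ‖u x‖ ^ 2) := integrable_norm_sq hu
  have hpi : ∀ k : Fin 3, Integrable (fun x => ‖pd (Sum.inl k) u x‖ ^ 2) :=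
    fun k => integrable_norm_sq (hu' k)
  have hpdf : ∀ k x, pd (Sum.inl k) (fun x => ‖u x‖ ^ 2) x =
      2 * (pd (Sum.inl k) u x * conj (u x)).re := fun k x => by
    have h1 := pd_massDensity (u := fun _ => u) (s := 0) (hd x) (Sum.inl k)
    have hdm : DifferentiableAt ℝ (massDensity (fun _ => u) 0) x := by
      have := ((hd x).norm_sq ℝ).mul_const (2⁻¹ : ℝ)
      exact this
    have h2 := pd_clm ((2 : ℝ) • ContinuousLinearMap.id ℝ ℝ) hdm (Sum.inl k)
    rw [h1] at h2
    refine Eq.trans ?_ h2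
    congr 1
    funext x
    simp [massDensity]; ring
  have hpdb : ∀ k x, |pd (Sum.inl k) (fun x => ‖u x‖ ^ 2) x| ≤
      2 * (‖u x‖ * ‖pd (Sum.inl k) u x‖) := fun k x => by
    rw [hpdf, abs_mul, abs_two]
    gcongr
    refine (Complex.abs_re_le_norm _).trans (le_of_eq ?_)
    rw [norm_mul, RCLike.norm_conj, mul_comm]
  have hdsq : Differentiable ℝ (fun x => ‖u x‖ ^ 2) := hd.norm_sq ℝ
  have hmeas : ∀ k : Fin 3, AEStronglyMeasurable (pd (Sum.inl k) (fun x => ‖u x‖ ^ 2)) volume :=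
    fun k => by
      rw [funext (hpdf k)]
      have h1 := (hu' k).1
      have h2 := hu.1
      exact (Complex.continuous_re.comp_aestronglyMeasurable
        (h1.mul (Complex.continuous_conj.comp_aestronglyMeasurable h2))).const_mul 2
  have hpdi : ∀ k : Fin 3, Integrable (pd (Sum.inl k) (fun x => ‖u x‖ ^ 2)) := fun k => by
    refine Integrable.mono' (hfi.add (hpi k)) (hmeas k) (Filter.Eventually.of_forall fun x => ?_)
    refine (hpdb k x).trans ?_
    simp only [Pi.add_apply]
    nlinarith [sq_nonneg (‖u x‖ - ‖pd (Sum.inl k) u x‖)]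
  have hVm : ∀ k, Measurable (hardyField ε k) := fun k => by unfold hardyField; fun_prop
  have hVm' : ∀ k, Measurable (hardyField' ε k) := fun k => by unfold hardyField'; fun_prop
  have hVb : ∀ k z, |hardyField ε k z| ≤ ε⁻¹ := fun k z =>
    (abs_hardyField_le ε k z).trans (r_le_inv hε)
  have hVb' : ∀ k z, |hardyField' ε k z| ≤ 3 * ε⁻¹ ^ 2 := fun k z =>
    (abs_hardyField'_le ε k z).trans (by
      have := hrb z
      rw [abs_of_nonneg (by have := r_nonneg (ε := ε) (y := z); positivity)] at this
      linarith)
  have hri : Integrable (fun x : X d => ‖u x‖ ^ 2 * r ε (x.1 - y) ^ 2) := by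
    have := hfi.bdd_mul (f := fun x : X d => r ε (x.1 - y) ^ 2) (c := ε⁻¹ ^ 2)
      (by fun_prop) (Filter.Eventually.of_forall fun x => hrb _)
    exact this.congr (Filter.Eventually.of_forall fun x => mul_comm _ _)
  have hV'i : ∀ k, Integrable (fun x : X d => hardyField' ε k (x.1 - y) * ‖u x‖ ^ 2) := fun k =>
    hfi.bdd_mul ((hVm' k).comp (by fun_prop)).aestronglyMeasurable
      (Filter.Eventually.of_forall fun x => hVb' k _)
  have hVi : ∀ k : Fin 3, Integrable (fun x : X d =>
      hardyField ε k (x.1 - y) * pd (Sum.inl k) (fun x => ‖u x‖ ^ 2) x) := fun k =>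
    (hpdi k).bdd_mul ((hVm k).comp (by fun_prop)).aestronglyMeasurable
      (Filter.Eventually.of_forall fun x => hVb k _)
  have step1 : ∫ x, ‖u x‖ ^ 2 * r ε (x.1 - y) ^ 2 ≤
      ∑ k, ∫ x : X d, hardyField' ε k (x.1 - y) * ‖u x‖ ^ 2 := by
    rw [← integral_finsetSum _ fun k _ => hV'i k]
    refine integral_mono hri (integrable_finsetSum _ fun k _ => hV'i k) fun x => ?_
    simp only [← Finset.sum_mul]
    rw [mul_comm]
    exact mul_le_mul_of_nonneg_right r_sq_le_sum_hardyField' (by positivity)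
  -- By parts, the left side is $-\int V_k\,\partial_k|u|^2$, with $|V_k|\le r$ and
  -- $|\partial_k|u|^2|\le2|u||\partial_ku|$. Then
  -- $2\,(r|u|)\,|\partial_ku|\le\frac16r^2|u|^2+6|\partial_ku|^2$.
  have step2 : ∀ k : Fin 3, ∫ x : X d, hardyField' ε k (x.1 - y) * ‖u x‖ ^ 2 ≤
      6⁻¹ * (∫ x, ‖u x‖ ^ 2 * r ε (x.1 - y) ^ 2) + 6 * ∫ x, ‖pd (Sum.inl k) u x‖ ^ 2 := fun k => by
    have h := integral_mul_pd (W := fun x : X d => hardyField ε k (x.1 - y))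
      (W' := fun x : X d => hardyField' ε k (x.1 - y)) (α := Sum.inl k)
      ((hVm k).comp (by fun_prop)) ((hVm' k).comp (by fun_prop)) (fun _ => hVb k _)
      (fun _ => hVb' k _)
      (fun x => hasLineDerivAt_weight_right (hasPD_hardyField hε k _)) hdsq hfi (hpdi k)
    rw [eq_neg_iff_add_eq_zero, add_comm, ← eq_neg_iff_add_eq_zero] at h
    rw [h, ← integral_neg, ← integral_const_mul, ← integral_const_mul,
      ← integral_add (hri.const_mul _) ((hpi k).const_mul _)]
    refine integral_mono (hVi k).neg ((hri.const_mul _).add ((hpi k).const_mul _)) fun x => ?_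
    have h1 := hpdb k x
    have h2 := abs_hardyField_le ε k (x.1 - y)
    have h3 := mul_le_mul h2 h1 (abs_nonneg _) r_nonneg
    rw [← abs_mul] at h3
    have h4 := neg_abs_le (hardyField ε k (x.1 - y) * pd (Sum.inl k) (fun x => ‖u x‖ ^ 2) x)
    simp only
    nlinarith [sq_nonneg (‖u x‖ * r ε (x.1 - y) - 6 * ‖pd (Sum.inl k) u x‖)]
  -- Summing over three directions puts one half of the left side on the right. It can be absorbed
  -- because it is finite for $\varepsilon>0$; this leaves the constant $12$.
  have step3 := step1.trans (Finset.sum_le_sum fun k _ => step2 k)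
  rw [Finset.sum_add_distrib, ← Finset.mul_sum, ← Finset.mul_sum] at step3
  simp only [Finset.sum_const, Finset.card_univ, Fintype.card_fin, nsmul_eq_mul] at step3
  push_cast at step3
  linarith

open Filter Topology in
/-- The Hardy inequality in the variable `y`. -/
theorem hardy {u : X d → ℂ} (hd : Differentiable ℝ u)
    (hu : MemLp u 2 volume) (hu' : ∀ k : Fin 3, MemLp (pd (Sum.inl k) u) 2 volume) (y : Y) :
    ∫⁻ x, ‖u x‖ₑ ^ 2 * ‖r 0 (y - x.1)‖ₑ ^ 2 ≤
      12 * ∑ k : Fin 3, ∫⁻ x, ‖pd (Sum.inl k) u x‖ₑ ^ 2 := by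
  have hum : Measurable u := hd.continuous.measurable
  have hreg : ∀ n : ℕ, ∫⁻ x, ‖u x‖ₑ ^ 2 * ‖r (1 / ((n : ℝ) + 1)) (y - x.1)‖ₑ ^ 2 ≤
      12 * ∑ k : Fin 3, ∫⁻ x, ‖pd (Sum.inl k) u x‖ₑ ^ 2 := fun n => by
    have hε : (0 : ℝ) < 1 / ((n : ℝ) + 1) := by positivity
    have h := hardy_regularized hε hd hu hu' y
    set ε := 1 / ((n : ℝ) + 1)
    have hri : Integrable (fun x : X d => ‖u x‖ ^ 2 * r ε (x.1 - y) ^ 2) := by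
      have := (integrable_norm_sq hu).bdd_mul (f := fun x : X d => r ε (x.1 - y) ^ 2) (c := ε⁻¹ ^ 2)
        (by fun_prop) (Filter.Eventually.of_forall fun x => by
          rw [norm_pow, Real.norm_eq_abs, abs_of_nonneg r_nonneg]
          exact pow_le_pow_left₀ r_nonneg (r_le_inv hε) 2)
      exact this.congr (Filter.Eventually.of_forall fun x => mul_comm _ _)
    have h1 : ∫⁻ x, ‖u x‖ₑ ^ 2 * ‖r ε (y - x.1)‖ₑ ^ 2 =
        ENNReal.ofReal (∫ x, ‖u x‖ ^ 2 * r ε (x.1 - y) ^ 2) := by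
      rw [ofReal_integral_eq_lintegral_ofReal hri
        (Filter.Eventually.of_forall fun x => by positivity)]
      congr 1; funext x
      rw [ENNReal.ofReal_mul (by positivity), ENNReal.ofReal_pow (norm_nonneg _), ofReal_norm,
        ENNReal.ofReal_pow r_nonneg, Real.enorm_eq_ofReal r_nonneg, r, r, norm_sub_rev]
    rw [h1]
    refine (ENNReal.ofReal_le_ofReal h).trans ?_
    rw [ENNReal.ofReal_mul (by norm_num), ENNReal.ofReal_sum_of_nonneg fun k _ =>
      integral_nonneg fun x => by positivity]
    simp only [lintegral_sq_eq_ofReal (hu' _)]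
    simp
  have hlim : Tendsto (fun n : ℕ => 1 / ((n : ℝ) + 1)) atTop (𝓝 0) :=
    tendsto_one_div_add_atTop_nhds_zero_nat
  have hpt : ∀ᵐ x : X d, Tendsto (fun n : ℕ => ‖u x‖ₑ ^ 2 * ‖r (1 / ((n : ℝ) + 1)) (y - x.1)‖ₑ ^ 2)
      atTop (𝓝 (‖u x‖ₑ ^ 2 * ‖r 0 (y - x.1)‖ₑ ^ 2)) := by
    filter_upwards [ae_fst_ne y] with x hx
    have h1 := ((tendsto_r (sub_ne_zero.2 hx.symm)).comp hlim).enorm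
    exact ENNReal.Tendsto.const_mul (ENNReal.Tendsto.pow h1) (Or.inr (by simp))
  -- Fatou's lemma along $\varepsilon=1/(n+1)$, since the regularized bound is independent of
  -- $\varepsilon$.
  calc ∫⁻ x, ‖u x‖ₑ ^ 2 * ‖r 0 (y - x.1)‖ₑ ^ 2
      = ∫⁻ x, liminf (fun n : ℕ => ‖u x‖ₑ ^ 2 * ‖r (1 / ((n : ℝ) + 1)) (y - x.1)‖ₑ ^ 2) atTop := by
        refine lintegral_congr_ae ?_
        filter_upwards [hpt] with x hx using hx.liminf_eq.symm
    _ ≤ liminf (fun n : ℕ => ∫⁻ x, ‖u x‖ₑ ^ 2 * ‖r (1 / ((n : ℝ) + 1)) (y - x.1)‖ₑ ^ 2) atTop :=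
        lintegral_liminf_le fun n => by fun_prop
    _ ≤ _ := by
        refine liminf_le_of_frequently_le' (Frequently.of_forall hreg)

theorem Reg.lintegral_sq_bound (hu : Reg 2 T n u) :
    ∃ K : ℝ≥0, ∀ s ∈ Icc 0 T, ∫⁻ x, ‖u s x‖ₑ ^ 2 ≤ K := by
  obtain ⟨K, hK⟩ := hu.bound
  refine ⟨K ^ 2, fun s hs => ?_⟩
  rw [lintegral_sq_eq]
  push_cast
  exact pow_le_pow_left' (hK s hs) 2

theorem Reg.hardy_bound (hu : Reg 2 T 1 u) :
    ∃ K : ℝ≥0, ∀ s ∈ Icc 0 T, ∀ y : Y, ∫⁻ x, ‖u s x‖ₑ ^ 2 * ‖r 0 (y - x.1)‖ₑ ^ 2 ≤ K := by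
  choose K hK using fun k : Fin 3 => (hu.pd (Sum.inl k)).lintegral_sq_bound
  refine ⟨12 * ∑ k, K k, fun s hs y => ?_⟩
  refine (hardy (hu.differentiable hs) (hu.memLp hs)
    (fun k => (hu.pd (Sum.inl k)).memLp hs) y).trans ?_
  push_cast
  gcongr with k _
  exact hK k s hs

theorem dom_massDensity (hu : Reg 2 T 1 u) : Dom T (massDensity u) (fun y => r 0 y ^ 2) := by
  obtain ⟨K, hK⟩ := hu.hardy_bound
  refine ⟨by fun_prop, hu.massDensity.continuousOn, K, fun s hs y => le_trans ?_ (hK s hs y)⟩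
  refine lintegral_mono fun x => ?_
  simp only [enorm_pow]
  gcongr
  rw [massDensity, Real.enorm_eq_ofReal (by positivity), ← ofReal_norm,
    ← ENNReal.ofReal_pow (norm_nonneg _)]
  refine ENNReal.ofReal_le_ofReal ?_
  have : 0 ≤ ‖u s x‖ ^ 2 := by positivity
  linarith

/-- The elementary bound $|u||v|\,r\le|u|^2r^2+|v|^2$ reduces the weight $1/|y|$ to Hardy for $u$
and the $L^2$ bound for $v$; no derivative of $v$ is needed. -/
theorem dom_of_abs_le (hu : Reg 2 T 1 u) (hv : Reg 2 T 0 v) {f : ℝ → X d → ℝ}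
    (hf : ContinuousOn (fun q : ℝ × X d => f q.1 q.2) (Icc 0 T ×ˢ univ))
    (h : ∀ s ∈ Icc 0 T, ∀ x, |f s x| ≤ ‖u s x‖ * ‖v s x‖) : Dom T f (r 0) := by
  obtain ⟨K, hK⟩ := hu.hardy_bound
  obtain ⟨K', hK'⟩ := hv.lintegral_sq_bound
  refine ⟨measurable_r, hf, K + K', fun s hs y => ?_⟩
  have hum : Measurable (u s) := (hu.continuous hs).measurable
  calc ∫⁻ x, ‖f s x‖ₑ * ‖r 0 (y - x.1)‖ₑ
      ≤ ∫⁻ x, (‖u s x‖ₑ ^ 2 * ‖r 0 (y - x.1)‖ₑ ^ 2 + ‖v s x‖ₑ ^ 2) := by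
        refine lintegral_mono fun x => ?_
        have hr := r_nonneg (ε := 0) (y := y - x.1)
        simp only [← ofReal_norm, Real.norm_eq_abs]
        rw [← ENNReal.ofReal_mul (abs_nonneg _), ← ENNReal.ofReal_pow (norm_nonneg _),
          ← ENNReal.ofReal_pow (norm_nonneg _), ← ENNReal.ofReal_pow (abs_nonneg _),
          ← ENNReal.ofReal_mul (by positivity), ← ENNReal.ofReal_add (by positivity)
              (by positivity)]
        refine ENNReal.ofReal_le_ofReal ?_
        rw [abs_of_nonneg hr]
        have := mul_le_mul_of_nonneg_right (h s hs x) hr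
        nlinarith [sq_nonneg (‖u s x‖ * r 0 (y - x.1) - ‖v s x‖),
          sq_nonneg (‖u s x‖ * r 0 (y - x.1)), sq_nonneg (‖v s x‖)]
    _ = (∫⁻ x, ‖u s x‖ₑ ^ 2 * ‖r 0 (y - x.1)‖ₑ ^ 2) + ∫⁻ x, ‖v s x‖ₑ ^ 2 :=
        lintegral_add_left (by fun_prop) _
    _ ≤ _ := by
        push_cast
        exact add_le_add (hK s hs y) (hK' s hs)

end

/-! ### Local conservation laws of mass and momentum. -/

noncomputable section

variable {d : ℕ} {T t : ℝ} {n : ℕ} {F : Type*} [NormedAddCommGroup F] [NormedSpace ℝ F]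

/-- The partial derivative `∂_α` of a function of `(t, x)`. -/
abbrev dx (α : Idx d) (f : ℝ → X d → F) : ℝ → X d → F := fun s => pd α (f s)

/-- The flux `∑_β g^{αβ} ∂_β u`. -/
def flux (h : Idx d → Idx d → ℝ → X d → ℝ) (u : ℝ → X d → ℂ) (α : Idx d) (s : ℝ) (x : X d) : ℂ :=
  ∑ β, (metric h α β s x : ℂ) * pd β (u s) x

/-- The divergence `∑_{α,β} ∂_α (g^{αβ} ∂_β u)`. -/
def divFlux (h : Idx d → Idx d → ℝ → X d → ℝ) (u : ℝ → X d → ℂ) (s : ℝ) (x : X d) : ℂ :=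
  ∑ α, pd α (flux h u α s) x

/-- The time derivative prescribed by the equation. -/
def vel (h : Idx d → Idx d → ℝ → X d → ℝ) (u N : ℝ → X d → ℂ) (s : ℝ) (x : X d) : ℂ :=
  Complex.I * divFlux h u s x + -Complex.I * N s x

/-- The regularity and symmetry of a solution, without the equation. -/
structure RegData (d : ℕ) (T : ℝ) (h : Idx d → Idx d → ℝ → X d → ℝ) (u N : ℝ → X d → ℂ) :
    Prop where
  hu : Reg 2 T 3 u
  hN : Reg 2 T 1 N
  hh : ∀ α β, Reg ∞ T 2 (h α β)
  symm : ∀ α β : Idx d, ∀ t ∈ Icc 0 T, ∀ x, h α β t x = h β α t x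
  smooth : ∀ t ∈ Icc 0 T, ContDiff ℝ 3 (u t)

variable {h : Idx d → Idx d → ℝ → X d → ℝ} {u N : ℝ → X d → ℂ}

theorem RegData.reg_coe (H : RegData d T h u N) (α β : Idx d) :
    Reg ∞ T 2 (fun s x => (h α β s x : ℂ)) := (H.hh α β).clm Complex.ofRealCLM

theorem RegData.reg_metric (H : RegData d T h u N) (α β : Idx d) :
    Reg ∞ T 2 (fun s x => (metric h α β s x : ℂ)) := by
  have h1 : Reg ∞ T 2 (fun s x => metric h α β s x) :=
    Reg.add (by simp) (Reg.const (if α = β then (1 : ℝ) else 0)) (H.hh α β)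
  exact h1.clm Complex.ofRealCLM

theorem RegData.reg_flux (H : RegData d T h u N) (α : Idx d) : Reg 2 T 2 (flux h u α) :=
  Reg.sum (by norm_num) _ fun β _ => Reg.mul (by norm_num) (H.reg_metric α β) (H.hu.pd β)

theorem RegData.reg_divFlux (H : RegData d T h u N) : Reg 2 T 1 (divFlux h u) :=
  Reg.sum (by norm_num) _ fun α _ => (H.reg_flux α).pd α

theorem Reg.cmul {f : ℝ → X d → ℂ} (c : ℂ) (hf : Reg 2 T n f) : Reg 2 T n (fun s x => c * f s x) :=
  hf.clm (c • ContinuousLinearMap.id ℝ ℂ)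

theorem RegData.reg_vel (H : RegData d T h u N) : Reg 2 T 1 (vel h u N) :=
  Reg.add (by norm_num) (H.reg_divFlux.cmul _) (H.hN.cmul _)

theorem RegData.reg_pd (H : RegData d T h u N) (α : Idx d) : Reg 2 T 2 (dx α u) := H.hu.pd α

theorem RegData.metric_symm (H : RegData d T h u N) {s : ℝ} (hs : s ∈ Icc 0 T) (α β : Idx d)
    (x : X d) : metric h α β s x = metric h β α s x := by
  rw [metric, metric, H.symm α β s hs x]
  simp only [eq_comm]

/-- Symmetry of second derivatives is the reason why `RegData` retains joint smoothness in space in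
addition to the class `Reg`. -/
theorem pd_comm {f : X d → ℂ} (hf : ContDiff ℝ 2 f) (α β : Idx d) (x : X d) :
    pd α (pd β f) x = pd β (pd α f) x := by
  have h1 : Differentiable ℝ (fderiv ℝ f) :=
    (hf.fderiv_right (m := 1) (by norm_num)).differentiable (by norm_num)
  have h2 : ∀ α β, pd α (pd β f) x = fderiv ℝ (fderiv ℝ f) x (basisVec d α) (basisVec d β) := by
    intro α β
    exact pd_clm (ContinuousLinearMap.apply ℝ ℂ (basisVec d β)) (h1 x) α
  have h3 : IsSymmSndFDerivAt ℝ f x :=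
    (hf.contDiffAt).isSymmSndFDerivAt (by simp)
  rw [h2, h2, h3]

theorem sum_re_mul_conj {ι : Type*} [Fintype ι] (f : ι → ℂ) (c : ℂ) :
    ∑ i, (f i * conj c).re = ((∑ i, f i) * conj c).re := by
  rw [Finset.sum_mul, Complex.re_sum]

/-- A real symmetric form makes $\sum G_{ij}A_i\bar A_j$ real. In the mass law this removes the term
in which the divergence falls on $u$ rather than on the flux. -/
theorem sum_im_metric_eq_zero {ι : Type*} [Fintype ι] (G : ι → ι → ℝ) (hG : ∀ i j, G i j = G j i)
    (A : ι → ℂ) : ∑ i, (A i * conj (∑ j, (G i j : ℂ) * A j)).im = 0 := by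
  have h1 : ∀ i, (A i * conj (∑ j, (G i j : ℂ) * A j)).im = ∑ j, G i j * (A i * conj (A j)).im := by
    intro i
    rw [map_sum, Finset.mul_sum, Complex.im_sum]
    refine Finset.sum_congr rfl fun j _ => ?_
    simp [Complex.mul_im, Complex.mul_re]; ring
  simp only [h1]
  have h2 : ∑ i, ∑ j, G i j * (A i * conj (A j)).im = -∑ i, ∑ j, G i j * (A i * conj (A j)).im := by
    conv_rhs => rw [Finset.sum_comm]
    rw [← Finset.sum_neg_distrib]
    refine Finset.sum_congr rfl fun i _ => ?_
    rw [← Finset.sum_neg_distrib]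
    refine Finset.sum_congr rfl fun j _ => ?_
    rw [hG j i]
    simp [Complex.mul_im]; ring
  linarith

/-- Symmetry lets the coefficients pass from $\nabla\partial_ku$ to $\nabla u$ in the momentum law.
-/
theorem sum_re_metric_comm {ι : Type*} [Fintype ι] (G : ι → ι → ℝ) (hG : ∀ i j, G i j = G j i)
    (A B : ι → ℂ) : ∑ i, ((∑ j, (G i j : ℂ) * A j) * conj (B i)).re =
      ∑ i, ((∑ j, (G i j : ℂ) * B j) * conj (A i)).re := by
  have h1 : ∀ A B : ι → ℂ, ∀ i, ((∑ j, (G i j : ℂ) * A j) * conj (B i)).re =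
      ∑ j, G i j * (A j * conj (B i)).re := by
    intro A B i
    rw [Finset.sum_mul, Complex.re_sum]
    refine Finset.sum_congr rfl fun j _ => ?_
    simp [Complex.mul_re]; ring
  simp only [h1]
  rw [Finset.sum_comm]
  refine Finset.sum_congr rfl fun i _ => Finset.sum_congr rfl fun j _ => ?_
  rw [hG j i]
  simp only [Complex.mul_re, Complex.conj_re, Complex.conj_im]; ring

/-- The local conservation law of the mass. -/
theorem RegData.mass_law (H : RegData d T h u N) {s : ℝ} (hs : s ∈ Icc 0 T) (x : X d) :
    reP (vel h u N) u s x = ∑ α, pd α (imP u (flux h u α) s) x + imP N u s x := by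
  have h1 : ∀ α, pd α (imP u (flux h u α) s) x =
      (pd α (u s) x * conj (flux h u α s x)).im
        + (u s x * conj (pd α (flux h u α s) x)).im := fun α =>
    pd_imP (H.hu.differentiable hs x) ((H.reg_flux α).differentiable hs x) α
  simp only [h1, Finset.sum_add_distrib]
  have h2 : ∑ α, (pd α (u s) x * conj (flux h u α s x)).im = 0 :=
    sum_im_metric_eq_zero (fun α β => metric h α β s x)
      (fun α β => H.metric_symm hs α β x) (fun α => pd α (u s) x)
  have h3 : ∑ α, (u s x * conj (pd α (flux h u α s) x)).im =
      (u s x * conj (divFlux h u s x)).im := by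
    rw [divFlux, map_sum, Finset.mul_sum, Complex.im_sum]
  rw [h2, h3, reP, imP, vel]
  simp [Complex.mul_im, Complex.mul_re]; ring

/-- The forcing term of the momentum law. -/
def momF (u N : ℝ → X d → ℂ) (k : Fin 3) (s : ℝ) (x : X d) : ℝ :=
  reP u (dx (Sum.inl k) N) s x - reP N (dx (Sum.inl k) u) s x

/-- The term of the momentum law that contains the derivatives of the coefficients. -/
def momE (h : Idx d → Idx d → ℝ → X d → ℝ) (u : ℝ → X d → ℂ) (k : Fin 3) (α β : Idx d) :
    ℝ → X d → ℝ :=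
  reP (fun s x => pd α (u s) x * ((pd (Sum.inl k) (h α β s) x : ℝ) : ℂ)) (dx β u)

/-- The identity part of the metric is constant, so only derivatives of $h$ appear when the
coefficients are differentiated. -/
theorem RegData.pd_flux (H : RegData d T h u N) {s : ℝ} (hs : s ∈ Icc 0 T) (α κ : Idx d)
    (x : X d) : pd κ (flux h u α s) x =
      ∑ β, ((pd κ (h α β s) x : ℝ) : ℂ) * pd β (u s) x
        + ∑ β, (metric h α β s x : ℂ) * pd κ (pd β (u s)) x := by
  have h0 : ∀ β, DifferentiableAt ℝ (fun x => (metric h α β s x : ℂ)) x :=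
    fun β => (H.reg_metric α β).differentiable hs x
  have h1 : ∀ β, DifferentiableAt ℝ (pd β (u s)) x := fun β => (H.reg_pd β).differentiable hs x
  have h2 : ∀ β, pd κ (fun x => (metric h α β s x : ℂ)) x = ((pd κ (h α β s) x : ℝ) : ℂ) := by
    intro β
    have hd := (H.hh α β).differentiable hs x
    have h3 : pd κ (fun x => metric h α β s x) x = pd κ (h α β s) x := by
      simp only [metric]
      rw [pd_add (differentiableAt_const _) hd, pd_const, zero_add]
    have h4 : DifferentiableAt ℝ (fun x => metric h α β s x) x :=
      (differentiableAt_const _).add hd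
    exact (pd_clm Complex.ofRealCLM h4 κ).trans (by rw [h3]; rfl)
  have : flux h u α s = fun x => ∑ β, (metric h α β s x : ℂ) * pd β (u s) x := rfl
  rw [this, pd_sum (f := fun β x => (metric h α β s x : ℂ) * pd β (u s) x) _
    (fun β _ => (h0 β).mul (h1 β)), ← Finset.sum_add_distrib]
  refine Finset.sum_congr rfl fun β _ => ?_
  rw [pd_mul (h0 β) (h1 β), h2]

/-- The local conservation law of the momentum. -/
theorem RegData.momentum_law (H : RegData d T h u N) {s : ℝ} (hs : s ∈ Icc 0 T) (k : Fin 3)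
    (x : X d) :
    imP (vel h u N) (dx (Sum.inl k) u) s x + imP u (dx (Sum.inl k) (vel h u N)) s x =
      momF u N k s x + 2 * ∑ α, pd α (reP (flux h u α) (dx (Sum.inl k) u) s) x
        + ∑ α, ∑ β, momE h u k α β s x
        - ∑ α, pd (Sum.inl k) (pd α (reP (flux h u α) u s)) x := by
  set κ : Idx d := Sum.inl k
  have du := H.hu.differentiable hs
  have ddu : ∀ α, Differentiable ℝ (pd α (u s)) := fun α => (H.reg_pd α).differentiable hs
  have dq : ∀ α, Differentiable ℝ (flux h u α s) := fun α => (H.reg_flux α).differentiable hs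
  have ddq : ∀ α β, Differentiable ℝ (pd β (flux h u α s)) :=
    fun α β => ((H.reg_flux α).pd β).differentiable hs
  have h1 : ∀ α, pd α (reP (flux h u α) (dx κ u) s) x =
      (pd α (flux h u α s) x * conj (pd κ (u s) x)).re
        + (flux h u α s x * conj (pd κ (pd α (u s)) x)).re := fun α => by
    rw [pd_reP (dq α x) (ddu κ x), pd_comm ((H.smooth s hs).of_le (by norm_num)) α κ]
  have h2 : ∀ α, pd κ (pd α (reP (flux h u α) u s)) x =
      (pd κ (pd α (flux h u α s)) x * conj (u s x)).re
        + (pd α (flux h u α s) x * conj (pd κ (u s) x)).re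
        + ((pd κ (flux h u α s) x * conj (pd α (u s) x)).re
        + (flux h u α s x * conj (pd κ (pd α (u s)) x)).re) := fun α => by
    have e : pd α (reP (flux h u α) u s) = fun x =>
        reP (dx α (flux h u α)) u s x + reP (flux h u α) (dx α u) s x := by
      funext x
      exact pd_reP (dq α x) (du x) α
    have r1 := (((H.reg_flux α).pd α).reP (H.hu.of_le (by norm_num : 1 ≤ 3))).differentiable hs x
    have r2 := ((H.reg_flux α).reP (H.reg_pd α)).differentiable hs x
    rw [e, pd_add r1 r2, pd_reP (ddq α α x) (du x), pd_reP (dq α x) (ddu α x)]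
  have h3 : pd κ (vel h u N s) x = Complex.I * ∑ α, pd κ (pd α (flux h u α s)) x
      + -Complex.I * pd κ (N s) x := by
    have e : vel h u N s = fun x => (Complex.I • ContinuousLinearMap.id ℝ ℂ) (divFlux h u s x)
      + ((-Complex.I) • ContinuousLinearMap.id ℝ ℂ) (N s x) := rfl
    have r1 := H.reg_divFlux.differentiable hs x
    have r2 := H.hN.differentiable hs x
    rw [e, pd_add (f := fun x => (Complex.I • ContinuousLinearMap.id ℝ ℂ) (divFlux h u s x))
      (g := fun x => ((-Complex.I) • ContinuousLinearMap.id ℝ ℂ) (N s x))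
      ((Complex.I • ContinuousLinearMap.id ℝ ℂ).differentiableAt.comp x r1)
      (((-Complex.I) • ContinuousLinearMap.id ℝ ℂ).differentiableAt.comp x r2), pd_clm _ r1,
      pd_clm _ r2]
    have : divFlux h u s = fun x => ∑ α, pd α (flux h u α s) x := rfl
    rw [this, pd_sum _ fun α _ => ddq α α x]
    rfl
  -- Differentiating the flux either hits the coefficients, which gives `momE`, or hits $\nabla u$;
  -- in the latter case symmetry of the metric turns the result into
  -- $\mathrm{Re}(\text{flux}_\alpha\,\partial_k\partial_\alpha\bar u)$, which also comes from the
  -- two divergence terms.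
  have h4 : ∑ α, (pd κ (flux h u α s) x * conj (pd α (u s) x)).re =
      ∑ α, ∑ β, momE h u k α β s x
        + ∑ α, (flux h u α s x * conj (pd κ (pd α (u s)) x)).re := by
    have := sum_re_metric_comm (fun α β => metric h α β s x)
      (fun α β => H.metric_symm hs α β x) (fun α => pd κ (pd α (u s)) x) (fun α => pd α (u s) x)
    simp only [flux, H.pd_flux hs _ κ x, add_mul, Complex.add_re, Finset.sum_add_distrib]
    rw [this]
    congr 1
    refine Finset.sum_congr rfl fun α _ => ?_
    rw [Finset.sum_mul, Complex.re_sum]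
    refine Finset.sum_congr rfl fun β _ => ?_
    simp [momE, reP, Complex.mul_re, κ]; ring
  have h5 : divFlux h u s x = ∑ α, pd α (flux h u α s) x := rfl
  simp only [h1, h2, Finset.sum_add_distrib, sum_re_mul_conj, h4, imP, h3, momF, reP, vel, h5]
  simp only [map_add, map_mul, map_neg, Complex.conj_I, Complex.add_re, Complex.add_im,
    Complex.mul_re, Complex.mul_im, Complex.neg_re, Complex.neg_im, Complex.I_re, Complex.I_im,
    Complex.conj_re, Complex.conj_im]
  ring

end

/-! ### The rate of change of the regularized potential. -/

noncomputable section

variable {d : ℕ} {T t : ℝ} {n : ℕ}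

section Bounded

variable {ε : ℝ}

theorem bddW_of_le {w : Y → ℝ} (hm : Measurable w) (hε : 0 < ε) (C : ℝ) (m : ℕ) (hC : 0 ≤ C)
    (h : ∀ y, |w y| ≤ C * r ε y ^ m) : BddW w := by
  refine ⟨hm, C * ε⁻¹ ^ m, fun y => (h y).trans ?_⟩
  gcongr
  · exact r_nonneg
  · exact r_le_inv hε

theorem bddW_w1 (k : Fin 3) : BddW (w1 ε k) := ⟨by fun_prop, 1, fun _ => abs_w1_le k⟩

theorem bddW_w2 (hε : 0 < ε) (j k : Fin 3) : BddW (w2 ε j k) :=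
  bddW_of_le (by fun_prop) hε 2 1 (by norm_num) fun _ => by simpa using abs_w2_le j k

theorem bddW_wLap (hε : 0 < ε) : BddW (wLap ε) :=
  bddW_of_le (by fun_prop) hε 3 1 (by norm_num) fun _ => by simpa using abs_wLap_le

theorem bddW_w3 (hε : 0 < ε) (k : Fin 3) : BddW (w3 ε k) :=
  bddW_of_le (by fun_prop) hε 5 2 (by norm_num) fun _ => abs_w3_le k

theorem bddW_w3' (hε : 0 < ε) (j k : Fin 3) : BddW (w3' ε j k) :=
  bddW_of_le (by fun_prop) hε 26 3 (by norm_num) fun _ => abs_w3'_le j k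

theorem bddW_w4 (hε : 0 < ε) : BddW (w4 ε) := by
  refine bddW_of_le (by fun_prop) hε (15 * ε ^ 4) 7 (by positivity) fun y => ?_
  have h0 := r_nonneg (ε := ε) (y := y)
  rw [w4, show -15 * ε ^ 4 * r ε y ^ 7 = -(15 * ε ^ 4 * r ε y ^ 7) by ring, abs_neg,
    abs_of_nonneg (by positivity)]

end Bounded

section Divergence

variable {w : Y → ℝ} {w' : Fin 3 → Y → ℝ} {s : ℝ} {J : Idx d → ℝ → X d → ℝ} {f g : X d → ℝ}

/-- Integration by parts against a divergence, in the first particle. -/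
theorem pairing_div_left (hw : BddW w) (hw' : ∀ j, BddW (w' j))
    (hd : ∀ j y, HasPD j w (w' j y) y) (hs : s ∈ Icc 0 T) (hJ : ∀ α, Reg 1 T 1 (J α))
    (hg : Integrable g) :
    pairing w (fun x => ∑ α, pd α (J α s) x) g = ∑ j, pairing (w' j) (J (Sum.inl j) s) g := by
  rw [pairing_sum_left _ hw (fun α _ => ((hJ α).pd α).integrable hs) hg, Fintype.sum_sum_type]
  have h1 : ∀ j, pairing w (pd (Sum.inr j) (J (Sum.inr j) s)) g = 0 := fun j =>
    pairing_pd_inr_left hw ((hJ _).differentiable hs) ((hJ _).integrable hs)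
      (((hJ _).pd _).integrable hs) hg
  have h2 : ∀ j, pairing w (pd (Sum.inl j) (J (Sum.inl j) s)) g =
      pairing (w' j) (J (Sum.inl j) s) g := fun j =>
    pairing_pd_left hw (hw' j) (hd j) ((hJ _).differentiable hs) ((hJ _).integrable hs)
      (((hJ _).pd _).integrable hs) hg
  simp [h1, h2]

/-- Integration by parts against a divergence, in the second particle. -/
theorem pairing_div_right (hw : BddW w) (hw' : ∀ j, BddW (w' j))
    (hd : ∀ j y, HasPD j w (w' j y) y) (hs : s ∈ Icc 0 T) (hJ : ∀ α, Reg 1 T 1 (J α))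
    (hf : Integrable f) :
    pairing w f (fun x => ∑ α, pd α (J α s) x) = -∑ j, pairing (w' j) f (J (Sum.inl j) s) := by
  rw [pairing_sum_right _ hw hf (fun α _ => ((hJ α).pd α).integrable hs), Fintype.sum_sum_type]
  have h1 : ∀ j, pairing w f (pd (Sum.inr j) (J (Sum.inr j) s)) = 0 := fun j =>
    pairing_pd_inr_right hw ((hJ _).differentiable hs) ((hJ _).integrable hs)
      (((hJ _).pd _).integrable hs) hf
  have h2 : ∀ j, pairing w f (pd (Sum.inl j) (J (Sum.inl j) s)) =
      -pairing (w' j) f (J (Sum.inl j) s) := fun j =>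
    pairing_pd_right hw (hw' j) (hd j) ((hJ _).differentiable hs) ((hJ _).integrable hs)
      (((hJ _).pd _).integrable hs) hf
  simp [h1, h2]

theorem pairing_swap (hw : ∀ y, w (-y) = w y) : pairing w f g = pairing w g f := by
  rw [pairing, pairing, Measure.volume_eq_prod,
    ← integral_prod_swap (fun q : X d × X d => f q.1 * w (q.2.1 - q.1.1) * g q.2)]
  congr 1; funext q
  simp only [Prod.fst_swap, Prod.snd_swap]
  rw [← hw, neg_sub]; ring

end Divergence

theorem r_neg (ε : ℝ) (y : Y) : r ε (-y) = r ε y := by simp [r]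

theorem w2_neg (ε : ℝ) (j k : Fin 3) (y : Y) : w2 ε j k (-y) = w2 ε j k y := by
  simp [w2, r_neg]

variable {h : Idx d → Idx d → ℝ → X d → ℝ} {u N : ℝ → X d → ℂ} {ε s : ℝ}

/-- Separates the flat part from the part in $h$. Applied to the three fluxes that meet a
$y$-derivative of the weight, it produces the main terms and the first three kinds of error. -/
theorem flux_eq (j : Fin 3) (x : X d) : flux h u (Sum.inl j) s x =
    pd (Sum.inl j) (u s) x + ∑ β, (h (Sum.inl j) β s x : ℂ) * pd β (u s) x := by
  simp only [flux, metric, Complex.ofReal_add, add_mul, Finset.sum_add_distrib]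
  congr 1
  rw [Finset.sum_eq_single (Sum.inl j)]
  · simp
  · intro β _ hβ
    simp [hβ.symm]
  · simp

/-- The momentum density `Im (u ∂_{y_k} ū)`. -/
abbrev momDensity (u : ℝ → X d → ℂ) (k : Fin 3) : ℝ → X d → ℝ := imP u (dx (Sum.inl k) u)

/-- The density `Im (h^{αβ} u ∂_β ū)`. -/
abbrev errDensity₁ (u : ℝ → X d → ℂ) (h : Idx d → Idx d → ℝ → X d → ℝ) (j : Fin 3) (β : Idx d) :
    ℝ → X d → ℝ := imP (fun s x => (h (Sum.inl j) β s x : ℂ) * u s x) (dx β u)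

/-- The density `Re (u h^{αβ} ∂_β ū)`. -/
abbrev errDensity₂ (u : ℝ → X d → ℂ) (h : Idx d → Idx d → ℝ → X d → ℝ) (j : Fin 3) (β : Idx d) :
    ℝ → X d → ℝ := reP (fun s x => u s x * (h (Sum.inl j) β s x : ℂ)) (dx β u)

/-- The density `Re (∂_{y_k} u h^{αβ} ∂_β ū)`. -/
abbrev errDensity₃ (u : ℝ → X d → ℂ) (h : Idx d → Idx d → ℝ → X d → ℝ) (k j : Fin 3) (β : Idx d) :
    ℝ → X d → ℝ :=
  reP (fun s x => pd (Sum.inl k) (u s) x * (h (Sum.inl j) β s x : ℂ)) (dx β u)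

theorem imP_flux (j : Fin 3) (x : X d) : imP u (flux h u (Sum.inl j)) s x =
    momDensity u j s x + ∑ β, errDensity₁ u h j β s x := by
  rw [imP, flux_eq, map_add, mul_add, Complex.add_im, map_sum, Finset.mul_sum, Complex.im_sum]
  congr 1
  refine Finset.sum_congr rfl fun β _ => ?_
  change _ = ((h (Sum.inl j) β s x : ℂ) * u s x * conj (pd β (u s) x)).im
  rw [map_mul, Complex.conj_ofReal]
  congr 1; ring

theorem reP_flux_pd (j k : Fin 3) (x : X d) :
    reP (flux h u (Sum.inl j)) (dx (Sum.inl k) u) s x =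
      reP (dx (Sum.inl j) u) (dx (Sum.inl k) u) s x + ∑ β, errDensity₃ u h k j β s x := by
  rw [reP, flux_eq, add_mul, Complex.add_re, Finset.sum_mul, Complex.re_sum]
  congr 1
  refine Finset.sum_congr rfl fun β _ => ?_
  simp [reP, Complex.mul_re]; ring

namespace RegData

theorem reg_two (H : RegData d T h u N) : Reg 2 T 2 u := H.hu.pred

theorem reg_momDensity (H : RegData d T h u N) (k : Fin 3) : Reg 1 T 2 (momDensity u k) :=
    H.reg_two.imP (H.reg_pd _)

theorem reg_err₁ (H : RegData d T h u N) (j : Fin 3) (β : Idx d) :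
    Reg 1 T 2 (errDensity₁ u h j β) :=
  Reg.imP (Reg.mul (by norm_num) (H.reg_coe _ _) H.reg_two) (H.reg_pd β)

theorem reg_err₂ (H : RegData d T h u N) (j : Fin 3) (β : Idx d) :
    Reg 1 T 2 (errDensity₂ u h j β) :=
  Reg.reP (Reg.mul (by norm_num) H.reg_two (H.reg_coe _ _)) (H.reg_pd β)

theorem reg_err₃ (H : RegData d T h u N) (k j : Fin 3) (β : Idx d) :
    Reg 1 T 2 (errDensity₃ u h k j β) :=
  Reg.reP (Reg.mul (by norm_num) (H.reg_pd _) (H.reg_coe _ _)) (H.reg_pd β)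

theorem reg_momE (H : RegData d T h u N) (k : Fin 3) (α β : Idx d) : Reg 1 T 1 (momE h u k α β) :=
  Reg.reP (Reg.mul (by norm_num) (H.reg_pd α).pred
    (((H.hh α β).pd (Sum.inl k)).clm Complex.ofRealCLM)) (H.reg_pd β).pred

theorem reg_momF (H : RegData d T h u N) (k : Fin 3) : Reg 1 T 0 (momF u N k) := by
  have h1 := Reg.reP H.hu.zero ((H.hN.pd (Sum.inl k)))
  have h2 := Reg.reP H.hN.zero ((H.hu.pd (Sum.inl k)).zero)
  exact (Reg.add le_rfl h1 (h2.const_mul (-1))).congr fun s _ x => by rw [momF]; ring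

theorem reg_massForcing (H : RegData d T h u N) : Reg 1 T 1 (imP N u) := Reg.imP H.hN
    (H.hu.of_le (by norm_num))

theorem reP_flux (H : RegData d T h u N) (hs : s ∈ Icc 0 T) (j : Fin 3) (x : X d) :
    reP (flux h u (Sum.inl j)) u s x =
      pd (Sum.inl j) (massDensity u s) x + ∑ β, errDensity₂ u h j β s x := by
  rw [reP, flux_eq, add_mul, Complex.add_re, Finset.sum_mul, Complex.re_sum,
    pd_massDensity (H.hu.differentiable hs x)]
  congr 1
  refine Finset.sum_congr rfl fun β _ => ?_
  simp [reP, Complex.mul_re]; ring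

/-- The mass flux in the first particle is exchanged for a Hessian of the weight: its flat part is
the momentum density, and the remainder gives `errDensity₁`. -/
theorem pairing_mass (H : RegData d T h u N) (hε : 0 < ε) (hs : s ∈ Icc 0 T) (k : Fin 3)
    {g : X d → ℝ}
    (hg : Integrable g) : pairing (w1 ε k) (reP (vel h u N) u s) g =
      ∑ j, (pairing (w2 ε j k) (momDensity u j s) g
        + ∑ β, pairing (w2 ε j k) (errDensity₁ u h j β s) g)
        + pairing (w1 ε k) (imP N u s) g := by
  have hJ : ∀ α, Reg 1 T 1 (imP u (flux h u α)) := fun α =>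
    (H.reg_two.imP (H.reg_flux α)).pred
  have hR : Integrable (fun x => ∑ α, pd α (imP u (flux h u α) s) x) :=
    integrable_finsetSum _ fun α _ => ((hJ α).pd α).integrable hs
  rw [funext (H.mass_law hs), pairing_add_left (bddW_w1 k) hR (H.reg_massForcing.integrable hs) hg,
    pairing_div_left (J := fun α => imP u (flux h u α)) (bddW_w1 k) (fun j => bddW_w2 hε j k)
      (fun j y => hasPD_w1 (by positivity) j k) hs hJ hg]
  congr 1
  refine Finset.sum_congr rfl fun j _ => ?_
  rw [funext (imP_flux j), pairing_add_left (bddW_w2 hε j k) ((H.reg_momDensity j).integrable hs)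
    (integrable_finsetSum _ fun β _ => (H.reg_err₁ j β).integrable hs) hg,
    pairing_sum_left _ (bddW_w2 hε j k) (fun β _ => (H.reg_err₁ j β).integrable hs) hg]

/-- Moving $\partial_k$ and then the divergence onto the gradient weight produces $\nabla\Delta
a_\varepsilon$ against $\mathrm{Re}(\text{flux}_j\,\bar u)$. The flat part of the latter is
$\partial_j\rho$, so one more integration by parts reaches $\Delta^2a_\varepsilon$; the part in $h$
stops at third derivatives of the weight. -/
theorem pairing_biLaplace (H : RegData d T h u N) (hε : 0 < ε) (hs : s ∈ Icc 0 T) :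
    ∑ k : Fin 3, pairing (w1 ε k) (massDensity u s)
      (fun x => ∑ α, pd (Sum.inl k) (pd α (reP (flux h u α) u s)) x) =
    -pairing (w4 ε) (massDensity u s) (massDensity u s)
      + ∑ j, ∑ β, pairing (w3 ε j) (massDensity u s) (errDensity₂ u h j β s) := by
  have hρ := H.reg_two.massDensity
  have hρi := hρ.integrable hs
  have hR : ∀ α, Reg 1 T 2 (reP (flux h u α) u) := fun α => (H.reg_flux α).reP H.reg_two
  have h1 : ∀ k : Fin 3, pairing (w1 ε k) (massDensity u s)
      (fun x => ∑ α, pd (Sum.inl k) (pd α (reP (flux h u α) u s)) x) =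
      -pairing (w2 ε k k) (massDensity u s) (fun x => ∑ α, pd α (reP (flux h u α) u s) x) := by
    intro k
    rw [pairing_sum_right _ (bddW_w1 k) hρi
        (fun α _ => (((hR α).pd α).pd (Sum.inl k)).integrable hs),
      pairing_sum_right _ (bddW_w2 hε k k) hρi (fun α _ => ((hR α).pd α).integrable hs),
      ← Finset.sum_neg_distrib]
    refine Finset.sum_congr rfl fun α _ => ?_
    exact pairing_pd_right (bddW_w1 k) (bddW_w2 hε k k)
      (fun y => hasPD_w1 (by positivity) k k) (((hR α).pd α).differentiable hs)
      (((hR α).pd α).integrable hs) (((hR α).pd α).pd (Sum.inl k) |>.integrable hs) hρi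
  have hRi : Integrable (fun x => ∑ α, pd α (reP (flux h u α) u s) x) :=
    integrable_finsetSum _ fun α _ => ((hR α).pd α).integrable hs
  have h2 : ∑ k, pairing (w2 ε k k) (massDensity u s)
      (fun x => ∑ α, pd α (reP (flux h u α) u s) x) = pairing (wLap ε) (massDensity u s)
      (fun x => ∑ α, pd α (reP (flux h u α) u s) x) := by
    rw [← pairing_sum_weight _ (fun k _ => bddW_w2 hε k k) hρi hRi]
    congr 1; funext y
    exact sum_w2 (by positivity)
  have h3 : ∀ j : Fin 3, pairing (w3 ε j) (massDensity u s) (reP (flux h u (Sum.inl j)) u s) =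
      -pairing (w3' ε j j) (massDensity u s) (massDensity u s)
        + ∑ β, pairing (w3 ε j) (massDensity u s) (errDensity₂ u h j β s) := by
    intro j
    rw [funext (H.reP_flux hs j), pairing_add_right (bddW_w3 hε j) hρi
      ((hρ.pd (Sum.inl j)).integrable hs)
      (integrable_finsetSum _ fun β _ => (H.reg_err₂ j β).integrable hs),
      pairing_sum_right _ (bddW_w3 hε j) hρi (fun β _ => (H.reg_err₂ j β).integrable hs)]
    congr 1
    exact pairing_pd_right (bddW_w3 hε j) (bddW_w3' hε j j)
      (fun y => hasPD_w3 (by positivity) j j) (hρ.differentiable hs) hρi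
      ((hρ.pd (Sum.inl j)).integrable hs) hρi
  have h4 : ∑ j, pairing (w3' ε j j) (massDensity u s) (massDensity u s) =
      pairing (w4 ε) (massDensity u s) (massDensity u s) := by
    rw [← pairing_sum_weight _ (fun k _ => bddW_w3' hε k k) hρi hρi]
    congr 1; funext y
    exact sum_w3' (by positivity)
  rw [Finset.sum_congr rfl fun k _ => h1 k, Finset.sum_neg_distrib, h2,
    pairing_div_right (J := fun α => reP (flux h u α) u) (bddW_wLap hε) (bddW_w3 hε)
      (fun j y => hasPD_wLap (by positivity) j) hs (fun α => (hR α).pred) hρi, neg_neg,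
    Finset.sum_congr rfl fun j _ => h3 j, Finset.sum_add_distrib, Finset.sum_neg_distrib, h4]

theorem pairing_momentum (H : RegData d T h u N) (hε : 0 < ε) (hs : s ∈ Icc 0 T) (k : Fin 3) :
    pairing (w1 ε k) (massDensity u s) (fun x => imP (vel h u N) (dx (Sum.inl k) u) s x
        + imP u (dx (Sum.inl k) (vel h u N)) s x) =
      pairing (w1 ε k) (massDensity u s) (momF u N k s)
      - 2 * ∑ j, (pairing (w2 ε j k) (massDensity u s) (reP (dx (Sum.inl j) u) (dx (Sum.inl k) u) s)
        + ∑ β, pairing (w2 ε j k) (massDensity u s) (errDensity₃ u h k j β s))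
      + ∑ α, ∑ β, pairing (w1 ε k) (massDensity u s) (momE h u k α β s)
      - pairing (w1 ε k) (massDensity u s)
        (fun x => ∑ α, pd (Sum.inl k) (pd α (reP (flux h u α) u s)) x) := by
  have hρ := H.reg_two.massDensity
  have hρi := hρ.integrable hs
  have hR : ∀ α, Reg 1 T 2 (reP (flux h u α) u) := fun α => (H.reg_flux α).reP H.reg_two
  have hG : ∀ α, Reg 1 T 1 (reP (flux h u α) (dx (Sum.inl k) u)) := fun α =>
    ((H.reg_flux α).reP (H.reg_pd _)).pred
  have i1 := (H.reg_momF k).integrable hs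
  have i2 : Integrable (fun x => 2 * ∑ α, pd α (reP (flux h u α) (dx (Sum.inl k) u) s) x) :=
    (integrable_finsetSum _ fun α _ => ((hG α).pd α).integrable hs).const_mul 2
  have i3 : Integrable (fun x => ∑ α, ∑ β, momE h u k α β s x) :=
    integrable_finsetSum _ fun α _ => integrable_finsetSum _ fun β _ =>
      (H.reg_momE k α β).integrable hs
  have i4 : Integrable (fun x => ∑ α, pd (Sum.inl k) (pd α (reP (flux h u α) u s)) x) :=
    integrable_finsetSum _ fun α _ => (((hR α).pd α).pd (Sum.inl k)).integrable hs
  have hw := bddW_w1 (ε := ε) k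
  have i12 : Integrable (fun x => momF u N k s x
      + 2 * ∑ α, pd α (reP (flux h u α) (dx (Sum.inl k) u) s) x) := i1.add i2
  have i123 : Integrable (fun x => momF u N k s x
      + 2 * ∑ α, pd α (reP (flux h u α) (dx (Sum.inl k) u) s) x
      + ∑ α, ∑ β, momE h u k α β s x) := i12.add i3
  rw [funext (H.momentum_law hs k), pairing_sub_right hw hρi i123 i4,
    pairing_add_right hw hρi i12 i3, pairing_add_right hw hρi i1 i2,
    pairing_const_mul_right,
    pairing_div_right (J := fun α => reP (flux h u α) (dx (Sum.inl k) u)) hw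
      (fun j => bddW_w2 hε j k) (fun j y => hasPD_w1 (by positivity) j k) hs hG hρi,
    pairing_sum_right _ hw hρi (fun α _ => integrable_finsetSum _ fun β _ =>
      (H.reg_momE k α β).integrable hs)]
  have h1 : ∀ j : Fin 3, pairing (w2 ε j k) (massDensity u s)
      (reP (flux h u (Sum.inl j)) (dx (Sum.inl k) u) s) =
      pairing (w2 ε j k) (massDensity u s) (reP (dx (Sum.inl j) u) (dx (Sum.inl k) u) s)
        + ∑ β, pairing (w2 ε j k) (massDensity u s) (errDensity₃ u h k j β s) := fun j => by
    rw [funext (reP_flux_pd j k), pairing_add_right (bddW_w2 hε j k) hρi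
      (((H.reg_pd (Sum.inl j)).reP (H.reg_pd (Sum.inl k))).integrable hs)
      (integrable_finsetSum _ fun β _ => (H.reg_err₃ k j β).integrable hs),
      pairing_sum_right _ (bddW_w2 hε j k) hρi (fun β _ => (H.reg_err₃ k j β).integrable hs)]
  have h2 : ∀ α, pairing (w1 ε k) (massDensity u s) (fun x => ∑ β, momE h u k α β s x) =
      ∑ β, pairing (w1 ε k) (massDensity u s) (momE h u k α β s) := fun α =>
    pairing_sum_right _ hw hρi (fun β _ => (H.reg_momE k α β).integrable hs)
  simp only [h1, h2]
  ring

/-- The quadratic terms of the interaction Morawetz identity have a sign. -/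
theorem pairing_hessian_nonpos (H : RegData d T h u N) (hε : 0 < ε) (hs : s ∈ Icc 0 T) :
    ∑ k, ∑ j, pairing (w2 ε j k) (momDensity u j s) (momDensity u k s) ≤
      2 * ∑ k, ∑ j, pairing (w2 ε j k) (massDensity u s)
        (reP (dx (Sum.inl j) u) (dx (Sum.inl k) u) s) := by
  have hρi := H.reg_two.massDensity.integrable hs
  have hm : ∀ k, Integrable (momDensity u k s) := fun k => (H.reg_momDensity k).integrable hs
  have hG : ∀ j k : Fin 3, Integrable (reP (dx (Sum.inl j) u) (dx (Sum.inl k) u) s) :=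
    fun j k => ((H.reg_pd (Sum.inl j)).reP (H.reg_pd (Sum.inl k))).integrable hs
  -- The Hessian is even, so exchanging the particles gives the same integral. The factor $2$ is
  -- spent on the symmetric sum, which is the form required by the pointwise inequality.
  have e : 2 * ∑ k, ∑ j, pairing (w2 ε j k) (massDensity u s)
        (reP (dx (Sum.inl j) u) (dx (Sum.inl k) u) s) =
      ∑ k, ∑ j, (pairing (w2 ε j k) (massDensity u s)
        (reP (dx (Sum.inl j) u) (dx (Sum.inl k) u) s) + pairing (w2 ε j k)
        (reP (dx (Sum.inl j) u) (dx (Sum.inl k) u) s) (massDensity u s)) := by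
    rw [Finset.mul_sum]
    refine Finset.sum_congr rfl fun k _ => ?_
    rw [Finset.mul_sum]
    refine Finset.sum_congr rfl fun j _ => ?_
    rw [pairing_swap (f := reP (dx (Sum.inl j) u) (dx (Sum.inl k) u) s) (w2_neg ε j k)]
    ring
  rw [e]
  have b := fun j k => bddW_w2 hε j k
  simp only [pairing]
  simp only [← integral_add (integrable_pairing (b _ _) hρi (hG _ _))
    (integrable_pairing (b _ _) (hG _ _) hρi)]
  have hadd : ∀ j k : Fin 3, Integrable (fun q : X d × X d => massDensity u s q.1
      * w2 ε j k (q.2.1 - q.1.1) * reP (dx (Sum.inl j) u) (dx (Sum.inl k) u) s q.2 +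
      reP (dx (Sum.inl j) u) (dx (Sum.inl k) u) s q.1 * w2 ε j k (q.2.1 - q.1.1)
      * massDensity u s q.2) := fun j k =>
    (integrable_pairing (b j k) hρi (hG j k)).add (integrable_pairing (b j k) (hG j k) hρi)
  have e1 : ∀ k, ∑ j, ∫ q : X d × X d, momDensity u j s q.1 * w2 ε j k (q.2.1 - q.1.1)
      * momDensity u k s q.2 = ∫ q : X d × X d, ∑ j, momDensity u j s q.1
      * w2 ε j k (q.2.1 - q.1.1) * momDensity u k s q.2 := fun k =>
    (integral_finsetSum _ fun j _ => integrable_pairing (b j k) (hm j) (hm k)).symm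
  have e2 : ∀ k : Fin 3, ∑ j : Fin 3, ∫ q : X d × X d,
      (massDensity u s q.1 * w2 ε j k (q.2.1 - q.1.1)
      * reP (dx (Sum.inl j) u) (dx (Sum.inl k) u) s q.2 +
      reP (dx (Sum.inl j) u) (dx (Sum.inl k) u) s q.1 * w2 ε j k (q.2.1 - q.1.1)
      * massDensity u s q.2) = ∫ q : X d × X d, ∑ j : Fin 3, (massDensity u s q.1
      * w2 ε j k (q.2.1 - q.1.1) * reP (dx (Sum.inl j) u) (dx (Sum.inl k) u) s q.2 +
      reP (dx (Sum.inl j) u) (dx (Sum.inl k) u) s q.1 * w2 ε j k (q.2.1 - q.1.1)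
      * massDensity u s q.2) := fun k =>
    (integral_finsetSum _ fun j _ => hadd j k).symm
  simp only [e1, e2]
  rw [← integral_finsetSum _ fun k _ => integrable_finsetSum _ fun j _ =>
      integrable_pairing (b j k) (hm j) (hm k),
    ← integral_finsetSum _ fun k _ => integrable_finsetSum _ fun j _ => hadd j k]
  refine integral_mono (integrable_finsetSum _ fun k _ => integrable_finsetSum _ fun j _ =>
      integrable_pairing (b j k) (hm j) (hm k)) (integrable_finsetSum _ fun k _ =>
      integrable_finsetSum _ fun j _ => hadd j k) fun q => ?_
  have key := sum_w2_mul_le (ε := ε) (y := q.2.1 - q.1.1) (by positivity) (u s q.1) (u s q.2)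
    (fun k => pd (Sum.inl k) (u s) q.1) (fun k => pd (Sum.inl k) (u s) q.2)
  simp only
  -- The doubling compensates the factor $\frac12$ in $\rho=|u|^2/2$.
  refine le_of_mul_le_mul_left ?_ (two_pos : (0 : ℝ) < 2)
  refine le_trans (le_of_eq ?_) (key.trans (le_of_eq ?_))
  all_goals
    rw [Finset.sum_comm, Finset.mul_sum]
    refine Finset.sum_congr rfl fun k _ => ?_
    rw [Finset.mul_sum]
    refine Finset.sum_congr rfl fun j _ => ?_
    simp only [imP, reP, massDensity]
    ring

/-- The rate of change of the regularized interaction Morawetz potential. -/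
theorem potential_rate_le (H : RegData d T h u N) (hε : 0 < ε) (hs : s ∈ Icc 0 T) :
    ∑ k : Fin 3, (pairing (w1 ε k) (reP (vel h u N) u s) (momDensity u k s)
      + pairing (w1 ε k) (massDensity u s) (fun x => imP (vel h u N) (dx (Sum.inl k) u) s x
        + imP u (dx (Sum.inl k) (vel h u N)) s x)) ≤
    pairing (w4 ε) (massDensity u s) (massDensity u s)
      + ∑ k, pairing (w1 ε k) (imP N u s) (momDensity u k s)
      + ∑ k, pairing (w1 ε k) (massDensity u s) (momF u N k s)
      + ∑ k, ∑ j, ∑ β, pairing (w2 ε j k) (errDensity₁ u h j β s) (momDensity u k s)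
      - ∑ j, ∑ β, pairing (w3 ε j) (massDensity u s) (errDensity₂ u h j β s)
      - 2 * ∑ k, ∑ j, ∑ β, pairing (w2 ε j k) (massDensity u s) (errDensity₃ u h k j β s)
      + ∑ k, ∑ α, ∑ β, pairing (w1 ε k) (massDensity u s) (momE h u k α β s) := by
  have h1 := H.pairing_hessian_nonpos hε hs
  have h2 := H.pairing_biLaplace hε hs
  simp only [H.pairing_mass hε hs _ ((H.reg_momDensity _).integrable hs),
    H.pairing_momentum hε hs, Finset.sum_add_distrib, Finset.sum_sub_distrib, ← Finset.mul_sum, h2]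
  linarith

end RegData

end

/-! ### Time derivatives and the fundamental theorem of calculus for two-particle integrals. -/

noncomputable section

variable {d : ℕ} {T t s : ℝ} {n : ℕ} {F : Type*} [NormedAddCommGroup F] [NormedSpace ℝ F]
    {p q : ℝ≥0∞}

theorem Reg.continuousOn_time {F : Type*} [NormedAddCommGroup F] [NormedSpace ℝ F]
    {f : ℝ → X d → F} (hf : Reg p T n f) (x : X d) :
    ContinuousOn (fun s => f s x) (Icc 0 T) :=
  hf.continuousOn.comp (f := fun s : ℝ => (s, x)) (by fun_prop) fun _ hs => ⟨hs, mem_univ _⟩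

/-- Derivatives are used only in the open interval, with continuity up to the end points, so the
one-sided derivatives at $0$ and $T$ never enter. -/
theorem sub_eq_integral [CompleteSpace F] {f f' : ℝ → F} (hs : s ∈ Icc 0 T)
    (hf : ContinuousOn f (Icc 0 T))
    (hf' : ContinuousOn f' (Icc 0 T)) (hd : ∀ s ∈ Ioo 0 T, HasDerivAt f (f' s) s) :
    ∫ r in (0 : ℝ)..s, f' r = f s - f 0 := by
  have hsub : Icc 0 s ⊆ Icc 0 T := Icc_subset_Icc_right hs.2
  refine intervalIntegral.integral_eq_sub_of_hasDerivAt_of_le hs.1 (hf.mono hsub)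
    (fun r hr => hd r ⟨hr.1, hr.2.trans_le hs.2⟩) ?_
  refine ContinuousOn.intervalIntegrable ?_
  rw [uIcc_of_le hs.1]
  exact hf'.mono hsub

/-- Differentiation under the integral; the derivative is dominated by its maximum on the compact
set $[0,s]\times[-1,1]$. -/
theorem hasDerivAt_integral_line {v : ℝ → X d → F} (hv : Reg p T 1 v) (hs : s ∈ Icc 0 T)
    (α : Idx d) (x : X d) :
    HasDerivAt (fun τ : ℝ => ∫ r in (0 : ℝ)..s, v r (x + τ • basisVec d α))
      (∫ r in (0 : ℝ)..s, pd α (v r) x) 0 := by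
  have hsub : Icc 0 s ⊆ Icc 0 T := Icc_subset_Icc_right hs.2
  have hu : uIcc 0 s = Icc 0 s := uIcc_of_le hs.1
  have huI : uIoc 0 s ⊆ Icc 0 s := by rw [uIoc_of_le hs.1]; exact Ioc_subset_Icc_self
  have hc : ContinuousOn (fun q : ℝ × ℝ => pd α (v q.1) (x + q.2 • basisVec d α))
      (Icc 0 s ×ˢ Icc (-1) 1) :=
    (hv.pd α).continuousOn.comp (f := fun q : ℝ × ℝ => (q.1, x + q.2 • basisVec d α))
      (by fun_prop) fun q hq => ⟨hsub hq.1, mem_univ _⟩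
  obtain ⟨C, hC⟩ := (isCompact_Icc.prod isCompact_Icc).exists_bound_of_continuousOn hc
  have hcv : ∀ y, ContinuousOn (fun r => v r y) (uIcc 0 s) := fun y => by
    rw [hu]; exact (hv.continuousOn_time y).mono hsub
  have hcv' : ∀ y, ContinuousOn (fun r => pd α (v r) y) (uIcc 0 s) := fun y => by
    rw [hu]; exact ((hv.pd α).continuousOn_time y).mono hsub
  have hmem : Icc (-1 : ℝ) 1 ∈ nhds (0 : ℝ) := Icc_mem_nhds (by norm_num) (by norm_num)
  have := (intervalIntegral.hasDerivAt_integral_of_dominated_loc_of_deriv_le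
    (F := fun (τ : ℝ) r => v r (x + τ • basisVec d α))
    (F' := fun (τ : ℝ) r => pd α (v r) (x + τ • basisVec d α))
    (μ := volume) (a := 0) (b := s) (x₀ := 0) (s := Icc (-1) 1) (bound := fun _ => C) hmem
    (Filter.Eventually.of_forall fun τ => ((hcv _).mono uIoc_subset_uIcc).aestronglyMeasurable
      measurableSet_uIoc) (hcv _).intervalIntegrable
    (((hcv' _).mono uIoc_subset_uIcc).aestronglyMeasurable measurableSet_uIoc)
    (Filter.Eventually.of_forall fun r hr τ hτ => hC (r, τ) ⟨huI hr, hτ⟩)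
    intervalIntegrable_const (Filter.Eventually.of_forall fun r hr τ _ => ?_)).2
  · simpa using this
  · have h1 := (hv.differentiable (hsub (huI hr)) (x + τ • basisVec d α)).hasFDerivAt
    have h2 : HasDerivAt (fun τ : ℝ => x + τ • basisVec d α) (basisVec d α) τ := by
      simpa using ((hasDerivAt_id τ).smul_const (basisVec d α)).const_add x
    exact h1.comp_hasDerivAt τ h2

/-- Space derivatives commute with the time derivative. -/
theorem hasDerivAt_pd [CompleteSpace F] {u v : ℝ → X d → F} (hu : Reg p T 1 u) (hv : Reg q T 1 v)
    (hd : ∀ x, ∀ s ∈ Ioo 0 T, HasDerivAt (fun s => u s x) (v s x) s) (α : Idx d) (x : X d)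
    (hs : s ∈ Ioo 0 T) : HasDerivAt (fun s => pd α (u s) x) (pd α (v s) x) s := by
  have hT : 0 ≤ T := hs.1.le.trans hs.2.le
  -- Existence of the mixed derivative is not assumed. The identity $u(r)=u(0)+\int_0^rv$ is
  -- differentiated in space, and the resulting integral is then differentiated in $r$ by continuity
  -- of $\partial_\alpha v$.
  have key : ∀ r ∈ Icc 0 T, pd α (u r) x = pd α (u 0) x + ∫ r' in (0 : ℝ)..r, pd α (v r') x := by
    intro r hr
    have h1 := hasDerivAt_integral_line hv hr α x
    have h2 : ∀ r ∈ Icc 0 T, HasDerivAt (fun τ : ℝ => u r (x + τ • basisVec d α))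
        (pd α (u r) x) 0 := fun r hr => by
      have h3 := (hu.differentiable hr (x + (0 : ℝ) • basisVec d α)).hasFDerivAt
      have h4 : HasDerivAt (fun τ : ℝ => x + τ • basisVec d α) (basisVec d α) 0 := by
        simpa using ((hasDerivAt_id (0 : ℝ)).smul_const (basisVec d α)).const_add x
      have := h3.comp_hasDerivAt 0 h4
      simpa [pd] using! this
    have h5 := (h2 r hr).sub (h2 0 ⟨le_rfl, hT⟩)
    have h6 : (fun τ : ℝ => ∫ r' in (0 : ℝ)..r, v r' (x + τ • basisVec d α)) =
        (fun τ : ℝ => u r (x + τ • basisVec d α)) - fun τ : ℝ => u 0 (x + τ • basisVec d α) := by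
      funext τ
      exact sub_eq_integral hr (hu.continuousOn_time _) (hv.continuousOn_time _) (hd _)
    rw [h6] at h1
    rw [h1.unique h5]; abel
  have hc := (hv.pd α).continuousOn_time x
  have hint : IntervalIntegrable (fun r => pd α (v r) x) volume 0 s := by
    refine ContinuousOn.intervalIntegrable (hc.mono ?_)
    rw [uIcc_of_le hs.1.le]; exact Icc_subset_Icc_right hs.2.le
  have hco := hc.mono Ioo_subset_Icc_self
  have h7 := intervalIntegral.integral_hasDerivAt_right hint
    (hco.stronglyMeasurableAtFilter isOpen_Ioo s hs) (hco.continuousAt (isOpen_Ioo.mem_nhds hs))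
  refine (h7.const_add (pd α (u 0) x)).congr_of_eventuallyEq ?_
  filter_upwards [isOpen_Ioo.mem_nhds hs] with r hr using key r (Ioo_subset_Icc_self hr)

/-- The fundamental theorem of calculus for a two-particle integral. -/
theorem pairing_ftc {w : Y → ℝ} (hw : BddW w) {f g f' g' : ℝ → X d → ℝ} (hf : Reg 1 T 0 f)
    (hg : Reg 1 T 0 g) (hf' : Reg 1 T 0 f') (hg' : Reg 1 T 0 g')
    (hfd : ∀ x, ∀ s ∈ Ioo 0 T, HasDerivAt (fun s => f s x) (f' s x) s)
    (hgd : ∀ x, ∀ s ∈ Ioo 0 T, HasDerivAt (fun s => g s x) (g' s x) s) (ht : t ∈ Icc 0 T) :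
    pairing w (f t) (g t) - pairing w (f 0) (g 0) =
      ∫ s in Icc 0 t, (pairing w (f' s) (g s) + pairing w (f s) (g' s)) := by
  have h0 : (0 : ℝ) ∈ Icc 0 T := ⟨le_rfl, ht.1.trans ht.2⟩
  have d1 := Dom.of_bddW hf' hw
  have d2 := Dom.of_bddW hf hw
  have hI : Integrable (fun q => kern w f' g q + kern w f g' q)
      ((volume.restrict (Icc 0 t)).prod (volume : Measure (X d × X d))) :=
    (integrable_kern d1 hg ht.2).add (integrable_kern d2 hg' ht.2)
  rw [integral_add (integrableOn_pairing d1 hg ht.2) (integrableOn_pairing d2 hg' ht.2),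
    integral_pairing_eq d1 hg ht.2, integral_pairing_eq d2 hg' ht.2,
    ← integral_add (integrable_kern d1 hg ht.2) (integrable_kern d2 hg' ht.2), stMeasure,
    integral_prod_symm _ hI, pairing,
    pairing, ← integral_sub (integrable_pairing hw (hf.integrable ht) (hg.integrable ht))
      (integrable_pairing hw (hf.integrable h0) (hg.integrable h0))]
  -- Fubini has put the time integral inside, so only the one-dimensional theorem at a fixed pair of
  -- points remains; the two-particle integral itself is never differentiated in time.
  congr 1; funext q
  have hder : ∀ s ∈ Ioo 0 T, HasDerivAt (fun s => f s q.1 * w (q.2.1 - q.1.1) * g s q.2)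
      (kern w f' g (s, q) + kern w f g' (s, q)) s := fun s hs =>
    (((hfd q.1 s hs).mul_const _).mul (hgd q.2 s hs))
  have hcf := hf.continuousOn_time q.1
  have hcg := hg.continuousOn_time q.2
  have hcf' := hf'.continuousOn_time q.1
  have hcg' := hg'.continuousOn_time q.2
  have := sub_eq_integral ht (f := fun s => f s q.1 * w (q.2.1 - q.1.1) * g s q.2)
    (f' := fun s => kern w f' g (s, q) + kern w f g' (s, q))
    ((hcf.mul continuousOn_const).mul hcg)
    (by simp only [kern]; fun_prop) hder
  rw [← this, intervalIntegral.integral_of_le ht.1, ← integral_Icc_eq_integral_Ioc]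

end

/-! ### The regularized estimate integrated in time. -/

noncomputable section

variable {d : ℕ} {T t s : ℝ} {n : ℕ}
  {h : Idx d → Idx d → ℝ → X d → ℝ} {u N : ℝ → X d → ℂ} {u₀ : X d → ℂ}

theorem IsSolution.regData (hsol : IsSolution d T u₀ u h N) : RegData d T h u N where
  hu := by
    obtain ⟨K, hK⟩ := hsol.bound_u
    exact Reg.of_iteratedFDeriv (fun t ht => hsol.contDiff_u t ht) hsol.continuous_u
      ⟨K.toNNReal, fun j hj t ht => hK j hj t ht⟩
  hN := by
    obtain ⟨K, hK⟩ := hsol.bound_N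
    exact Reg.of_iteratedFDeriv (fun t ht => by exact_mod_cast hsol.contDiff_N t ht)
      hsol.continuous_N ⟨K.toNNReal, fun j hj t ht => hK j hj t ht⟩
  hh := fun α β => by
    obtain ⟨K, hK⟩ := hsol.bound_h
    refine Reg.of_iteratedFDeriv (fun t ht => hsol.contDiff_h α β t ht) (hsol.continuous_h α β)
      ⟨K.toNNReal, fun j hj t ht => ?_⟩
    rw [eLpNorm_exponent_top]
    refine eLpNormEssSup_le_of_ae_bound (C := K) (Filter.Eventually.of_forall fun x => ?_)
    exact hK α β j hj t ht x
  symm := hsol.symm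
  smooth := hsol.contDiff_u

theorem IsSolution.hasDerivAt (hsol : IsSolution d T u₀ u h N) (x : X d) (hs : s ∈ Ioo 0 T) :
    HasDerivAt (fun s => u s x) (vel h u N s x) s := by
  have H := hsol.regData
  have hs' := Ioo_subset_Icc_self hs
  obtain ⟨ut, h1, h2⟩ := hsol.equation s hs' x
  have h3 : ∑ α, ∑ β, pd α (fun x' => (metric h α β s x' : ℂ) * pd β (u s) x') x =
      divFlux h u s x := by
    rw [divFlux]
    refine Finset.sum_congr rfl fun α _ => ?_
    exact (pd_sum (f := fun β x' => (metric h α β s x' : ℂ) * pd β (u s) x') _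
      (fun β _ => ((H.reg_metric α β).differentiable hs' x).mul
        ((H.reg_pd β).differentiable hs' x)) α).symm
  have h4 : ut = vel h u N s x := by
    rw [h3] at h2
    rw [vel, ← h2]
    linear_combination ut * Complex.I_mul_I
  rw [← h4]
  exact h1.hasDerivAt (Icc_mem_nhds hs.1 hs.2)

theorem hasDerivAt_mul_conj {p q : ℝ → ℂ} {p' q' : ℂ} (hp : HasDerivAt p p' s)
    (hq : HasDerivAt q q' s) :
    HasDerivAt (fun s => p s * conj (q s)) (p' * conj (q s) + p s * conj q') s :=
  hp.mul (Complex.conjCLE.toContinuousLinearMap.hasFDerivAt.comp_hasDerivAt s hq)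

theorem IsSolution.hasDerivAt_massDensity (hsol : IsSolution d T u₀ u h N) (x : X d)
    (hs : s ∈ Ioo 0 T) :
    HasDerivAt (fun s => massDensity u s x) (reP (vel h u N) u s x) s := by
  have h1 := hsol.hasDerivAt x hs
  have h2 := (Complex.reCLM.hasFDerivAt.comp_hasDerivAt s (hasDerivAt_mul_conj h1 h1)).const_mul
    (2⁻¹ : ℝ)
  rw [massDensity_eq]
  convert! h2 using 1
  simp [reP]; ring

theorem IsSolution.hasDerivAt_momDensity (hsol : IsSolution d T u₀ u h N) (k : Fin 3) (x : X d)
    (hs : s ∈ Ioo 0 T) :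
    HasDerivAt (fun s => momDensity u k s x) (imP (vel h u N) (dx (Sum.inl k) u) s x
      + imP u (dx (Sum.inl k) (vel h u N)) s x) s := by
  have H := hsol.regData
  have h1 := hsol.hasDerivAt x hs
  have h2 := hasDerivAt_pd (H.hu.of_le (by norm_num)) H.reg_vel (fun x s hs => hsol.hasDerivAt x hs)
    (Sum.inl k) x hs
  have h3 := Complex.imCLM.hasFDerivAt.comp_hasDerivAt s (hasDerivAt_mul_conj h1 h2)
  convert! h3 using 1

/-- The regularized interaction Morawetz potential. -/
def regPotential (u : ℝ → X d → ℂ) (ε s : ℝ) : ℝ :=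
  ∑ k, pairing (w1 ε k) (massDensity u s) (momDensity u k s)

/-- The space-time integral `∫_0^t ∫∫ f(s, x') w(y - y') g(s, x) dx' dx ds`. -/
def stPairing (t : ℝ) (w : Y → ℝ) (f g : ℝ → X d → ℝ) : ℝ := ∫ q, kern w f g q ∂(stMeasure d t)

/-- The right-hand side of the regularized interaction Morawetz estimate. -/
def regRhs (u N : ℝ → X d → ℂ) (h : Idx d → Idx d → ℝ → X d → ℝ) (t ε : ℝ) : ℝ :=
  -(regPotential u ε t - regPotential u ε 0)
    + ∑ k, stPairing t (w1 ε k) (imP N u) (momDensity u k)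
    + ∑ k, stPairing t (w1 ε k) (massDensity u) (momF u N k)
    + ∑ k, ∑ j, ∑ β, stPairing t (w2 ε j k) (errDensity₁ u h j β) (momDensity u k)
    - ∑ j, ∑ β, stPairing t (w3 ε j) (massDensity u) (errDensity₂ u h j β)
    - 2 * ∑ k, ∑ j, ∑ β, stPairing t (w2 ε j k) (massDensity u) (errDensity₃ u h k j β)
    + ∑ k, ∑ α, ∑ β, stPairing t (w1 ε k) (massDensity u) (momE h u k α β)

theorem integral_pairing_eq_stPairing {f g : ℝ → X d → ℝ} {w : Y → ℝ} (hf : Reg 1 T 0 f)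
    (hg : Reg 1 T 0 g) (hw : BddW w) (ht : t ≤ T) :
    ∫ s in Icc 0 t, pairing w (f s) (g s) = stPairing t w f g :=
  integral_pairing_eq (Dom.of_bddW hf hw) hg ht

/-- The regularized interaction Morawetz estimate. -/
theorem IsSolution.neg_stPairing_w4_le (hsol : IsSolution d T u₀ u h N) {ε : ℝ} (hε : 0 < ε)
    (ht : t ∈ Icc 0 T) :
    -stPairing t (w4 ε) (massDensity u) (massDensity u) ≤ regRhs u N h t ε := by
  have H := hsol.regData
  have hρ := H.reg_two.massDensity.zero
  have hm := fun k => (H.reg_momDensity k).zero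
  have hN := H.reg_massForcing.zero
  have hF := fun k => (H.reg_momF k).zero
  have h1 := fun j β => (H.reg_err₁ j β).zero
  have h2 := fun j β => (H.reg_err₂ j β).zero
  have h3 := fun k j β => (H.reg_err₃ k j β).zero
  have hE := fun k α β => (H.reg_momE k α β).zero
  have hv : Reg 1 T 0 (reP (vel h u N) u) := (H.reg_vel.reP (H.hu.of_le (by norm_num))).zero
  have hv' : ∀ k : Fin 3, Reg 1 T 0 (fun s x => imP (vel h u N) (dx (Sum.inl k) u) s x
      + imP u (dx (Sum.inl k) (vel h u N)) s x) := fun k =>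
    Reg.add le_rfl (H.reg_vel.zero.imP (H.reg_pd _).zero) (H.hu.zero.imP (H.reg_vel.pd _))
  have I : ∀ {w : Y → ℝ} {f g : ℝ → X d → ℝ}, BddW w → Reg 1 T 0 f → Reg 1 T 0 g →
      IntegrableOn (fun s => pairing w (f s) (g s)) (Icc 0 t) := fun hw hf hg =>
    integrableOn_pairing (Dom.of_bddW hf hw) hg ht.2
  have b1 := bddW_w1 (ε := ε)
  have b2 := bddW_w2 hε
  have b3 := bddW_w3 hε
  have b4 := bddW_w4 hε
  have J : ∀ k : Fin 3, IntegrableOn (fun s => pairing (w1 ε k) (reP (vel h u N) u s)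
      (momDensity u k s) + pairing (w1 ε k) (massDensity u s)
      (fun x => imP (vel h u N) (dx (Sum.inl k) u) s x
        + imP u (dx (Sum.inl k) (vel h u N)) s x)) (Icc 0 t) := fun k =>
    (I (b1 k) hv (hm k)).add (I (b1 k) hρ (hv' k))
  have ftc : regPotential u ε t - regPotential u ε 0 = ∫ s in Icc 0 t,
      ∑ k : Fin 3, (pairing (w1 ε k) (reP (vel h u N) u s) (momDensity u k s)
      + pairing (w1 ε k) (massDensity u s) (fun x => imP (vel h u N) (dx (Sum.inl k) u) s x
        + imP u (dx (Sum.inl k) (vel h u N)) s x)) := by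
    rw [regPotential, regPotential, ← Finset.sum_sub_distrib,
      integral_finsetSum _ fun k _ => J k]
    refine Finset.sum_congr rfl fun k _ => ?_
    exact pairing_ftc (b1 k) hρ (hm k) hv (hv' k)
      (fun x s hs => hsol.hasDerivAt_massDensity x hs)
      (fun x s hs => hsol.hasDerivAt_momDensity k x hs) ht
  have K1 := I b4 hρ hρ
  have K2 : IntegrableOn (fun s => ∑ k, pairing (w1 ε k) (imP N u s) (momDensity u k s))
    (Icc 0 t) := integrable_finsetSum _ fun k _ => I (b1 k) hN (hm k)
  have K3 : IntegrableOn (fun s => ∑ k, pairing (w1 ε k) (massDensity u s) (momF u N k s))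
    (Icc 0 t) := integrable_finsetSum _ fun k _ => I (b1 k) hρ (hF k)
  have K4 : IntegrableOn (fun s => ∑ k, ∑ j, ∑ β, pairing (w2 ε j k) (errDensity₁ u h j β s)
      (momDensity u k s)) (Icc 0 t) := integrable_finsetSum _ fun k _ =>
    integrable_finsetSum _ fun j _ => integrable_finsetSum _ fun β _ => I (b2 j k) (h1 j β) (hm k)
  have K5 : IntegrableOn (fun s => ∑ j, ∑ β, pairing (w3 ε j) (massDensity u s)
      (errDensity₂ u h j β s)) (Icc 0 t) := integrable_finsetSum _ fun j _ =>
    integrable_finsetSum _ fun β _ => I (b3 j) hρ (h2 j β)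
  have K6 : IntegrableOn (fun s => 2 * ∑ k, ∑ j, ∑ β, pairing (w2 ε j k) (massDensity u s)
      (errDensity₃ u h k j β s)) (Icc 0 t) := (integrable_finsetSum _ fun k _ =>
    integrable_finsetSum _ fun j _ => integrable_finsetSum _ fun β _ =>
      I (b2 j k) hρ (h3 k j β)).const_mul 2
  have K7 : IntegrableOn (fun s => ∑ k, ∑ α, ∑ β, pairing (w1 ε k) (massDensity u s)
      (momE h u k α β s)) (Icc 0 t) := integrable_finsetSum _ fun k _ =>
    integrable_finsetSum _ fun α _ => integrable_finsetSum _ fun β _ => I (b1 k) hρ (hE k α β)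
  -- The inequality for the rate is integrated over $[0,t]$; the rest of the proof distributes the
  -- integral over the finite sums.
  have mono := setIntegral_mono_on (integrable_finsetSum _ fun k _ => J k)
      ((((((K1.add K2).add K3).add K4).sub K5).sub K6).add K7)
    measurableSet_Icc fun s hs => H.potential_rate_le hε ⟨hs.1, hs.2.trans ht.2⟩
  rw [← ftc, integral_add' (((((K1.add K2).add K3).add K4).sub K5).sub K6) K7,
    integral_sub' ((((K1.add K2).add K3).add K4).sub K5) K6,
    integral_sub' (((K1.add K2).add K3).add K4) K5,
    integral_add' ((K1.add K2).add K3) K4, integral_add' (K1.add K2) K3, integral_add' K1 K2,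
    integral_const_mul] at mono
  rw [integral_pairing_eq_stPairing hρ hρ b4 ht.2] at mono
  have E2 : ∫ s in Icc 0 t, ∑ k, pairing (w1 ε k) (imP N u s) (momDensity u k s) =
      ∑ k, stPairing t (w1 ε k) (imP N u) (momDensity u k) := by
    rw [integral_finsetSum _ fun k _ => I (b1 k) hN (hm k)]
    exact Finset.sum_congr rfl fun k _ => integral_pairing_eq_stPairing hN (hm k) (b1 k) ht.2
  have E3 : ∫ s in Icc 0 t, ∑ k, pairing (w1 ε k) (massDensity u s) (momF u N k s) =
      ∑ k, stPairing t (w1 ε k) (massDensity u) (momF u N k) := by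
    rw [integral_finsetSum _ fun k _ => I (b1 k) hρ (hF k)]
    exact Finset.sum_congr rfl fun k _ => integral_pairing_eq_stPairing hρ (hF k) (b1 k) ht.2
  have E4 : ∫ s in Icc 0 t, ∑ k, ∑ j, ∑ β, pairing (w2 ε j k) (errDensity₁ u h j β s)
      (momDensity u k s) = ∑ k, ∑ j, ∑ β,
      stPairing t (w2 ε j k) (errDensity₁ u h j β) (momDensity u k) := by
    rw [integral_finsetSum _ fun k _ => integrable_finsetSum _ fun j _ =>
      integrable_finsetSum _ fun β _ => I (b2 j k) (h1 j β) (hm k)]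
    refine Finset.sum_congr rfl fun k _ => ?_
    rw [integral_finsetSum _ fun j _ =>
      integrable_finsetSum _ fun β _ => I (b2 j k) (h1 j β) (hm k)]
    refine Finset.sum_congr rfl fun j _ => ?_
    rw [integral_finsetSum _ fun β _ => I (b2 j k) (h1 j β) (hm k)]
    exact Finset.sum_congr rfl fun β _ =>
      integral_pairing_eq_stPairing (h1 j β) (hm k) (b2 j k) ht.2
  have E5 : ∫ s in Icc 0 t, ∑ j, ∑ β, pairing (w3 ε j) (massDensity u s)
      (errDensity₂ u h j β s) = ∑ j, ∑ β,
      stPairing t (w3 ε j) (massDensity u) (errDensity₂ u h j β) := by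
    rw [integral_finsetSum _ fun j _ => integrable_finsetSum _ fun β _ => I (b3 j) hρ (h2 j β)]
    refine Finset.sum_congr rfl fun j _ => ?_
    rw [integral_finsetSum _ fun β _ => I (b3 j) hρ (h2 j β)]
    exact Finset.sum_congr rfl fun β _ => integral_pairing_eq_stPairing hρ (h2 j β) (b3 j) ht.2
  have E6 : ∫ s in Icc 0 t, ∑ k, ∑ j, ∑ β, pairing (w2 ε j k) (massDensity u s)
      (errDensity₃ u h k j β s) = ∑ k, ∑ j, ∑ β,
      stPairing t (w2 ε j k) (massDensity u) (errDensity₃ u h k j β) := by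
    rw [integral_finsetSum _ fun k _ => integrable_finsetSum _ fun j _ =>
      integrable_finsetSum _ fun β _ => I (b2 j k) hρ (h3 k j β)]
    refine Finset.sum_congr rfl fun k _ => ?_
    rw [integral_finsetSum _ fun j _ =>
      integrable_finsetSum _ fun β _ => I (b2 j k) hρ (h3 k j β)]
    refine Finset.sum_congr rfl fun j _ => ?_
    rw [integral_finsetSum _ fun β _ => I (b2 j k) hρ (h3 k j β)]
    exact Finset.sum_congr rfl fun β _ =>
      integral_pairing_eq_stPairing hρ (h3 k j β) (b2 j k) ht.2
  have E7 : ∫ s in Icc 0 t, ∑ k, ∑ α, ∑ β, pairing (w1 ε k) (massDensity u s)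
      (momE h u k α β s) = ∑ k, ∑ α, ∑ β,
      stPairing t (w1 ε k) (massDensity u) (momE h u k α β) := by
    rw [integral_finsetSum _ fun k _ => integrable_finsetSum _ fun α _ =>
      integrable_finsetSum _ fun β _ => I (b1 k) hρ (hE k α β)]
    refine Finset.sum_congr rfl fun k _ => ?_
    rw [integral_finsetSum _ fun α _ =>
      integrable_finsetSum _ fun β _ => I (b1 k) hρ (hE k α β)]
    refine Finset.sum_congr rfl fun α _ => ?_
    rw [integral_finsetSum _ fun β _ => I (b1 k) hρ (hE k α β)]
    exact Finset.sum_congr rfl fun β _ =>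
      integral_pairing_eq_stPairing hρ (hE k α β) (b1 k) ht.2
  rw [E2, E3, E4, E5, E6, E7] at mono
  rw [regRhs]
  linarith

end

/-! ### Concentration of the bi-Laplacian on the diagonal. -/

noncomputable section

variable {d : ℕ} {T t s : ℝ}

/-- The regularized bi-Laplacian dominates a normalized indicator of the ball of radius `ε`. -/
theorem inv_pow_le_neg_w4 {ε : ℝ} (hε : 0 < ε) {v : Y} (hv : ‖v‖ ≤ 1) :
    (ε ^ 3)⁻¹ ≤ -w4 ε (ε • v) := by
  have h0 : 0 < ε ^ 2 + ‖ε • v‖ ^ 2 := by positivity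
  have h1 := r_sq h0
  have hr := r_nonneg (ε := ε) (y := ε • v)
  set R := r ε (ε • v)
  have hn : ‖ε • v‖ ^ 2 ≤ ε ^ 2 := by
    rw [norm_smul, mul_pow, Real.norm_eq_abs, sq_abs]
    have : ‖v‖ ^ 2 ≤ 1 := by nlinarith [norm_nonneg v]
    nlinarith [sq_nonneg ε]
  set x := ε * R with hx
  have hx0 : 0 ≤ x := by positivity
  have h2 : 1 ≤ 2 * x ^ 2 := by
    rw [hx, mul_pow]
    nlinarith [sq_nonneg R]
  have h3 : (2 / 3 : ℝ) ≤ x := by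
    by_contra hlt
    push Not at hlt
    nlinarith
  have h4 : (1 / 8 : ℝ) ≤ x ^ 6 := by
    have : (1 / 2 : ℝ) ≤ x ^ 2 := by linarith
    calc (1 / 8 : ℝ) = (1 / 2) ^ 3 := by norm_num
      _ ≤ (x ^ 2) ^ 3 := by gcongr
      _ = x ^ 6 := by ring
  have h5 : 1 ≤ 15 * x ^ 7 := by
    have : (1 / 8 : ℝ) * (2 / 3) ≤ x ^ 6 * x := by gcongr
    nlinarith
  rw [inv_le_iff_one_le_mul₀ (by positivity)]
  have : -w4 ε (ε • v) * ε ^ 3 = 15 * x ^ 7 := by rw [w4, hx]; ring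
  rw [this]; exact h5

theorem lintegral_comp_smul_ball (f : Y → ℝ≥0∞) (hf : Measurable f) {ε : ℝ} (hε : 0 < ε) :
    ∫⁻ v, f (ε • v) = ENNReal.ofReal (ε ^ 3)⁻¹ * ∫⁻ y, f y := by
  have h := Measure.map_addHaar_smul (volume : Measure Y) hε.ne'
  have h2 : ∫⁻ v, f (ε • v) = ∫⁻ y, f y ∂(Measure.map (ε • ·) volume) :=
    (lintegral_map hf (measurable_const_smul ε)).symm
  rw [h2, h, lintegral_smul_measure]
  simp only [finrank_euclideanSpace, Fintype.card_fin]
  rw [abs_of_nonneg (by positivity)]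
  rfl

/-- Averages over small balls are bounded by the regularized bi-Laplacian. -/
theorem lintegral_ball_le (f : Y → ℝ≥0∞) (hf : Measurable f) {ε : ℝ} (hε : 0 < ε) (y : Y) :
    ∫⁻ v in Metric.closedBall 0 1, f (y + ε • v) ≤
      ∫⁻ y', ENNReal.ofReal (-w4 ε (y' - y)) * f y' := by
  have h1 : ∫⁻ y', ENNReal.ofReal (-w4 ε (y' - y)) * f y' =
      ∫⁻ y', ENNReal.ofReal (-w4 ε y') * f (y + y') := by
    rw [← lintegral_add_left_eq_self _ y]
    simp
  have hm : Measurable fun y' => ENNReal.ofReal (-w4 ε y') * f (y + y') := by fun_prop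
  have h2 := lintegral_comp_smul_ball _ hm hε
  have hε3 : 0 < ε ^ 3 := by positivity
  have h3 : ∫⁻ y', ENNReal.ofReal (-w4 ε y') * f (y + y') =
      ∫⁻ v, ENNReal.ofReal (ε ^ 3) * (ENNReal.ofReal (-w4 ε (ε • v)) * f (y + ε • v)) := by
    rw [lintegral_const_mul' _ _ ENNReal.ofReal_ne_top, h2, ← mul_assoc,
      ← ENNReal.ofReal_mul hε3.le, mul_inv_cancel₀ hε3.ne', ENNReal.ofReal_one, one_mul]
  rw [h1, h3]
  refine le_trans ?_ (setLIntegral_le_lintegral (Metric.closedBall 0 1) _)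
  refine setLIntegral_mono' measurableSet_closedBall fun v hv => ?_
  rw [← mul_assoc, ← ENNReal.ofReal_mul hε3.le]
  refine le_mul_of_one_le_left' ?_
  rw [ENNReal.one_le_ofReal]
  have := inv_pow_le_neg_w4 hε (mem_closedBall_zero_iff.1 hv)
  rwa [inv_le_iff_one_le_mul₀' hε3] at this

open Filter Topology

/-- The volume of the unit ball of `ℝ³`. -/
def ballVol : ℝ≥0∞ := volume (Metric.closedBall (0 : Y) 1)

variable {R : X d → ℝ≥0∞} {e : ℕ → ℝ}

/-- Convergence of averages over shrinking balls, as an inequality. -/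
theorem ballVol_mul_le_liminf (hR : Continuous R) (he : ∀ n, 0 < e n)
    (hlim : Tendsto e atTop (𝓝 0)) (y : Y) :
    ballVol * ∫⁻ z, R (y, z) ≤
      liminf (fun n => ∫⁻ x : X d, ENNReal.ofReal (-w4 (e n) (x.1 - y)) * R x) atTop := by
  have hRm := hR.measurable
  -- The rescaled ball variable and $z$ are treated as one variable, so that a single application of
  -- Fatou suffices. Continuity of $R$ gives pointwise convergence.
  let ν : Measure (Y × Z d) := (volume.restrict (Metric.closedBall 0 1)).prod volume
  have h1 : ballVol * ∫⁻ z, R (y, z) = ∫⁻ p : Y × Z d, R (y, p.2) ∂ν := by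
    rw [lintegral_prod _ (by fun_prop)]
    simp [ballVol, mul_comm]
  have h2 : ∀ p : Y × Z d, Tendsto (fun n => R (y + e n • p.1, p.2)) atTop (𝓝 (R (y, p.2))) := by
    intro p
    have : Tendsto (fun n => (y + e n • p.1, p.2)) atTop (𝓝 (y + (0 : ℝ) • p.1, p.2)) :=
      ((hlim.smul_const p.1).const_add y).prodMk_nhds tendsto_const_nhds
    rw [zero_smul, add_zero] at this
    exact (hR.tendsto _).comp this
  rw [h1]
  calc ∫⁻ p : Y × Z d, R (y, p.2) ∂ν
      = ∫⁻ p : Y × Z d, liminf (fun n => R (y + e n • p.1, p.2)) atTop ∂ν := by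
        congr 1; funext p; exact (h2 p).liminf_eq.symm
    _ ≤ liminf (fun n => ∫⁻ p : Y × Z d, R (y + e n • p.1, p.2) ∂ν) atTop :=
        lintegral_liminf_le fun n => by fun_prop
    _ ≤ _ := by
        refine liminf_le_liminf (Eventually.of_forall fun n => ?_)
        rw [Measure.volume_eq_prod, lintegral_prod_symm _ (by fun_prop),
          lintegral_prod_symm _ (by fun_prop)]
        exact lintegral_mono fun z => lintegral_ball_le (fun y => R (y, z)) (by fun_prop) (he n) y

/-- The square is opened as $\int R(x')\big(\int R(y',z)\,dz\big)dx'$. The inner integral is bounded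
by the ball averages centred at $y'$, and a second Fatou moves the lower limit outside the integral
in $x'$. -/
theorem ballVol_mul_lintegral_sq_le (hR : Continuous R) (he : ∀ n, 0 < e n)
    (hlim : Tendsto e atTop (𝓝 0)) :
    ballVol * ∫⁻ y, (∫⁻ z, R (y, z)) ^ 2 ≤
      liminf (fun n => ∫⁻ q : X d × X d,
        R q.1 * ENNReal.ofReal (-w4 (e n) (q.2.1 - q.1.1)) * R q.2) atTop := by
  have hRm := hR.measurable
  have hV : ballVol ≠ ∞ := measure_closedBall_lt_top.ne
  calc ballVol * ∫⁻ y, (∫⁻ z, R (y, z)) ^ 2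
      = ∫⁻ x' : X d, R x' * (ballVol * ∫⁻ z, R (x'.1, z)) := by
        rw [Measure.volume_eq_prod, lintegral_prod _ (by fun_prop), ← lintegral_const_mul' _ _ hV]
        congr 1; funext y
        change _ = ∫⁻ z', R (y, z') * (ballVol * ∫⁻ z, R (y, z))
        rw [lintegral_mul_const _ (by fun_prop)]
        ring
    _ ≤ ∫⁻ x' : X d, liminf (fun n => R x' *
          ∫⁻ x : X d, ENNReal.ofReal (-w4 (e n) (x.1 - x'.1)) * R x) atTop := by
        refine lintegral_mono fun x' => ?_
        refine le_trans ?_ (ENNReal.le_liminf_mul)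
        refine mul_le_mul' ?_ (ballVol_mul_le_liminf hR he hlim x'.1)
        simp
    _ ≤ liminf (fun n => ∫⁻ x' : X d, R x' *
          ∫⁻ x : X d, ENNReal.ofReal (-w4 (e n) (x.1 - x'.1)) * R x) atTop :=
        lintegral_liminf_le fun n => by fun_prop
    _ = _ := by
        congr 1; funext n
        rw [Measure.volume_eq_prod (X d) (X d), lintegral_prod _ (by fun_prop)]
        congr 1; funext x'
        rw [← lintegral_const_mul _ (by fun_prop)]
        congr 1; funext x
        ring

theorem lintegral_eq_ofReal_pairing {ε : ℝ} (hε : 0 < ε) {ρ : X d → ℝ} (hρ : Integrable ρ)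
    (h0 : ∀ x, 0 ≤ ρ x) :
    ∫⁻ q : X d × X d, ENNReal.ofReal (ρ q.1) * ENNReal.ofReal (-w4 ε (q.2.1 - q.1.1))
      * ENNReal.ofReal (ρ q.2) = ENNReal.ofReal (-pairing (w4 ε) ρ ρ) := by
  have hI : Integrable fun q : X d × X d => -(ρ q.1 * w4 ε (q.2.1 - q.1.1) * ρ q.2) :=
    (integrable_pairing (bddW_w4 hε) hρ hρ).neg
  rw [pairing, ← integral_neg, ofReal_integral_eq_lintegral_ofReal hI]
  · congr 1; funext q
    rw [← ENNReal.ofReal_mul (h0 _), ← ENNReal.ofReal_mul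
      (mul_nonneg (h0 _) (neg_nonneg.2 w4_nonpos))]
    congr 1; ring
  · refine Eventually.of_forall fun q => ?_
    have := mul_nonneg (mul_nonneg (h0 q.1) (neg_nonneg.2 (w4_nonpos (ε := ε)
      (y := q.2.1 - q.1.1)))) (h0 q.2)
    simp only [Pi.zero_apply]
    linarith

theorem pairing_w4_nonpos {ε : ℝ} {ρ : X d → ℝ} (h0 : ∀ x, 0 ≤ ρ x) :
    pairing (w4 ε) ρ ρ ≤ 0 := by
  refine integral_nonpos fun q => ?_
  have := mul_nonneg (mul_nonneg (h0 q.1) (neg_nonneg.2 (w4_nonpos (ε := ε)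
    (y := q.2.1 - q.1.1)))) (h0 q.2)
  simp only [Pi.zero_apply]
  linarith

/-- The bi-Laplacian term controls the space-time integral of the squared mass in the limit. -/
theorem ballVol_mul_lintegral_le {ρ : ℝ → X d → ℝ} (hρ : Reg 1 T 0 ρ) (h0 : ∀ s x, 0 ≤ ρ s x)
    (he : ∀ n, 0 < e n) (hlim : Tendsto e atTop (𝓝 0)) (ht : t ∈ Icc 0 T) :
    ballVol * ∫⁻ s in Icc 0 t, ∫⁻ y, (∫⁻ z, ENNReal.ofReal (ρ s (y, z))) ^ 2 ≤
      liminf (fun n => ENNReal.ofReal (-stPairing t (w4 (e n)) ρ ρ)) atTop := by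
  have hV : ballVol ≠ ∞ := measure_closedBall_lt_top.ne
  have hI : ∀ n, IntegrableOn (fun s => pairing (w4 (e n)) (ρ s) (ρ s)) (Icc 0 t) := fun n =>
    integrableOn_pairing (Dom.of_bddW hρ (bddW_w4 (he n))) hρ ht.2
  calc ballVol * ∫⁻ s in Icc 0 t, ∫⁻ y, (∫⁻ z, ENNReal.ofReal (ρ s (y, z))) ^ 2
      = ∫⁻ s in Icc 0 t, ballVol * ∫⁻ y, (∫⁻ z, ENNReal.ofReal (ρ s (y, z))) ^ 2 :=
        (lintegral_const_mul' _ _ hV).symm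
    _ ≤ ∫⁻ s in Icc 0 t, liminf (fun n =>
          ENNReal.ofReal (-pairing (w4 (e n)) (ρ s) (ρ s))) atTop := by
        refine setLIntegral_mono' measurableSet_Icc fun s hs => ?_
        have hs' : s ∈ Icc 0 T := ⟨hs.1, hs.2.trans ht.2⟩
        have hc : Continuous fun x => ENNReal.ofReal (ρ s x) :=
          ENNReal.continuous_ofReal.comp (hρ.continuous hs')
        refine (ballVol_mul_lintegral_sq_le hc he hlim).trans (le_of_eq ?_)
        congr 1; funext n
        exact lintegral_eq_ofReal_pairing (he n) (hρ.integrable hs') (h0 s)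
    _ ≤ liminf (fun n => ∫⁻ s in Icc 0 t,
          ENNReal.ofReal (-pairing (w4 (e n)) (ρ s) (ρ s))) atTop :=
        lintegral_liminf_le' fun n => (hI n).aestronglyMeasurable.aemeasurable.neg.ennreal_ofReal
    _ = _ := by
        congr 1; funext n
        have hI' : IntegrableOn (fun s => -pairing (w4 (e n)) (ρ s) (ρ s)) (Icc 0 t) := (hI n).neg
        rw [← integral_pairing_eq_stPairing hρ hρ (bddW_w4 (he n)) ht.2, ← integral_neg,
          ofReal_integral_eq_lintegral_ofReal hI']
        exact Eventually.of_forall fun s => neg_nonneg.2 (pairing_w4_nonpos (h0 s))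

end

/-! ### The limit $\varepsilon\to0$ on the right-hand side. -/

noncomputable section

open Filter Topology

variable {d : ℕ} {T t s : ℝ} {f g : ℝ → X d → ℝ} {e : ℕ → ℝ}

theorem bddW_one : BddW fun _ : Y => (1 : ℝ) := ⟨measurable_const, 1, fun _ => by simp⟩

theorem abs_w2_le_abs {ε : ℝ} {y : Y} (hy : y ≠ 0) (j k : Fin 3) : |w2 ε j k y| ≤ 2 * |r 0 y| := by
  rw [abs_of_nonneg r_nonneg]
  exact (abs_w2_le j k).trans (by gcongr; exact r_le_r_zero hy)

theorem abs_w3_le_abs {ε : ℝ} {y : Y} (hy : y ≠ 0) (k : Fin 3) : |w3 ε k y| ≤ 5 * |r 0 y ^ 2| := by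
  rw [abs_of_nonneg (pow_nonneg r_nonneg 2)]
  refine (abs_w3_le k).trans ?_
  gcongr
  · exact r_nonneg
  · exact r_le_r_zero hy

theorem Dom.w2 (hf : Dom T f (r 0)) (j k : Fin 3) : Dom T f (w2 0 j k) :=
  hf.of_le (by fun_prop) fun _ hy => abs_w2_le_abs hy j k

theorem Dom.w3 (hf : Dom T f fun y => r 0 y ^ 2) (k : Fin 3) : Dom T f (w3 0 k) :=
  hf.of_le (by fun_prop) fun _ hy => abs_w3_le_abs hy k

theorem tendsto_stPairing_w1 (hf : Reg 1 T 0 f) (hg : Reg 1 T 0 g) (ht : t ≤ T)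
    (hlim : Tendsto e atTop (𝓝 0)) (k : Fin 3) :
    Tendsto (fun n => stPairing t (w1 (e n) k) f g) atTop (𝓝 (stPairing t (w1 0 k) f g)) :=
  tendsto_integral_kern (Dom.of_bddW hf bddW_one) hg ht (fun n => by fun_prop) (C := 1)
    (fun n y _ => by simpa using abs_w1_le k) fun y hy => (tendsto_w1 hy k).comp hlim

theorem tendsto_stPairing_w2 (hf : Dom T f (r 0)) (hg : Reg 1 T 0 g) (ht : t ≤ T)
    (hlim : Tendsto e atTop (𝓝 0)) (j k : Fin 3) :
    Tendsto (fun n => stPairing t (w2 (e n) j k) f g) atTop (𝓝 (stPairing t (w2 0 j k) f g)) :=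
  tendsto_integral_kern hf hg ht (fun n => by fun_prop) (C := 2)
    (fun n y hy => abs_w2_le_abs hy j k) fun y hy => (tendsto_w2 hy j k).comp hlim

theorem tendsto_stPairing_w3 (hf : Dom T f fun y => r 0 y ^ 2) (hg : Reg 1 T 0 g) (ht : t ≤ T)
    (hlim : Tendsto e atTop (𝓝 0)) (k : Fin 3) :
    Tendsto (fun n => stPairing t (w3 (e n) k) f g) atTop (𝓝 (stPairing t (w3 0 k) f g)) :=
  tendsto_integral_kern hf hg ht (fun n => by fun_prop) (C := 5)
    (fun n y hy => abs_w3_le_abs hy k) fun y hy => (tendsto_w3 hy k).comp hlim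

variable {h : Idx d → Idx d → ℝ → X d → ℝ} {u N : ℝ → X d → ℂ} {u₀ : X d → ℂ}

namespace RegData

theorem dom_massDensity_sq (H : RegData d T h u N) : Dom T (massDensity u) fun y => r 0 y ^ 2 :=
  dom_massDensity H.reg_two.pred

theorem dom_massDensity (H : RegData d T h u N) : Dom T (massDensity u) (r 0) :=
  dom_of_abs_le H.reg_two.pred H.hu.zero H.reg_two.massDensity.continuousOn fun s _ x => by
    rw [massDensity, abs_of_nonneg (by positivity)]
    nlinarith [norm_nonneg (u s x)]

/-- The coefficient is grouped with $\partial_\beta u$, which needs only an $L^2$ bound; Hardy is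
applied to the undifferentiated factor $u$. -/
theorem dom_err₁ (H : RegData d T h u N) (j : Fin 3) (β : Idx d) :
    Dom T (errDensity₁ u h j β) (r 0) := by
  have hv : Reg 2 T 0 (fun s x => (h (Sum.inl j) β s x : ℂ) * pd β (u s) x) :=
    (Reg.mul (by norm_num) (H.reg_coe _ _) (H.reg_pd β)).zero
  refine dom_of_abs_le H.reg_two.pred hv (H.reg_err₁ j β).continuousOn fun s _ x => ?_
  refine (Complex.abs_im_le_norm _).trans (le_of_eq ?_)
  rw [norm_mul, norm_mul, norm_mul, RCLike.norm_conj]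
  simp only [dx]; ring

theorem tendsto_regPotential (H : RegData d T h u N) (hs : s ∈ Icc 0 T)
    (hlim : Tendsto e atTop (𝓝 0)) :
    Tendsto (fun n => regPotential u (e n) s) atTop (𝓝 (regPotential u 0 s)) :=
  tendsto_finsetSum _ fun k _ => tendsto_pairing (H.reg_two.massDensity.integrable hs)
    ((H.reg_momDensity k).integrable hs) (fun n => by fun_prop) (C := 1)
    (fun n y => abs_w1_le k) fun y hy => (tendsto_w1 hy k).comp hlim

theorem tendsto_regRhs (H : RegData d T h u N) (ht : t ∈ Icc 0 T)
    (hlim : Tendsto e atTop (𝓝 0)) :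
    Tendsto (fun n => regRhs u N h t (e n)) atTop (𝓝 (regRhs u N h t 0)) := by
  have h0 : (0 : ℝ) ∈ Icc 0 T := ⟨le_rfl, ht.1.trans ht.2⟩
  have hρ := H.reg_two.massDensity.zero
  have hm := fun k => (H.reg_momDensity k).zero
  refine ((((((((H.tendsto_regPotential ht hlim).sub (H.tendsto_regPotential h0 hlim)).neg).add
    ?_).add ?_).add ?_).sub ?_).sub (Tendsto.const_mul 2 ?_)).add ?_
  · exact tendsto_finsetSum _ fun k _ =>
      tendsto_stPairing_w1 H.reg_massForcing.zero (hm k) ht.2 hlim k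
  · exact tendsto_finsetSum _ fun k _ => tendsto_stPairing_w1 hρ (H.reg_momF k) ht.2 hlim k
  · exact tendsto_finsetSum _ fun k _ => tendsto_finsetSum _ fun j _ => tendsto_finsetSum _
      fun β _ => tendsto_stPairing_w2 (H.dom_err₁ j β) (hm k) ht.2 hlim j k
  · exact tendsto_finsetSum _ fun j _ => tendsto_finsetSum _ fun β _ =>
      tendsto_stPairing_w3 H.dom_massDensity_sq (H.reg_err₂ j β).zero ht.2 hlim j
  · exact tendsto_finsetSum _ fun k _ => tendsto_finsetSum _ fun j _ => tendsto_finsetSum _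
      fun β _ => tendsto_stPairing_w2 H.dom_massDensity (H.reg_err₃ k j β).zero ht.2 hlim j k
  · exact tendsto_finsetSum _ fun k _ => tendsto_finsetSum _ fun α _ => tendsto_finsetSum _
      fun β _ => tendsto_stPairing_w1 hρ (H.reg_momE k α β).zero ht.2 hlim k

end RegData

theorem spaceTimeIntegral_eq {Φ : ℝ → Y → Y → ℝ} (hΦ : SpaceTimeIntegrable t Φ) (ht : 0 ≤ t) :
    spaceTimeIntegral t Φ =
      ∫ q : ℝ × (Y × Y), Φ q.1 q.2.1 q.2.2 ∂((volume.restrict (Icc 0 t)).prod volume) := by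
  rw [spaceTimeIntegral, intervalIntegral.integral_of_le ht, ← integral_Icc_eq_integral_Ioc]
  exact (integral_prod _ hΦ).symm

/-- Needed for the two forcing terms, whose integrands contain a scalar product over the three
components of $\nabla_ya$ and are therefore sums of kernels. -/
theorem spaceTime_sum {ι : Type*} [Fintype ι] {w : ι → Y → ℝ} {f g : ι → ℝ → X d → ℝ}
    (hk : ∀ i, Integrable (kern (w i) (f i) (g i)) (stMeasure d t)) (ht : 0 ≤ t)
    {Φ : ℝ → Y → Y → ℝ} (hΦ : ∀ s ∈ Icc 0 t, ∀ η y, y ≠ η →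
      Φ s η y = ∑ i, (∫ z, f i s (η, z)) * w i (y - η) * ∫ z, g i s (y, z)) :
    SpaceTimeIntegrable t Φ ∧ spaceTimeIntegral t Φ = ∑ i, stPairing t (w i) (f i) (g i) := by
  let Ψ : ι → ℝ → Y → Y → ℝ := fun i s η y =>
    (∫ z, f i s (η, z)) * w i (y - η) * ∫ z, g i s (y, z)
  have hi := fun i => spaceTime_of_kern (Φ := Ψ i) (hk i) ht fun _ _ _ _ _ => rfl
  have hae : (fun q : ℝ × (Y × Y) => ∑ i, Ψ i q.1 q.2.1 q.2.2)
      =ᵐ[(volume.restrict (Icc 0 t)).prod volume] fun q => Φ q.1 q.2.1 q.2.2 := by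
    have h1 : ∀ᵐ q : ℝ × (Y × Y) ∂((volume.restrict (Icc 0 t)).prod volume), q.2.2 ≠ q.2.1 :=
      Measure.quasiMeasurePreserving_snd.ae ae_snd_ne_fst
    have h2 : ∀ᵐ q : ℝ × (Y × Y) ∂((volume.restrict (Icc 0 t)).prod volume), q.1 ∈ Icc 0 t :=
      Measure.quasiMeasurePreserving_fst.ae (ae_restrict_mem measurableSet_Icc)
    filter_upwards [h1, h2] with q hq hq'
    exact (hΦ _ hq' _ _ hq).symm
  have hΦi : SpaceTimeIntegrable t Φ :=
    (integrable_finsetSum _ fun i _ => (hi i).1).congr hae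
  refine ⟨hΦi, ?_⟩
  rw [spaceTimeIntegral_eq hΦi ht, ← integral_congr_ae hae,
    integral_finsetSum _ fun i _ => (hi i).1]
  refine Finset.sum_congr rfl fun i _ => ?_
  rw [← spaceTimeIntegral_eq (hi i).1 ht, (hi i).2, stPairing]

theorem RegData.integrable_potentialIntegrand (H : RegData d T h u N) (hs : s ∈ Icc 0 T) :
    Integrable (fun p : Y × Y => potentialIntegrand u s p.1 p.2) ∧
      potential u s = regPotential u 0 s := by
  have hi := fun k : Fin 3 => integrable_pairing (bddW_w1 (ε := 0) k)
    (H.reg_two.massDensity.integrable hs) ((H.reg_momDensity k).integrable hs)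
  have hae : (fun p : Y × Y => ∑ k, (∫ z, massDensity u s (p.1, z)) * w1 0 k (p.2 - p.1)
      * ∫ z, momDensity u k s (p.2, z)) =ᵐ[volume]
      fun p => potentialIntegrand u s p.1 p.2 := by
    filter_upwards [ae_snd_ne_fst] with p hp
    rw [potentialIntegrand, Finset.mul_sum]
    refine Finset.sum_congr rfl fun k _ => ?_
    rw [pdY_a (sub_ne_zero.2 hp), ← mul_assoc]
    rfl
  refine ⟨(integrable_finsetSum _ fun k _ => integrable_zInt (hi k)).congr hae, ?_⟩
  rw [potential, ← integral_congr_ae hae, integral_finsetSum _ fun k _ => integrable_zInt (hi k)]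
  exact Finset.sum_congr rfl fun k _ => integral_zInt (hi k)

end

/-! ### Identification of the limit terms with those of the theorem. -/

noncomputable section

open Filter Topology

variable {d : ℕ} {T t s : ℝ} {h : Idx d → Idx d → ℝ → X d → ℝ} {u N : ℝ → X d → ℂ} {u₀ : X d → ℂ}

namespace RegData

theorem spaceTime_massForcing (H : RegData d T h u N) (ht : t ∈ Icc 0 T) :
    SpaceTimeIntegrable t (massForcing u N) ∧ spaceTimeIntegral t (massForcing u N) =
      ∑ k, stPairing t (w1 0 k) (imP N u) (momDensity u k) := by
  refine spaceTime_sum (fun k => integrable_kern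
    (Dom.of_bddW H.reg_massForcing.zero (bddW_w1 k)) (H.reg_momDensity k).zero ht.2) ht.1
    fun s _ η y hy => ?_
  rw [massForcing, Finset.mul_sum]
  refine Finset.sum_congr rfl fun k _ => ?_
  rw [pdY_a (sub_ne_zero.2 hy), ← mul_assoc]
  rfl

theorem spaceTime_momentumForcing (H : RegData d T h u N) (ht : t ∈ Icc 0 T) :
    SpaceTimeIntegrable t (momentumForcing u N) ∧ spaceTimeIntegral t (momentumForcing u N) =
      ∑ k, stPairing t (w1 0 k) (massDensity u) (momF u N k) := by
  refine spaceTime_sum (fun k => integrable_kern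
    (Dom.of_bddW H.reg_two.massDensity.zero (bddW_w1 k)) (H.reg_momF k) ht.2) ht.1
    fun s _ η y hy => ?_
  rw [momentumForcing, Finset.mul_sum]
  refine Finset.sum_congr rfl fun k _ => ?_
  rw [pdY_a (sub_ne_zero.2 hy), ← mul_assoc]
  rfl

theorem spaceTime_error₁ (H : RegData d T h u N) (ht : t ∈ Icc 0 T) (k j : Fin 3) (β : Idx d) :
    SpaceTimeIntegrable t (error₁ u h k j β) ∧ spaceTimeIntegral t (error₁ u h k j β) =
      stPairing t (w2 0 j k) (errDensity₁ u h j β) (momDensity u k) := by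
  refine spaceTime_of_kern (integrable_kern ((H.dom_err₁ j β).w2 j k)
    (H.reg_momDensity k).zero ht.2) ht.1 fun s _ η y hy => ?_
  rw [error₁, pdY_pdY_a (sub_ne_zero.2 hy)]
  rfl

theorem spaceTime_error₂ (H : RegData d T h u N) (ht : t ∈ Icc 0 T) (j : Fin 3) (β : Idx d) :
    SpaceTimeIntegrable t (error₂ u h j β) ∧ spaceTimeIntegral t (error₂ u h j β) =
      stPairing t (w3 0 j) (massDensity u) (errDensity₂ u h j β) := by
  refine spaceTime_of_kern (integrable_kern (H.dom_massDensity_sq.w3 j)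
    (H.reg_err₂ j β).zero ht.2) ht.1 fun s _ η y hy => ?_
  rw [error₂, lapY_pdY_a (sub_ne_zero.2 hy)]
  rfl

theorem spaceTime_error₃ (H : RegData d T h u N) (ht : t ∈ Icc 0 T) (k j : Fin 3) (β : Idx d) :
    SpaceTimeIntegrable t (error₃ u h k j β) ∧ spaceTimeIntegral t (error₃ u h k j β) =
      stPairing t (w2 0 j k) (massDensity u) (errDensity₃ u h k j β) := by
  refine spaceTime_of_kern (integrable_kern (H.dom_massDensity.w2 j k)
    (H.reg_err₃ k j β).zero ht.2) ht.1 fun s _ η y hy => ?_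
  rw [error₃, pdY_pdY_a (sub_ne_zero.2 hy)]
  rfl

theorem spaceTime_error₄ (H : RegData d T h u N) (ht : t ∈ Icc 0 T) (k : Fin 3) (α β : Idx d) :
    SpaceTimeIntegrable t (error₄ u h k α β) ∧ spaceTimeIntegral t (error₄ u h k α β) =
      stPairing t (w1 0 k) (massDensity u) (momE h u k α β) := by
  refine spaceTime_of_kern (integrable_kern (Dom.of_bddW H.reg_two.massDensity.zero (bddW_w1 k))
    (H.reg_momE k α β).zero ht.2) ht.1 fun s _ η y hy => ?_
  have hw : (y k - η k) / ‖y - η‖ = w1 0 k (y - η) := by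
    rw [w1, r_zero_eq, div_eq_mul_inv]; rfl
  rw [error₄, hw]
  rfl

theorem termsConverge (H : RegData d T h u N) (ht : t ∈ Icc 0 T) : TermsConverge u h N t where
  converge_potential _ hs := (H.integrable_potentialIntegrand ⟨hs.1, hs.2.trans ht.2⟩).1
  converge_massForcing := (H.spaceTime_massForcing ht).1
  converge_momentumForcing := (H.spaceTime_momentumForcing ht).1
  converge_error₁ k α β := (H.spaceTime_error₁ ht k α β).1
  converge_error₂ α β := (H.spaceTime_error₂ ht α β).1
  converge_error₃ k α β := (H.spaceTime_error₃ ht k α β).1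
  converge_error₄ k α β := (H.spaceTime_error₄ ht k α β).1

/-- The limit has signed error terms; taking absolute values term by term gives the stated form,
including the factor $2$ in front of the third kind of error. -/
theorem regRhs_zero_le (H : RegData d T h u N) (ht : t ∈ Icc 0 T) :
    regRhs u N h t 0 ≤ -(potential u t - potential u 0)
      + |spaceTimeIntegral t (massForcing u N)| + |spaceTimeIntegral t (momentumForcing u N)|
      + errorTerm u h t := by
  have h0 : (0 : ℝ) ∈ Icc 0 T := ⟨le_rfl, ht.1.trans ht.2⟩
  rw [regRhs, errorTerm, ← (H.spaceTime_massForcing ht).2, ← (H.spaceTime_momentumForcing ht).2,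
    ← (H.integrable_potentialIntegrand ht).2, ← (H.integrable_potentialIntegrand h0).2]
  simp only [← (H.spaceTime_error₁ ht _ _ _).2, ← (H.spaceTime_error₂ ht _ _).2,
    ← (H.spaceTime_error₃ ht _ _ _).2, ← (H.spaceTime_error₄ ht _ _ _).2]
  have e0 := le_abs_self (spaceTimeIntegral t (massForcing u N))
  have e0' := le_abs_self (spaceTimeIntegral t (momentumForcing u N))
  have e1 : ∑ k : Fin 3, ∑ j : Fin 3, ∑ β, spaceTimeIntegral t (error₁ u h k j β) ≤
      ∑ k : Fin 3, ∑ j : Fin 3, ∑ β, |spaceTimeIntegral t (error₁ u h k j β)| := by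
    gcongr; exact le_abs_self _
  have e2 : -∑ j : Fin 3, ∑ β, spaceTimeIntegral t (error₂ u h j β) ≤
      ∑ j : Fin 3, ∑ β, |spaceTimeIntegral t (error₂ u h j β)| := by
    simp only [← Finset.sum_neg_distrib]
    gcongr; exact neg_le_abs _
  have e3 : -∑ k : Fin 3, ∑ j : Fin 3, ∑ β, spaceTimeIntegral t (error₃ u h k j β) ≤
      ∑ k : Fin 3, ∑ j : Fin 3, ∑ β, |spaceTimeIntegral t (error₃ u h k j β)| := by
    simp only [← Finset.sum_neg_distrib]
    gcongr; exact neg_le_abs _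
  have e4 : ∑ k : Fin 3, ∑ α, ∑ β, spaceTimeIntegral t (error₄ u h k α β) ≤
      ∑ k : Fin 3, ∑ α, ∑ β, |spaceTimeIntegral t (error₄ u h k α β)| := by
    gcongr; exact le_abs_self _
  linarith

end RegData

end

/-! ### The mixed norm and the conclusion. -/

noncomputable section

open Filter Topology

variable {d : ℕ} {T t s : ℝ} {h : Idx d → Idx d → ℝ → X d → ℝ} {u N : ℝ → X d → ℂ} {u₀ : X d → ℂ}

/-- The mass `∫ |u|² dz`, as an extended nonnegative real. -/
def zMass (u : ℝ → X d → ℂ) (s : ℝ) (y : Y) : ℝ≥0∞ := ∫⁻ z : Z d, ‖u s (y, z)‖ₑ ^ 2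

theorem zMass_eq : zMass u s = fun y => 2 * ∫⁻ z, ENNReal.ofReal (massDensity u s (y, z)) := by
  funext y
  rw [zMass, ← lintegral_const_mul' _ _ (by norm_num)]
  congr 1; funext z
  rw [massDensity, ← ofReal_norm, ← ENNReal.ofReal_pow (norm_nonneg _),
    show (2 : ℝ≥0∞) = ENNReal.ofReal 2 by simp, ← ENNReal.ofReal_mul (by norm_num)]
  congr 1; ring

theorem aemeasurable_zMass
    (hu : ContinuousOn (fun q : ℝ × X d => u q.1 q.2) (Icc 0 T ×ˢ univ)) (ht : t ≤ T) :
    AEMeasurable (fun p : ℝ × Y => zMass u p.1 p.2) ((volume.restrict (Icc 0 t)).prod volume) := by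
  have hμ : (((volume : Measure ℝ).restrict (Icc 0 t)).prod (volume : Measure Y)).prod
      (volume : Measure (Z d)) =
      (volume : Measure ((ℝ × Y) × Z d)).restrict ((Icc 0 t ×ˢ univ) ×ˢ univ) := by
    rw [Measure.volume_eq_prod, Measure.volume_eq_prod, ← Measure.prod_restrict,
      ← Measure.prod_restrict, Measure.restrict_univ, Measure.restrict_univ]
  have hc : ContinuousOn (fun q : (ℝ × Y) × Z d => u q.1.1 (q.1.2, q.2))
      ((Icc 0 t ×ˢ univ) ×ˢ univ) :=
    hu.comp (f := fun q : (ℝ × Y) × Z d => (q.1.1, (q.1.2, q.2))) (by fun_prop)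
      fun q hq => ⟨⟨hq.1.1.1, hq.1.1.2.trans ht⟩, mem_univ _⟩
  have hm : AEMeasurable (fun q : (ℝ × Y) × Z d => ‖u q.1.1 (q.1.2, q.2)‖ₑ ^ 2)
      ((((volume : Measure ℝ).restrict (Icc 0 t)).prod (volume : Measure Y)).prod
      (volume : Measure (Z d))) := by
    rw [hμ]
    exact (hc.aestronglyMeasurable ((measurableSet_Icc.prod MeasurableSet.univ).prod
      MeasurableSet.univ)).enorm.pow_const 2
  exact hm.lintegral_prod_right'

theorem mixedNorm_pow_four
    (hu : ContinuousOn (fun q : ℝ × X d => u q.1 q.2) (Icc 0 T ×ˢ univ)) (ht : t ≤ T) :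
    mixedNorm u t ^ 4 = ∫⁻ s in Icc 0 t, ∫⁻ y, zMass u s y ^ 2 := by
  have h1 := eLpNorm_nnreal_pow_eq_lintegral (p := 4) (by norm_num)
    (μ := ((volume : Measure ℝ).restrict (Icc 0 t)).prod (volume : Measure Y))
    (f := fun p : ℝ × Y => eLpNorm (fun z : Z d => u p.1 (p.2, z)) 2 volume)
  have h2 : mixedNorm u t ^ 4 = ∫⁻ p : ℝ × Y, zMass u p.1 p.2 ^ 2
      ∂((volume.restrict (Icc 0 t)).prod volume) := by
    have h3 : ((4 : ℝ≥0) : ℝ) = ((4 : ℕ) : ℝ) := by norm_num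
    rw [h3, ENNReal.rpow_natCast] at h1
    refine Eq.trans h1 ?_
    congr 1; funext p
    rw [ENNReal.rpow_natCast, enorm_eq_self]
    have h4 := eLpNorm_nnreal_pow_eq_lintegral (p := 2) (by norm_num)
        (μ := (volume : Measure (Z d)))
      (f := fun z : Z d => u p.1 (p.2, z))
    have h5 : ((2 : ℝ≥0) : ℝ) = ((2 : ℕ) : ℝ) := by norm_num
    rw [h5, ENNReal.rpow_natCast] at h4
    simp only [ENNReal.rpow_natCast] at h4
    rw [zMass, ← h4, ← pow_mul]
    rfl
  rw [h2, lintegral_prod _ ((aemeasurable_zMass hu ht).pow_const 2)]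

theorem integral_norm_sq_eq_toReal (hu : Continuous (u s)) (y : Y) :
    ∫ z : Z d, ‖u s (y, z)‖ ^ 2 = (zMass u s y).toReal := by
  rw [integral_eq_lintegral_of_nonneg_ae (Eventually.of_forall fun z => by positivity)
    (by fun_prop), zMass]
  congr 2; funext z
  rw [ENNReal.ofReal_pow (norm_nonneg _), ofReal_norm]

/-- Finiteness is essential: a Bochner integral of a non-integrable function would be zero. It gives
finiteness for almost every time, and then for almost every $y$, before each conversion. -/
theorem integral_zMass_sq_eq
    (hu : ContinuousOn (fun q : ℝ × X d => u q.1 q.2) (Icc 0 T ×ˢ univ)) (ht : t ∈ Icc 0 T)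
    (hfin : ∫⁻ s in Icc 0 t, ∫⁻ y, zMass u s y ^ 2 ≠ ∞) :
    ∫ s in (0 : ℝ)..t, ∫ y : Y, (∫ z : Z d, ‖u s (y, z)‖ ^ 2) ^ 2 =
      (∫⁻ s in Icc 0 t, ∫⁻ y, zMass u s y ^ 2).toReal := by
  have hm := ((aemeasurable_zMass hu ht.2).pow_const 2)
  have hs := ae_lt_top' hm.lintegral_prod_right' hfin
  rw [intervalIntegral.integral_of_le ht.1, ← integral_Icc_eq_integral_Ioc,
    ← integral_toReal hm.lintegral_prod_right' hs]
  refine integral_congr_ae ?_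
  filter_upwards [hs, ae_restrict_mem measurableSet_Icc] with s hs hst
  have hc : Continuous (u s) := by
    have := hu.comp (f := fun x : X d => (s, x)) (s := univ) (by fun_prop)
      (fun x _ => ⟨⟨hst.1, hst.2.trans ht.2⟩, mem_univ _⟩)
    exact continuousOn_univ.1 this
  have hcm := hc.measurable
  have hm' : Measurable fun y => zMass u s y ^ 2 := by
    unfold zMass
    fun_prop
  rw [← integral_toReal hm'.aemeasurable (ae_lt_top hm' hs.ne)]
  congr 1; funext y
  rw [integral_norm_sq_eq_toReal hc, ENNReal.toReal_pow]

theorem ballVol_ne_zero : ballVol ≠ 0 :=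
  (Metric.measure_closedBall_pos volume (0 : Y) one_pos).ne'

theorem ballVol_ne_top : ballVol ≠ ∞ := measure_closedBall_lt_top.ne

/-- Both assertions are limits along $\varepsilon=1/(n+1)$ of the regularized estimate.
Nonnegativity comes from the sign of $\Delta^2a_\varepsilon$ and allows the later return from
extended to real numbers. The factor $4$ is due to $|u|^2=2\rho$. -/
theorem IsSolution.regRhs_zero_nonneg_and_le (hsol : IsSolution d T u₀ u h N) (ht : t ∈ Icc 0 T) :
    0 ≤ regRhs u N h t 0 ∧ ballVol * ∫⁻ s in Icc 0 t, ∫⁻ y, zMass u s y ^ 2 ≤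
      4 * ENNReal.ofReal (regRhs u N h t 0) := by
  have H := hsol.regData
  let e : ℕ → ℝ := fun n => 1 / ((n : ℝ) + 1)
  have he : ∀ n, 0 < e n := fun n => by positivity
  have hlim : Tendsto e atTop (𝓝 0) := tendsto_one_div_add_atTop_nhds_zero_nat
  have hR := H.tendsto_regRhs ht hlim
  have hρ := H.reg_two.massDensity.zero
  have h0 : ∀ s x, 0 ≤ massDensity u s x := fun s x => by unfold massDensity; positivity
  have hle := fun n => hsol.neg_stPairing_w4_le (he n) ht
  constructor
  · refine ge_of_tendsto' hR fun n => le_trans ?_ (hle n)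
    rw [← integral_pairing_eq_stPairing hρ hρ (bddW_w4 (he n)) ht.2, ← integral_neg]
    exact integral_nonneg fun s => neg_nonneg.2 (pairing_w4_nonpos (h0 s))
  · have h1 := ballVol_mul_lintegral_le hρ h0 he hlim ht
    have h2 : liminf (fun n => ENNReal.ofReal (-stPairing t (w4 (e n)) (massDensity u)
        (massDensity u))) atTop ≤ ENNReal.ofReal (regRhs u N h t 0) := by
      refine (liminf_le_liminf (Eventually.of_forall fun n =>
        ENNReal.ofReal_le_ofReal (hle n))).trans ?_
      exact ((ENNReal.continuous_ofReal.tendsto _).comp hR).liminf_eq.le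
    have h3 : ∫⁻ s in Icc 0 t, ∫⁻ y, zMass u s y ^ 2 = 4 *
        ∫⁻ s in Icc 0 t, ∫⁻ y, (∫⁻ z, ENNReal.ofReal (massDensity u s (y, z))) ^ 2 := by
      rw [← lintegral_const_mul' _ _ (by norm_num)]
      congr 1; funext s
      rw [← lintegral_const_mul' _ _ (by norm_num), zMass_eq]
      congr 1; funext y
      rw [mul_pow]; norm_num
    rw [h3, mul_left_comm]
    gcongr
    exact h1.trans h2

end

end QNLS

theorem theoremA1 :
    ∃ C : ℝ, 0 < C ∧
      ∀ (d : ℕ), 3 ≤ d →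
      ∀ (T : ℝ), 0 < T →
      ∀ (u₀ : QNLS.X d → ℂ) (u : ℝ → QNLS.X d → ℂ)
        (h : QNLS.Idx d → QNLS.Idx d → ℝ → QNLS.X d → ℝ) (N : ℝ → QNLS.X d → ℂ),
        QNLS.IsSolution d T u₀ u h N →
        ∀ t ∈ Set.Icc 0 T,
          QNLS.TermsConverge u h N t ∧
          QNLS.mixedNorm u t ^ 4
            = ENNReal.ofReal
                (∫ s in (0 : ℝ)..t, ∫ y : QNLS.Y, (∫ z : QNLS.Z d, ‖u s (y, z)‖ ^ 2) ^ 2) ∧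
          (∫ s in (0 : ℝ)..t, ∫ y : QNLS.Y, (∫ z : QNLS.Z d, ‖u s (y, z)‖ ^ 2) ^ 2)
            ≤ C * (-(QNLS.potential u t - QNLS.potential u 0)
                + |QNLS.spaceTimeIntegral t (QNLS.massForcing u N)|
                + |QNLS.spaceTimeIntegral t (QNLS.momentumForcing u N)|
                + QNLS.errorTerm u h t) := by
  have hV : 0 < QNLS.ballVol.toReal :=
    ENNReal.toReal_pos QNLS.ballVol_ne_zero QNLS.ballVol_ne_top
  -- The $4$ comes from $\rho=|u|^2/2$ squared, and the volume of the unit ball of $\mathbb R^3$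
  -- from the lower bound for $-\Delta^2a_\varepsilon$. Neither depends on $d$, $T$ or the solution.
  refine ⟨4 / QNLS.ballVol.toReal, by positivity, ?_⟩
  intro d _ T _ u₀ u h N hsol t ht
  have H := hsol.regData
  obtain ⟨h0, hle⟩ := hsol.regRhs_zero_nonneg_and_le ht
  have hu := H.hu.continuousOn
  -- The norm is finite because the right-hand side of the limit estimate is a real number and the
  -- ball has positive volume.
  have hfin : ∫⁻ s in Icc 0 t, ∫⁻ y, QNLS.zMass u s y ^ 2 ≠ ∞ := fun htop => by
    rw [htop, ENNReal.mul_top QNLS.ballVol_ne_zero] at hle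
    exact ENNReal.mul_ne_top (by norm_num) ENNReal.ofReal_ne_top (top_le_iff.1 hle)
  rw [QNLS.integral_zMass_sq_eq hu ht hfin]
  refine ⟨H.termsConverge ht, ?_, ?_⟩
  · rw [QNLS.mixedNorm_pow_four hu ht.2, ENNReal.ofReal_toReal hfin]
  · refine le_trans ?_ (mul_le_mul_of_nonneg_left (H.regRhs_zero_le ht) (by positivity))
    have h1 := ENNReal.toReal_mono (ENNReal.mul_ne_top (by norm_num) ENNReal.ofReal_ne_top) hle
    rw [ENNReal.toReal_mul, ENNReal.toReal_mul, ENNReal.toReal_ofReal h0] at h1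
    rw [div_mul_eq_mul_div, le_div_iff₀ hV, mul_comm]
    simpa using h1
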